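/- Let $\sigma(t)=\max\{t,0\}$. A deep ReLU network $\Phi$ with input dimension $d$ and $L\ge 2$ layers is a sequence $((W^1,b^1),\dots,(W^L,b^L))$ with $W^\ell\in\mathbb R^{N_\ell\times N_{\ell-1}}$, $b^\ell\in\mathbb R^{N_\ell}$, $N_0=d$, $N_L=1$, $N_\ell\ge 1$; its output is $\mathcal N(\Phi,x)=z^L$, where $z^0=x$, $z^\ell=\sigma(W^\ell z^{\ell-1}+b^\ell)$ componentwise for $1\le\ell\le L-1$, and $z^L=W^Lz^{L-1}+b^L$. Its depth is $L$ and its width is $N_w=\max_{0\le\ell\le L}N_\ell$. An architecture $\mathbb A$ is such a sequence with all entries in $\{0,1\}$; $\Phi$ has architecture $\mathbb A$ if it has the same dimensions $N_0,\dots,N_L$ and every weight that is zero in $\mathbb A$ is zero in $\Phi$. For $0<\alpha\le 2$, let $\mathring U^\alpha_\infty$ be the set of continuous functions $f$ on $[0,1]^d$ that vanish on the boundary of the cube and satisfy $$\max_{u\subset\{1,\dots,d\}}\ \sup_{h}\ \prod_{i\in u}h_i^{-\alpha}\ \sup_{x}|\Delta_h^{2,u}f(x)|\le 1,$$ where $h_i>0$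 for $i\in u$, where $x$ runs through the points of $[0,1]^d$ with $x_i+2h_i\le 1$ for $i\in u$, and where $\Delta^{2,u}_h$ is the composition over $i\in u$ of the second differences $f\mapsto f(\cdot+2h_ie_i)-2f(\cdot+h_ie_i)+f$. For $1\le p\le\infty$, let $\mathring W^1_p$ be the space of functions in $L_p([0,1]^d)$ with weak partial derivatives in $L_p$ and with zero trace on the boundary, normed by $\|f\|_{\mathring W^1_p}=\big(\sum_{i=1}^d\|\partial_if\|_{L_p}^p\big)^{1/p}$ for $p<\infty$ and $\|f\|_{\mathring W^1_\infty}=\max_i\|\partial_if\|_{L_\infty}$. For $d\ge 2$, $1<\alpha\le 2$, $\beta>\alpha$ and $1\le p\le\infty$ put, with $(p+1)^{t/p}:=1$ for $p=\infty$, $$K_1=2(p+1)^{\frac1p}\max\Big\{\tfrac{2\beta}{\beta-1},\tfrac1{2^{\alpha-1}-1}\Big\},\qquad \varepsilon_0=\min\Big\{1,\ \frac{d}{2^{\alpha d}(1-2^{1-\alpha})},\ \frac{K_1d^2}{(p+1)^{d/p}\,2^{(\alpha+1)d}\big(1-2^{-\frac{\beta-\alpha}{\beta-1}}\big)^d}\Big\},$$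 $$B=B(d,\alpha,\beta,p)=\big(1-2^{-\frac1{\beta-1}}\big)\Big(\frac{(p+1)^{\frac1p}\,2^{\alpha+1}\big(1-2^{-\frac{\beta-\alpha}{\beta-1}}\big)}{d^{2\alpha/d}}\Big)^{\frac1{\alpha-1}}.$$ There is an absolute constant $K_4>0$, and for all $1<\alpha\le 2$, $\beta>\alpha$, $1\le p\le\infty$ there is a constant $K_5=K_5(\alpha,\beta,p)>0$, such that for every $d\ge 2$ and every $\varepsilon\in(0,\varepsilon_0)$ there is an architecture $\mathbb A^*_\varepsilon$ with input dimension $d$ such that $$N_w(\mathbb A^*_\varepsilon)\le K_4d,\qquad L(\mathbb A^*_\varepsilon)\le K_5\,B^{-d}\,(\varepsilon^{-1})^{\frac1{\alpha-1}}\max\{1,\log_2(\varepsilon^{-1})\},$$ and for every $f\in\mathring U^\alpha_\infty$ there is a deep ReLU network $\Phi_f^*$ with architecture $\mathbb A^*_\varepsilon$ for which $f-\mathcal N(\Phi_f^*,\cdot)\in\mathring W^1_p$ and $$\|f-\mathcal N(\Phi_f^*,\cdot)\|_{\mathring W^1_p}\le\varepsilon .$$ -/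

import Mathlib

open MeasureTheory
open scoped ENNReal ContDiff Matrix

noncomputable section

namespace DeepReLU

/-! ### Neural networks -/

/-- The dimensions `(N 0, …, N L)` of a network with input dimension `d`, scalar output and
`L = hidden + 1 ≥ 2` layers. Only the values `N ℓ` with `ℓ ≤ L` are relevant. -/
structure NetShape (d : ℕ) where
  hidden : ℕ
  one_le_hidden : 1 ≤ hidden
  N : ℕ → ℕ
  N_input : N 0 = d
  N_output : N (hidden + 1) = 1
  N_pos : ∀ ℓ, 1 ≤ ℓ → ℓ ≤ hidden → 1 ≤ N ℓ

/-- The depth `L`: the number of layers. -/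
def NetShape.depth {d : ℕ} (D : NetShape d) : ℕ := D.hidden + 1

/-- The width `max_{0 ≤ ℓ ≤ L} N ℓ`. -/
def NetShape.width {d : ℕ} (D : NetShape d) : ℕ :=
  (Finset.range (D.depth + 1)).sup D.N

/-- A neural network with dimensions `D`. The pair `(W ℓ, b ℓ)`, `0 ≤ ℓ < L`, holds the edge and
node weights leading from layer `ℓ` to layer `ℓ + 1`; the values at `ℓ ≥ L` are irrelevant. -/
structure Net {d : ℕ} (D : NetShape d) where
  W : (ℓ : ℕ) → Matrix (Fin (D.N (ℓ + 1))) (Fin (D.N ℓ)) ℝ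
  b : (ℓ : ℕ) → Fin (D.N (ℓ + 1)) → ℝ

/-- A network architecture is a network all of whose weights are `0` or `1`. -/
def Net.IsArchitecture {d : ℕ} {D : NetShape d} (A : Net D) : Prop :=
  ∀ ℓ < D.depth, (∀ i j, A.W ℓ i j = 0 ∨ A.W ℓ i j = 1) ∧ ∀ i, A.b ℓ i = 0 ∨ A.b ℓ i = 1

/-- `Φ` has architecture `A`: the dimensions agree (by typing), and every weight that vanishes
in `A` vanishes in `Φ`. -/
def Net.HasArchitecture {d : ℕ} {D : NetShape d} (Φ A : Net D) : Prop :=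
  ∀ ℓ < D.depth, (∀ i j, A.W ℓ i j = 0 → Φ.W ℓ i j = 0) ∧ ∀ i, A.b ℓ i = 0 → Φ.b ℓ i = 0

/-- The vector `z ^ ℓ` of the ReLU computation scheme; it is used for `ℓ < L` only. -/
def Net.layer {d : ℕ} {D : NetShape d} (Φ : Net D) (x : Fin d → ℝ) : (ℓ : ℕ) → Fin (D.N ℓ) → ℝ
  | 0 => fun i => x (Fin.cast D.N_input i)
  | ℓ + 1 => fun i => max ((Φ.W ℓ *ᵥ Φ.layer x ℓ) i + Φ.b ℓ i) 0

/-- The output of the ReLU network `Φ` at `x`: the last layer carries no activation. -/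
def Net.output {d : ℕ} {D : NetShape d} (Φ : Net D) (x : Fin d → ℝ) : ℝ :=
  (Φ.W D.hidden *ᵥ Φ.layer x D.hidden) (Fin.cast D.N_output.symm 0) +
    Φ.b D.hidden (Fin.cast D.N_output.symm 0)

/-! ### Hölder–Zygmund functions of mixed smoothness -/

/-- The closed unit cube. -/
def cube (d : ℕ) : Set (Fin d → ℝ) := Set.Icc 0 1

/-- The univariate second difference operator with step `h` acting in the `i`-th variable:
`f ↦ (x ↦ f (x + 2 h eᵢ) - 2 f (x + h eᵢ) + f x)`. -/
def secondDiff {d : ℕ} (i : Fin d) (h : ℝ) : Module.End ℝ ((Fin d → ℝ) → ℝ) where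
  toFun f x := f (x + Pi.single i (2 * h)) - 2 * f (x + Pi.single i h) + f x
  map_add' f g := by ext x; simp only [Pi.add_apply]; ring
  map_smul' c f := by ext x; simp only [Pi.smul_apply, smul_eq_mul, RingHom.id_apply]; ring

theorem secondDiff_commute {d : ℕ} (i j : Fin d) (h k : ℝ) :
    Commute (secondDiff i h) (secondDiff j k) := by
  refine LinearMap.ext fun f => funext fun x => ?_
  simp only [Module.End.mul_apply, secondDiff, LinearMap.coe_mk, AddHom.coe_mk]
  simp only [add_right_comm x (Pi.single j _) (Pi.single i _)]
  ring

/-- The mixed difference operator: the product over `i ∈ u` of the second differences with step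
`h i` in the `i`-th variable (the identity if `u = ∅`). -/
def mixedDiff {d : ℕ} (u : Finset (Fin d)) (h : Fin d → ℝ) : Module.End ℝ ((Fin d → ℝ) → ℝ) :=
  u.noncommProd (fun i => secondDiff i (h i)) fun _ _ _ _ _ => secondDiff_commute _ _ _ _

/-- The points `x` of the cube with `x i + 2 h i ∈ [0, 1]` for all `i ∈ u`. -/
def diffDomain {d : ℕ} (u : Finset (Fin d)) (h : Fin d → ℝ) : Set (Fin d → ℝ) :=
  {x | x ∈ cube d ∧ ∀ i ∈ u, x i + 2 * h i ∈ Set.Icc (0 : ℝ) 1}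

/-- The Hölder–Zygmund norm of mixed smoothness `α`, with values in `[0, ∞]`. -/
def holderNorm {d : ℕ} (α : ℝ) (f : (Fin d → ℝ) → ℝ) : ℝ≥0∞ :=
  ⨆ (u : Finset (Fin d)) (h : Fin d → ℝ) (_ : ∀ i ∈ u, 0 < h i) (x ∈ diffDomain u h),
    ENNReal.ofReal ((∏ i ∈ u, h i ^ (-α)) * |mixedDiff u h f x|)

/-- The closed unit ball of the Hölder–Zygmund space of mixed smoothness `α` on the cube with
homogeneous boundary condition. Only the values of `f` on the cube matter. -/
structure InUnitBall {d : ℕ} (α : ℝ) (f : (Fin d → ℝ) → ℝ) : Prop where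
  continuousOn : ContinuousOn f (cube d)
  boundary : ∀ x ∈ cube d, (∃ j, x j = 0 ∨ x j = 1) → f x = 0
  norm_le_one : holderNorm α f ≤ 1

/-! ### The Sobolev space with homogeneous boundary condition -/

/-- `g` is the weak partial derivative of `f` in the `i`-th variable on the open unit cube. -/
def IsWeakPartial {d : ℕ} (i : Fin d) (f g : (Fin d → ℝ) → ℝ) : Prop :=
  ∀ φ : (Fin d → ℝ) → ℝ, ContDiff ℝ ∞ φ → HasCompactSupport φ →
    tsupport φ ⊆ Set.univ.pi (fun _ => Set.Ioo (0 : ℝ) 1) →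
    ∫ x in cube d, f x * fderiv ℝ φ x (Pi.single i 1) = -∫ x in cube d, g x * φ x

/-- `f` has trace zero on the boundary of the cube, where `g` is the weak gradient of `f`: in
Green's formula `∫ f ∂ᵢφ + ∫ gᵢ φ = ∫_{∂} (tr f) φ νᵢ` the boundary term vanishes for all `i` and
all smooth `φ`, whether or not `φ` vanishes near the boundary. -/
def HasZeroTrace {d : ℕ} (f : (Fin d → ℝ) → ℝ) (g : Fin d → (Fin d → ℝ) → ℝ) : Prop :=
  ∀ (i : Fin d) (φ : (Fin d → ℝ) → ℝ), ContDiff ℝ ∞ φ → HasCompactSupport φ →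
    (∫ x in cube d, f x * fderiv ℝ φ x (Pi.single i 1)) + ∫ x in cube d, g i x * φ x = 0

/-- `f` belongs to the Sobolev space of order one and exponent `p` on the cube, with zero trace,
and `g` is its weak gradient. -/
structure IsW10Gradient {d : ℕ} (p : ℝ≥0∞) (f : (Fin d → ℝ) → ℝ)
    (g : Fin d → (Fin d → ℝ) → ℝ) : Prop where
  memLp : MemLp f p (volume.restrict (cube d))
  memLp_grad : ∀ i, MemLp (g i) p (volume.restrict (cube d))
  weak : ∀ i, IsWeakPartial i f (g i)
  trace : HasZeroTrace f g

/-- Membership in the Sobolev space with homogeneous boundary condition. -/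
def MemW10 {d : ℕ} (p : ℝ≥0∞) (f : (Fin d → ℝ) → ℝ) : Prop :=
  ∃ g : Fin d → (Fin d → ℝ) → ℝ, IsW10Gradient p f g

/-- The expression `(∑ᵢ ∫ |gᵢ|^p)^(1/p)`, resp. `maxᵢ ess sup |gᵢ|` for `p = ∞`. -/
def gradNorm {d : ℕ} (p : ℝ≥0∞) (g : Fin d → (Fin d → ℝ) → ℝ) : ℝ≥0∞ :=
  if p = ⊤ then ⨆ i, essSup (fun x => ‖g i x‖ₑ) (volume.restrict (cube d))
  else (∑ i, ∫⁻ x in cube d, ‖g i x‖ₑ ^ p.toReal) ^ (1 / p.toReal)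

/-- The norm of the Sobolev space with homogeneous boundary condition, i.e. the norm of the weak
gradient (which is unique up to null sets); it is `∞` for a function outside of the space. -/
def w10Norm {d : ℕ} (p : ℝ≥0∞) (f : (Fin d → ℝ) → ℝ) : ℝ≥0∞ :=
  ⨅ (g : Fin d → (Fin d → ℝ) → ℝ) (_ : IsW10Gradient p f g), gradNorm p g

/-! ### The constants -/

/-- `(p + 1)^(t / p)`, with its limit `1` at `p = ∞`. -/
def pPow (p : ℝ≥0∞) (t : ℝ) : ℝ :=
  if p = ⊤ then 1 else (p.toReal + 1) ^ (t / p.toReal)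

/-- `1 - 2^(-(β - α)/(β - 1))`. -/
def gap (α β : ℝ) : ℝ := 1 - (2 : ℝ) ^ (-((β - α) / (β - 1)))

def K₁ (α β : ℝ) (p : ℝ≥0∞) : ℝ :=
  2 * pPow p 1 * max (2 * β / (β - 1)) (1 / ((2 : ℝ) ^ (α - 1) - 1))

def ε₀ (d : ℕ) (α β : ℝ) (p : ℝ≥0∞) : ℝ :=
  min 1 (min (d / ((2 : ℝ) ^ (α * d) * (1 - (2 : ℝ) ^ (1 - α))))
    (K₁ α β p * d ^ 2 / (pPow p d * (2 : ℝ) ^ ((α + 1) * d) * gap α β ^ d)))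

def B (d : ℕ) (α β : ℝ) (p : ℝ≥0∞) : ℝ :=
  (1 - (2 : ℝ) ^ (-(1 / (β - 1)))) *
    (pPow p 1 * (2 : ℝ) ^ (α + 1) * gap α β / (d : ℝ) ^ (2 * α / d)) ^ (1 / (α - 1))

end DeepReLU

end

namespace DeepReLU

/-!
Functions in the unit ball are expanded in the Faber series of tensor products of hat functions. The
mixed second differences bound the coefficients of level `k` by `2⁻ᵈ 2^(-α (|k|₁ + d))`, hence the
energy-type sparse grid of size `m`, which also penalizes the difference of `|k|₁` and the largest
entry of `k`, needs of the order of `2ᵐ` terms, without a factor `m^(d - 1)`, for an error of the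
order of `2^(-(α - 1) m)` in the Sobolev norm. Each tensor product is approximated with a relative
error of the order of `d 2⁻ᴹ` by multiplying the hat functions one after another, where products are
obtained from squares and squares from iterated tent maps. The network computes the terms one after
another: `d` neurons of each layer carry the input and twelve the computation, so that the width is
of the order of `d`, and the depth of the order of the number of terms times `d M`.
-/

noncomputable section

open Function
open scoped unitInterval

/-! ### Approximate multiplication -/

/-- The tent map on `[0, 1]`, written as an affine combination of ReLU units. -/
def tent (t : ℝ) : ℝ := 2 * t - 4 * max (t - 1 / 2) 0

lemma mapsTo_tent : Set.MapsTo tent I I := by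
  rintro t ⟨h0, h1⟩
  unfold tent
  rcases max_cases (t - 1 / 2) 0 with h | h <;> constructor <;> linarith

lemma tent_zero : tent 0 = 0 := by norm_num [tent]

lemma tent_one : tent 1 = 0 := by norm_num [tent]

lemma abs_tent_sub_tent_le (s t : ℝ) : |tent s - tent t| ≤ 2 * |s - t| := by
  unfold tent
  rcases max_cases (t - 1 / 2) 0 with h | h <;> rcases max_cases (s - 1 / 2) 0 with h' | h' <;>
  rcases abs_cases (s - t) with h'' | h'' <;> rw [abs_le] <;> constructor <;> linarith

lemma sub_sq_eq_tent (t : ℝ) : t - t ^ 2 = (tent t - tent t ^ 2 + tent t) / 4 := by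
  unfold tent
  rcases max_cases (t - 1 / 2) 0 with h | h <;> rw [h.1] <;> ring

/-- The partial sums of the expansion `t - t ^ 2 = ∑ tent^[j] t / 4 ^ j` over `j ≥ 1`, which
converges on `[0, 1]`. -/
def parabolaApprox (M : ℕ) (t : ℝ) : ℝ := ∑ j ∈ Finset.range M, tent^[j + 1] t / 4 ^ (j + 1)

lemma parabolaApprox_zero_left (t : ℝ) : parabolaApprox 0 t = 0 := Finset.sum_range_zero _

lemma parabolaApprox_succ (M : ℕ) (t : ℝ) :
    parabolaApprox (M + 1) t = parabolaApprox M t + tent^[M + 1] t / 4 ^ (M + 1) :=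
  Finset.sum_range_succ _ _

lemma parabolaApprox_succ' (M : ℕ) (t : ℝ) :
    parabolaApprox (M + 1) t = (parabolaApprox M (tent t) + tent t) / 4 := by
  simp only [parabolaApprox, Finset.sum_range_succ', add_div, Finset.sum_div, div_div, ← pow_succ,
    iterate_succ_apply, zero_add, pow_one, iterate_zero_apply]

lemma parabolaApprox_zero_right (M : ℕ) : parabolaApprox M 0 = 0 := by
  simp [parabolaApprox, iterate_fixed tent_zero]

lemma parabolaApprox_one_right (M : ℕ) : parabolaApprox M 1 = 0 := by
  simp [parabolaApprox, tent_one, iterate_fixed tent_zero]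

lemma abs_parabolaApprox_sub_le (M : ℕ) (s t : ℝ) :
    |parabolaApprox M s - parabolaApprox M t| ≤ |s - t| := by
  induction M generalizing s t with
  | zero => simp [parabolaApprox]
  | succ M ih =>
    calc |parabolaApprox (M + 1) s - parabolaApprox (M + 1) t|
        = |(parabolaApprox M (tent s) - parabolaApprox M (tent t)) + (tent s - tent t)| / 4 := by
          rw [parabolaApprox_succ', parabolaApprox_succ', ← sub_div, abs_div,
            abs_of_pos (four_pos : (0 : ℝ) < 4), add_sub_add_comm]
      _ ≤ (|tent s - tent t| + |tent s - tent t|) / 4 := by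
          gcongr; exact (abs_add_le _ _).trans (add_le_add_left (ih _ _) _)
      _ ≤ |s - t| := by linarith [abs_tent_sub_tent_le s t]

lemma abs_parabolaApprox_error_sub_le (M : ℕ) {s t : ℝ} (hs : s ∈ I) (ht : t ∈ I) :
    |(s - s ^ 2 - parabolaApprox M s) - (t - t ^ 2 - parabolaApprox M t)|
      ≤ (1 / 2) ^ M * |s - t| := by
  induction M generalizing s t with
  | zero =>
    have hle : |1 - s - t| ≤ 1 := abs_le.2 ⟨by linarith [hs.2, ht.2], by linarith [hs.1, ht.1]⟩
    calc _ = |1 - s - t| * |s - t| := by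
          rw [parabolaApprox_zero_left, parabolaApprox_zero_left, ← abs_mul]; ring_nf
      _ ≤ (1 / 2) ^ 0 * |s - t| := by rw [pow_zero]; gcongr
  | succ M ih =>
    have hrec (r : ℝ) : r - r ^ 2 - parabolaApprox (M + 1) r
        = (tent r - tent r ^ 2 - parabolaApprox M (tent r)) / 4 := by
      rw [parabolaApprox_succ', sub_sq_eq_tent]; ring
    rw [hrec, hrec, ← sub_div, abs_div, abs_of_pos (four_pos : (0 : ℝ) < 4)]
    calc _ ≤ (1 / 2) ^ M * (2 * |s - t|) / 4 := by
          gcongr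
          exact (ih (mapsTo_tent hs) (mapsTo_tent ht)).trans
            (by gcongr; exact abs_tent_sub_tent_le s t)
      _ = (1 / 2) ^ (M + 1) * |s - t| := by ring

/-- The ReLU approximation of the product of `a, b ∈ [0, 1]`. It comes from the identity
`a b = min a b - (s - s ^ 2) + (r - r ^ 2)` with `s = (a + b) / 2` and `r = |a - b| / 2`. -/
def mulApprox (M : ℕ) (a b : ℝ) : ℝ :=
  min a b - parabolaApprox M ((a + b) / 2) + parabolaApprox M (|a - b| / 2)

lemma mulApprox_comm (M : ℕ) (a b : ℝ) : mulApprox M a b = mulApprox M b a := by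
  rw [mulApprox, mulApprox, min_comm, add_comm a b, abs_sub_comm]

lemma mulApprox_zero_left (M : ℕ) {b : ℝ} (hb : 0 ≤ b) : mulApprox M 0 b = 0 := by
  simp [mulApprox, min_eq_left hb, abs_of_nonneg hb]

lemma mulApprox_zero_right (M : ℕ) {a : ℝ} (ha : 0 ≤ a) : mulApprox M a 0 = 0 := by
  rw [mulApprox_comm, mulApprox_zero_left M ha]

lemma mulApprox_succ (M : ℕ) (a b : ℝ) :
    mulApprox (M + 1) a b = mulApprox M a b - tent^[M + 1] ((a + b) / 2) / 4 ^ (M + 1)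
      + tent^[M + 1] (|a - b| / 2) / 4 ^ (M + 1) := by
  simp only [mulApprox, parabolaApprox_succ]; ring

lemma half_add_mem {a b : ℝ} (ha : a ∈ I) (hb : b ∈ I) : (a + b) / 2 ∈ I :=
  ⟨by linarith [ha.1, hb.1], by linarith [ha.2, hb.2]⟩

lemma half_abs_sub_mem {a b : ℝ} (ha : a ∈ I) (hb : b ∈ I) : |a - b| / 2 ∈ I :=
  ⟨by positivity, by linarith [abs_sub_le_of_le_of_le ha.1 ha.2 hb.1 hb.2]⟩

lemma min_eq_half_sub (a b : ℝ) : min a b = (a + b) / 2 - |a - b| / 2 := by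
  rcases le_total a b with h | h
  · rw [min_eq_left h, abs_of_nonpos (sub_nonpos.2 h)]; ring
  · rw [min_eq_right h, abs_of_nonneg (sub_nonneg.2 h)]; ring

lemma mulApprox_mem (M : ℕ) {a b : ℝ} (ha : a ∈ I) (hb : b ∈ I) : mulApprox M a b ∈ I := by
  have hmin : 0 ≤ (a + b) / 2 - |a - b| / 2 := min_eq_half_sub a b ▸ le_min ha.1 hb.1
  have h_sum := half_add_mem ha hb
  have h_diff := half_abs_sub_mem ha hb
  have h₁ := abs_parabolaApprox_sub_le M ((a + b) / 2) (|a - b| / 2)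
  have h₂ := abs_parabolaApprox_sub_le M 1 ((a + b) / 2)
  have h₃ := abs_parabolaApprox_sub_le M (|a - b| / 2) 0
  rw [abs_of_nonneg hmin, abs_le] at h₁
  rw [parabolaApprox_one_right, abs_of_nonneg (sub_nonneg.2 h_sum.2), abs_le] at h₂
  rw [parabolaApprox_zero_right, sub_zero, sub_zero, abs_of_nonneg h_diff.1, abs_le] at h₃
  rw [mulApprox, min_eq_half_sub]
  constructor <;> linarith

lemma mulApprox_sub_mul (M : ℕ) (a b : ℝ) :
    mulApprox M a b - a * b
      = ((a + b) / 2 - ((a + b) / 2) ^ 2 - parabolaApprox M ((a + b) / 2))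
        - (|a - b| / 2 - (|a - b| / 2) ^ 2 - parabolaApprox M (|a - b| / 2)) := by
  rw [mulApprox, min_eq_half_sub]
  linear_combination (-1 / 4) * sq_abs (a - b)

lemma abs_mulApprox_error_sub_left_le (M : ℕ) {a a' b : ℝ} (ha : a ∈ I) (ha' : a' ∈ I)
    (hb : b ∈ I) :
    |(mulApprox M a b - a * b) - (mulApprox M a' b - a' * b)| ≤ (1 / 2) ^ M * |a - a'| := by
  have h_sum : |(a + b) / 2 - (a' + b) / 2| = |a - a'| / 2 := by
    rw [← sub_div, add_sub_add_right_eq_sub, abs_div, abs_two]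
  have h_diff : |(|a - b| / 2 - |a' - b| / 2)| ≤ |a - a'| / 2 := by
    rw [← sub_div, abs_div, abs_two, ← sub_sub_sub_cancel_right a a' b]
    exact div_le_div_of_nonneg_right (abs_abs_sub_abs_le_abs_sub _ _) zero_le_two
  rw [mulApprox_sub_mul, mulApprox_sub_mul, sub_sub_sub_comm]
  rw [← Real.norm_eq_abs]
  calc _ ≤ (1 / 2) ^ M * |(a + b) / 2 - (a' + b) / 2|
        + (1 / 2) ^ M * |(|a - b| / 2 - |a' - b| / 2)| :=
        norm_sub_le_of_le
          (abs_parabolaApprox_error_sub_le M (half_add_mem ha hb) (half_add_mem ha' hb))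
          (abs_parabolaApprox_error_sub_le M (half_abs_sub_mem ha hb) (half_abs_sub_mem ha' hb))
    _ ≤ (1 / 2) ^ M * (|a - a'| / 2) + (1 / 2) ^ M * (|a - a'| / 2) := by rw [h_sum]; gcongr
    _ = (1 / 2) ^ M * |a - a'| := by ring

lemma abs_mulApprox_error_sub_right_le (M : ℕ) {a b b' : ℝ} (ha : a ∈ I) (hb : b ∈ I)
    (hb' : b' ∈ I) :
    |(mulApprox M a b - a * b) - (mulApprox M a b' - a * b')| ≤ (1 / 2) ^ M * |b - b'| := by
  rw [mulApprox_comm M a b, mulApprox_comm M a b', mul_comm a b, mul_comm a b']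
  exact abs_mulApprox_error_sub_left_le M hb hb' ha

lemma abs_mulApprox_sub_mul_le (M : ℕ) {a b : ℝ} (ha : a ∈ I) (hb : b ∈ I) :
    |mulApprox M a b - a * b| ≤ (1 / 2) ^ M := by
  have h := abs_mulApprox_error_sub_left_le M ha unitInterval.zero_mem hb
  rw [mulApprox_zero_left M hb.1, zero_mul, sub_zero, sub_zero, sub_zero, abs_of_nonneg ha.1] at h
  exact h.trans (mul_le_of_le_one_right (by positivity) ha.2)

/-- The ReLU approximation of the product `y 0 * ⋯ * y (n - 1)` of numbers in `[0, 1]`. -/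
def prodApprox (M : ℕ) : {n : ℕ} → (Fin n → ℝ) → ℝ
  | 0, _ => 1
  | n + 1, y => mulApprox M (prodApprox M (Fin.init y)) (y (Fin.last n))

lemma prodApprox_mem (M : ℕ) {n : ℕ} {y : Fin n → ℝ} (hy : ∀ j, y j ∈ I) :
    prodApprox M y ∈ I := by
  induction n with
  | zero => exact unitInterval.one_mem
  | succ n ih => exact mulApprox_mem M (ih fun j => hy j.castSucc) (hy _)

lemma prodApprox_eq_zero (M : ℕ) {n : ℕ} {y : Fin n → ℝ} (hy : ∀ j, y j ∈ I) {i : Fin n}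
    (hi : y i = 0) : prodApprox M y = 0 := by
  induction n with
  | zero => exact i.elim0
  | succ n ih =>
    rw [prodApprox]
    cases i using Fin.lastCases with
    | last =>
      rw [hi, mulApprox_zero_right M (prodApprox_mem M (y := Fin.init y) fun j => hy j.castSucc).1]
    | cast i =>
      rw [ih (y := Fin.init y) (fun j => hy j.castSucc) hi, mulApprox_zero_left M (hy _).1]

lemma abs_prodApprox_sub_prod_le (M : ℕ) {n : ℕ} {y : Fin n → ℝ} (hy : ∀ j, y j ∈ I) :
    |prodApprox M y - ∏ j, y j| ≤ n * (1 / 2) ^ M := by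
  induction n with
  | zero => simp [prodApprox]
  | succ n ih =>
    have h_init (j : Fin n) : Fin.init y j ∈ I := hy j.castSucc
    rw [prodApprox, Fin.prod_univ_castSucc]
    set P := prodApprox M (Fin.init y)
    set a := y (Fin.last n)
    calc |mulApprox M P a - (∏ j, Fin.init y j) * a|
        = |(mulApprox M P a - P * a) + (P - ∏ j, Fin.init y j) * a| := by ring_nf
      _ ≤ |mulApprox M P a - P * a| + |P - ∏ j, Fin.init y j| * |a| := by
          rw [← abs_mul]; exact abs_add_le _ _
      _ ≤ (1 / 2) ^ M + n * (1 / 2) ^ M * 1 := by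
          gcongr
          exacts [abs_mulApprox_sub_mul_le M (prodApprox_mem M h_init) (hy _), ih h_init,
            (abs_of_nonneg (hy _).1).trans_le (hy _).2]
      _ = (n + 1 : ℕ) * (1 / 2) ^ M := by push_cast; ring

lemma abs_prod_update_sub_prod_le {ι : Type*} [Fintype ι] [DecidableEq ι] {y : ι → ℝ}
    (hy : ∀ j, y j ∈ I) (i : ι) (t : ℝ) : |∏ j, update y i t j - ∏ j, y j| ≤ |t - y i| := by
  rw [Finset.prod_update_of_mem (Finset.mem_univ i),
    ← Finset.mul_prod_erase _ _ (Finset.mem_univ i), Finset.erase_eq, ← sub_mul, abs_mul]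
  refine mul_le_of_le_one_right (abs_nonneg _) ?_
  rw [abs_of_nonneg (Finset.prod_nonneg fun j _ => (hy j).1)]
  exact Finset.prod_le_one (fun j _ => (hy j).1) fun j _ => (hy j).2

lemma forall_update_mem {ι : Type*} [DecidableEq ι] {y : ι → ℝ} (hy : ∀ j, y j ∈ I) (i : ι) {t : ℝ}
    (ht : t ∈ I) (j : ι) : update y i t j ∈ I := by
  obtain rfl | hj := eq_or_ne j i
  · rwa [update_self]
  · rw [update_of_ne hj]; exact hy j

lemma abs_mulApprox_sub_mul_sub_left_le (M : ℕ) {P P' a : ℝ} (hP : P ∈ I) (hP' : P' ∈ I)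
    (ha : a ∈ I) (Q Q' : ℝ) :
    |(mulApprox M P a - Q * a) - (mulApprox M P' a - Q' * a)|
      ≤ (1 / 2) ^ M * |P - P'| + |(P - Q) - (P' - Q')| :=
  calc _ = |((mulApprox M P a - P * a) - (mulApprox M P' a - P' * a))
        + ((P - Q) - (P' - Q')) * a| := by ring_nf
    _ ≤ _ := (abs_add_le _ _).trans <|
        add_le_add (abs_mulApprox_error_sub_left_le M hP hP' ha) <| by
          rw [abs_mul, abs_of_nonneg ha.1]; exact mul_le_of_le_one_right (abs_nonneg _) ha.2

lemma abs_mulApprox_sub_mul_sub_right_le (M : ℕ) {P a a' : ℝ} (hP : P ∈ I) (ha : a ∈ I)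
    (ha' : a' ∈ I) (Q : ℝ) :
    |(mulApprox M P a - Q * a) - (mulApprox M P a' - Q * a')|
      ≤ (1 / 2) ^ M * |a - a'| + |P - Q| * |a - a'| :=
  calc _ = |((mulApprox M P a - P * a) - (mulApprox M P a' - P * a')) + (P - Q) * (a - a')| := by
        ring_nf
    _ ≤ _ := (abs_add_le _ _).trans <|
        add_le_add (abs_mulApprox_error_sub_right_le M hP ha ha') (abs_mul _ _).le

lemma abs_prodApprox_error_update_sub_le (M : ℕ) {n : ℕ} (hn : 2 * n * (1 / 2 : ℝ) ^ M ≤ 1)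
    {y : Fin n → ℝ} (hy : ∀ j, y j ∈ I) (i : Fin n) {t : ℝ} (ht : t ∈ I) :
    |(prodApprox M (update y i t) - ∏ j, update y i t j) - (prodApprox M y - ∏ j, y j)|
      ≤ 2 * n * (1 / 2) ^ M * |t - y i| := by
  induction n with
  | zero => exact i.elim0
  | succ n ih =>
    have h_init (j : Fin n) : Fin.init y j ∈ I := hy j.castSucc
    have h_prod (z : Fin (n + 1) → ℝ) : ∏ j, z j = (∏ j, Fin.init z j) * z (Fin.last n) :=
      Fin.prod_univ_castSucc z
    have hη : (0 : ℝ) ≤ (1 / 2) ^ M := by positivity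
    push_cast at hn ⊢
    rw [h_prod, h_prod, prodApprox, prodApprox]
    cases i using Fin.lastCases with
    | last =>
      rw [Fin.init_update_last, update_self]
      calc _ ≤ (1 / 2) ^ M * |t - y (Fin.last n)| + n * (1 / 2) ^ M * |t - y (Fin.last n)| :=
            (abs_mulApprox_sub_mul_sub_right_le M (prodApprox_mem M h_init) ht (hy _) _).trans
              (by gcongr; exact abs_prodApprox_sub_prod_le M h_init)
        _ = (n + 1) * (1 / 2) ^ M * |t - y (Fin.last n)| := by ring
        _ ≤ 2 * (n + 1) * (1 / 2) ^ M * |t - y (Fin.last n)| := by gcongr; linarith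
    | cast i =>
      rw [Fin.init_update_castSucc, update_of_ne (Fin.castSucc_lt_last i).ne']
      have h_error := ih (by linarith) h_init i
      have h_prodApprox : |prodApprox M (update (Fin.init y) i t) - prodApprox M (Fin.init y)|
          ≤ 2 * |t - y i.castSucc| :=
        calc _ = |((prodApprox M (update (Fin.init y) i t) - ∏ j, update (Fin.init y) i t j)
              - (prodApprox M (Fin.init y) - ∏ j, Fin.init y j))
              + (∏ j, update (Fin.init y) i t j - ∏ j, Fin.init y j)| := by ring_nf
          _ ≤ 2 * n * (1 / 2) ^ M * |t - y i.castSucc| + |t - y i.castSucc| :=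
            (abs_add_le _ _).trans (add_le_add h_error (abs_prod_update_sub_prod_le h_init i t))
          _ ≤ 1 * |t - y i.castSucc| + |t - y i.castSucc| := by gcongr; linarith
          _ = 2 * |t - y i.castSucc| := by ring
      calc _ ≤ (1 / 2) ^ M * (2 * |t - y i.castSucc|)
            + 2 * n * (1 / 2) ^ M * |t - y i.castSucc| :=
            (abs_mulApprox_sub_mul_sub_left_le M
              (prodApprox_mem M (forall_update_mem h_init i ht)) (prodApprox_mem M h_init)
              (hy _) _ _).trans (by gcongr; exact h_error)
        _ = 2 * (n + 1) * (1 / 2) ^ M * |t - y i.castSucc| := by ring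

/-! ### Hat functions -/

/-- The hat function of level `k` with support `[s 2⁻ᵏ, (s + 1) 2⁻ᵏ]` and height one. -/
def hat (k s : ℕ) (t : ℝ) : ℝ := max (1 - |2 ^ (k + 1) * t - 2 * s - 1|) 0

lemma hat_mem (k s : ℕ) (t : ℝ) : hat k s t ∈ I :=
  ⟨le_max_right _ _, max_le (sub_le_self _ (abs_nonneg _)) zero_le_one⟩

lemma hat_eq_relu (k s : ℕ) (t : ℝ) : hat k s t =
    max (2 ^ (k + 1) * t - 2 * s) 0 - 2 * max (2 ^ (k + 1) * t - 2 * s - 1) 0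
      + max (2 ^ (k + 1) * t - 2 * s - 2) 0 := by
  unfold hat
  generalize 2 ^ (k + 1) * t - 2 * (s : ℝ) = v
  rcases max_cases v 0 with h | h <;> rcases max_cases (v - 1) 0 with h' | h' <;>
  rcases max_cases (v - 2) 0 with h'' | h'' <;> rcases abs_cases (v - 1) with ha | ha <;>
  rw [h.1, h'.1, h''.1, ha.1] <;>
  first
  | (rw [max_eq_left (by linarith)]; linarith)
  | (rw [max_eq_right (by linarith)]; linarith)

/-! ### ReLU networks of constant width -/

section Affine

variable {E F : Type*} [AddCommGroup E] [Module ℝ E] [AddCommGroup F] [Module ℝ F]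

/-- The function `f` is affine; unbundled, so that `fun_prop` can prove it. -/
@[fun_prop]
def IsAffine (f : E → F) : Prop := ∃ A : E →ᵃ[ℝ] F, ⇑A = f

@[fun_prop]
lemma isAffine_id : IsAffine fun z : E => z := ⟨AffineMap.id ℝ E, rfl⟩

@[fun_prop]
lemma isAffine_const (c : F) : IsAffine fun _ : E => c := ⟨AffineMap.const ℝ E c, rfl⟩

@[fun_prop]
lemma isAffine_apply {κ : Type*} (r : κ) : IsAffine fun z : κ → ℝ => z r :=
  ⟨AffineMap.proj r, rfl⟩

@[fun_prop]
lemma isAffine_pi {κ : Type*} {f : E → κ → ℝ} (hf : ∀ r, IsAffine fun z => f z r) :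
    IsAffine f := by
  choose A hA using hf
  exact ⟨AffineMap.pi A, funext fun z => funext fun r => congrFun (hA r) z⟩

@[fun_prop]
lemma IsAffine.add {f g : E → F} (hf : IsAffine f) (hg : IsAffine g) :
    IsAffine fun z => f z + g z := by
  obtain ⟨A, rfl⟩ := hf
  obtain ⟨A', rfl⟩ := hg
  exact ⟨A + A', rfl⟩

@[fun_prop]
lemma IsAffine.sub {f g : E → F} (hf : IsAffine f) (hg : IsAffine g) :
    IsAffine fun z => f z - g z := by
  obtain ⟨A, rfl⟩ := hf
  obtain ⟨A', rfl⟩ := hg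
  exact ⟨A - A', rfl⟩

@[fun_prop]
lemma IsAffine.const_mul {f : E → ℝ} (c : ℝ) (hf : IsAffine f) : IsAffine fun z => c * f z := by
  obtain ⟨A, rfl⟩ := hf
  exact ⟨c • A, rfl⟩

lemma IsAffine.exists_mulVec {ι κ : Type*} [Fintype ι] {f : (ι → ℝ) → κ → ℝ} (hf : IsAffine f) :
    ∃ (W : Matrix κ ι ℝ) (b : κ → ℝ), ∀ z, f z = W *ᵥ z + b := by
  classical
  obtain ⟨A, rfl⟩ := hf
  exact ⟨A.linear.toMatrix', A 0, fun z => by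
    rw [LinearMap.toMatrix'_mulVec]; exact congrFun A.decomp z⟩

end Affine

section Networks

variable {ι κ : Type*}

/-- The ReLU activation of all neurons of a layer. -/
def relu (z : κ → ℝ) (r : κ) : ℝ := max (z r) 0

/-- `F` is a ReLU layer. -/
def IsLayer (F : (ι → ℝ) → κ → ℝ) : Prop :=
  ∃ A : (ι → ℝ) → κ → ℝ, IsAffine A ∧ ∀ z, F z = relu (A z)

/-- `F` is a composition of `n` ReLU layers of the same width. -/
inductive IsLayers : ℕ → ((ι → ℝ) → ι → ℝ) → Prop
  | zero : IsLayers 0 id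
  | succ {n F G} : IsLayers n F → IsLayer G → IsLayers (n + 1) (G ∘ F)

lemma IsLayers.comp {m n : ℕ} {F G : (ι → ℝ) → ι → ℝ} (hG : IsLayers n G) (hF : IsLayers m F) :
    IsLayers (m + n) (G ∘ F) := by
  induction hG with
  | zero => exact hF
  | succ _ hl ih => exact ih.succ hl

lemma IsLayer.isLayers {F : (ι → ℝ) → ι → ℝ} (h : IsLayer F) : IsLayers 1 F :=
  IsLayers.zero.succ h

/-- The state after `n` ReLU layers with the affine maps `A 0, A 1, …`, started in `z`. -/
def run (A : ℕ → (ι → ℝ) → ι → ℝ) (z : ι → ℝ) : ℕ → ι → ℝ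
  | 0 => z
  | n + 1 => relu (A n (run A z n))

lemma run_congr {A A' : ℕ → (ι → ℝ) → ι → ℝ} {n : ℕ} (h : ∀ ℓ < n, A ℓ = A' ℓ) (z : ι → ℝ) :
    run A z n = run A' z n := by
  induction n with
  | zero => rfl
  | succ n ih => rw [run, run, ih fun ℓ hℓ => h ℓ (by omega), h n n.lt_succ_self]

lemma IsLayers.exists_run {n : ℕ} {F : (ι → ℝ) → ι → ℝ} (hF : IsLayers n F) :
    ∃ A : ℕ → (ι → ℝ) → ι → ℝ, (∀ ℓ, IsAffine (A ℓ)) ∧ ∀ z, F z = run A z n := by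
  induction hF with
  | zero => exact ⟨fun _ => id, fun _ => isAffine_id, fun z => rfl⟩
  | @succ n F G _ hG ih =>
    obtain ⟨A, hA, hF⟩ := ih
    obtain ⟨A', hA', hG⟩ := hG
    refine ⟨update A n A', fun ℓ => ?_, fun z => ?_⟩
    · obtain rfl | hℓ := eq_or_ne ℓ n
      · rwa [update_self]
      · rw [update_of_ne hℓ]; exact hA ℓ
    · rw [comp_apply, hG, hF, run, update_self,
        run_congr fun ℓ hℓ => (update_of_ne (Nat.ne_of_lt hℓ) A' A).symm]

/-- The dimensions of a network with `n + 1` hidden layers of width `w`. -/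
def constShape (d w n : ℕ) (hw : 1 ≤ w) : NetShape d where
  hidden := n + 1
  one_le_hidden := n.succ_pos
  N
    | 0 => d
    | ℓ + 1 => if ℓ ≤ n then w else 1
  N_input := rfl
  N_output := if_neg n.not_succ_le_self
  N_pos
    | 0, h, _ => absurd h (by simp)
    | ℓ + 1, _, h => hw.trans_eq (if_pos (Nat.le_of_succ_le_succ h)).symm

lemma constShape_N_succ (d : ℕ) {w n ℓ : ℕ} (hw : 1 ≤ w) (hℓ : ℓ ≤ n) :
    (constShape d w n hw).N (ℓ + 1) = w := if_pos hℓ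

lemma width_constShape_le {d w : ℕ} (n : ℕ) (hw : 1 ≤ w) (hd : d ≤ w) :
    (constShape d w n hw).width ≤ w := by
  refine Finset.sup_le fun ℓ _ => ?_
  cases ℓ with
  | zero => exact hd
  | succ ℓ => simp only [constShape]; split_ifs <;> omega

/-- The network of constant width with the weights `W₀, b₀` in the first layer, the weights
`W ℓ, b ℓ` between the hidden layers, and the weights `v, c` in the last layer. The neurons of the
hidden layers are labelled by `ι`, and `r` numbers them. -/
def constNet {d w n : ℕ} (hw : 1 ≤ w) (r : ℕ → ι) (W₀ : Matrix ι (Fin d) ℝ) (b₀ : ι → ℝ)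
    (W : ℕ → Matrix ι ι ℝ) (b : ℕ → ι → ℝ) (v : ι → ℝ) (c : ℝ) : Net (constShape d w n hw) where
  W
    | 0 => fun i j => W₀ (r i) j
    | ℓ + 1 => fun i j => if ℓ < n then W ℓ (r i) (r j) else v (r j)
  b
    | 0 => fun i => b₀ (r i)
    | ℓ + 1 => fun i => if ℓ < n then b ℓ (r i) else c

variable [Fintype ι]

lemma exists_numbering [Nonempty ι] :
    ∃ r : ℕ → ι, ∀ g : ι → ℝ, ∑ j ∈ Finset.range (Fintype.card ι), g (r j) = ∑ i, g i := by
  let e := Fintype.equivFin ι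
  refine ⟨fun j => if h : j < Fintype.card ι then e.symm ⟨j, h⟩ else Classical.arbitrary ι,
    fun g => ?_⟩
  rw [← Fin.sum_univ_eq_sum_range (fun j => g _), ← e.symm.sum_comp]
  simp

section ConstNet

variable {d w n : ℕ} (hw : 1 ≤ w) {r : ℕ → ι} (W₀ : Matrix ι (Fin d) ℝ) (b₀ : ι → ℝ)
  (W : ℕ → Matrix ι ι ℝ) (b : ℕ → ι → ℝ) (v : ι → ℝ) (c : ℝ)

lemma layer_constNet_succ (hr : ∀ g : ι → ℝ, ∑ j ∈ Finset.range w, g (r j) = ∑ i, g i)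
    (x : Fin d → ℝ) {ℓ : ℕ} (hℓ : ℓ ≤ n) (i : Fin ((constShape d w n hw).N (ℓ + 1))) :
    (constNet hw r W₀ b₀ W b v c).layer x (ℓ + 1) i
      = run (fun ℓ z => W ℓ *ᵥ z + b ℓ) (relu (W₀ *ᵥ x + b₀)) ℓ (r i) := by
  induction ℓ with
  | zero => rfl
  | succ ℓ ih =>
    rw [Net.layer, run]
    simp only [relu, Matrix.mulVec, dotProduct, Pi.add_apply, ih (Nat.le_of_succ_le hℓ)]
    simp only [constNet, if_pos (Nat.lt_of_succ_le hℓ)]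
    rw [Fin.sum_univ_eq_sum_range fun j => W ℓ (r i) (r j) * run _ _ ℓ (r j),
      constShape_N_succ d hw (Nat.le_of_succ_le hℓ),
      hr fun j => W ℓ (r i) j * run _ _ ℓ j]

lemma output_constNet (hr : ∀ g : ι → ℝ, ∑ j ∈ Finset.range w, g (r j) = ∑ i, g i)
    (x : Fin d → ℝ) :
    (constNet (n := n) hw r W₀ b₀ W b v c).output x
      = v ⬝ᵥ run (fun ℓ z => W ℓ *ᵥ z + b ℓ) (relu (W₀ *ᵥ x + b₀)) n + c := by
  change ∑ j : Fin ((constShape d w n hw).N (n + 1)),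
      (if n < n then W n (r 0) (r j) else v (r j)) * (constNet hw r W₀ b₀ W b v c).layer x (n + 1) j
        + (if n < n then b n (r 0) else c) = _
  simp only [if_neg (lt_irrefl n), layer_constNet_succ hw W₀ b₀ W b v c hr x le_rfl]
  rw [Fin.sum_univ_eq_sum_range fun j => v (r j) * run _ _ n (r j),
    constShape_N_succ d hw le_rfl, hr fun j => v j * run _ _ n j,
    dotProduct]

end ConstNet

/-- The dimensions of the network depend on the number of layers only, and not on their weights. -/
lemma IsLayers.exists_net {d w n : ℕ} (hw : 1 ≤ w) (hι : Fintype.card ι = w)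
    {F₀ : (Fin d → ℝ) → ι → ℝ} (hF₀ : IsLayer F₀) {F : (ι → ℝ) → ι → ℝ} (hF : IsLayers n F)
    {f : (ι → ℝ) → ℝ} (hf : IsAffine f) :
    ∃ Φ : Net (constShape d w n hw), ∀ x, Φ.output x = f (F (F₀ x)) := by
  subst hι
  have : Nonempty ι := Fintype.card_pos_iff.1 hw
  obtain ⟨r, hr⟩ := exists_numbering (ι := ι)
  obtain ⟨A, hA, hF⟩ := hF.exists_run
  obtain ⟨A₀, hA₀, hF₀⟩ := hF₀
  obtain ⟨W₀, b₀, h₀⟩ := hA₀.exists_mulVec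
  choose W b hWb using fun ℓ => (hA ℓ).exists_mulVec
  obtain rfl : A = fun ℓ z => W ℓ *ᵥ z + b ℓ := funext fun ℓ => funext (hWb ℓ)
  obtain ⟨V, c, hV⟩ := (isAffine_pi fun _ : Unit => hf).exists_mulVec
  refine ⟨constNet hw r W₀ b₀ W b (V ()) (c ()), fun x => ?_⟩
  rw [output_constNet hw W₀ b₀ W b _ _ hr, hF, hF₀, h₀]
  exact (congrFun (hV _) ()).symm

end Networks

/-! ### A network that sums up approximate tensor products of hat functions -/

/-- The registers of the computation, in addition to those that hold the input: the sums of the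
positive and of the negative contributions, the current value, two iterates of the tent map with
their ReLU units, the ReLU units of a hat function, the hat function, and the positive part of the
difference between the current value and the hat function. -/
inductive Register
  | pos | neg | val | tent₁ | relu₁ | tent₂ | relu₂ | hat₀ | hat₁ | hat₂ | factor | excess
  deriving DecidableEq

instance : Fintype Register where
  elems := {.pos, .neg, .val, .tent₁, .relu₁, .tent₂, .relu₂, .hat₀, .hat₁, .hat₂, .factor, .excess}
  complete r := by cases r <;> decide

lemma card_registers (d : ℕ) : Fintype.card (Fin d ⊕ Register) = d + 12 := by
  rw [Fintype.card_sum, Fintype.card_fin]; rfl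

section Program

variable {d : ℕ} {x : Fin d → ℝ} {a b P : ℝ} {z : Fin d ⊕ Register → ℝ}

/-- The state `z` holds the input `x`, the sums `a`, `b` and the current value `P`. -/
structure Stores (x : Fin d → ℝ) (a b P : ℝ) (z : Fin d ⊕ Register → ℝ) : Prop where
  nonneg : 0 ≤ z
  input : ∀ i, z (.inl i) = x i
  pos : z (.inr .pos) = a
  neg : z (.inr .neg) = b
  val : z (.inr .val) = P

/-- The state `z` holds `s` and `r`, with the ReLU units that are needed for their images under the
tent map. -/
structure StoresTents (s r : ℝ) (z : Fin d ⊕ Register → ℝ) : Prop where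
  tent₁ : z (.inr .tent₁) = s
  relu₁ : z (.inr .relu₁) = max (s - 1 / 2) 0
  tent₂ : z (.inr .tent₂) = r
  relu₂ : z (.inr .relu₂) = max (r - 1 / 2) 0

/-- The layer that keeps the input and updates the registers by `U`. -/
def keepLayer (U : (Fin d ⊕ Register → ℝ) → Register → ℝ) (z : Fin d ⊕ Register → ℝ) :
    Fin d ⊕ Register → ℝ :=
  relu (Sum.elim (fun i => z (.inl i)) (U z))

lemma isLayer_keepLayer {U : (Fin d ⊕ Register → ℝ) → Register → ℝ}
    (hU : ∀ r, IsAffine fun z => U z r) : IsLayer (keepLayer U) := by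
  refine ⟨fun z => Sum.elim (fun i => z (.inl i)) (U z), isAffine_pi ?_, fun z => rfl⟩
  rintro (i | r)
  exacts [isAffine_apply _, hU r]

lemma Stores.keepLayer (hz : Stores x a b P z) {U : (Fin d ⊕ Register → ℝ) → Register → ℝ}
    {a' b' P' : ℝ} (ha : U z .pos = a') (hb : U z .neg = b') (hP : U z .val = P') (ha' : 0 ≤ a')
    (hb' : 0 ≤ b') (hP' : 0 ≤ P') : Stores x a' b' P' (keepLayer U z) where
  nonneg _ := le_max_right _ _
  input i := (max_eq_left (hz.nonneg _)).trans (hz.input i)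
  pos := (max_eq_left (ha' |>.trans_eq ha.symm)).trans ha
  neg := (max_eq_left (hb' |>.trans_eq hb.symm)).trans hb
  val := (max_eq_left (hP' |>.trans_eq hP.symm)).trans hP

lemma Stores.pos_nonneg (hz : Stores x a b P z) : 0 ≤ a := hz.pos ▸ hz.nonneg _

lemma Stores.neg_nonneg (hz : Stores x a b P z) : 0 ≤ b := hz.neg ▸ hz.nonneg _

lemma Stores.val_nonneg (hz : Stores x a b P z) : 0 ≤ P := hz.val ▸ hz.nonneg _

/-- The update that computes the ReLU units of a hat function of the `i`-th input. -/
def hatUpdate (k s : ℕ) (i : Fin d) (z : Fin d ⊕ Register → ℝ) : Register → ℝ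
  | .pos => z (.inr .pos)
  | .neg => z (.inr .neg)
  | .val => z (.inr .val)
  | .hat₀ => 2 ^ (k + 1) * z (.inl i) - 2 * s
  | .hat₁ => 2 ^ (k + 1) * z (.inl i) - 2 * s - 1
  | .hat₂ => 2 ^ (k + 1) * z (.inl i) - 2 * s - 2
  | _ => 0

/-- The update that computes the hat function and its difference to the current value. -/
def factorUpdate (z : Fin d ⊕ Register → ℝ) : Register → ℝ
  | .pos => z (.inr .pos)
  | .neg => z (.inr .neg)
  | .val => z (.inr .val)
  | .factor => z (.inr .hat₀) - 2 * z (.inr .hat₁) + z (.inr .hat₂)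
  | .excess => z (.inr .val) - (z (.inr .hat₀) - 2 * z (.inr .hat₁) + z (.inr .hat₂))
  | _ => 0

/-- The update that starts the approximate multiplication of the current value by the factor. -/
def mulUpdate (z : Fin d ⊕ Register → ℝ) : Register → ℝ
  | .pos => z (.inr .pos)
  | .neg => z (.inr .neg)
  | .val => z (.inr .val) - z (.inr .excess)
  | .tent₁ => 1 / 2 * (z (.inr .val) + z (.inr .factor))
  | .relu₁ => 1 / 2 * (z (.inr .val) + z (.inr .factor)) - 1 / 2
  | .tent₂ => z (.inr .excess) - 1 / 2 * (z (.inr .val) - z (.inr .factor))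
  | .relu₂ => z (.inr .excess) - 1 / 2 * (z (.inr .val) - z (.inr .factor)) - 1 / 2
  | _ => 0

/-- The update that performs the `j`-th step of the approximate multiplication. -/
def tentUpdate (j : ℕ) (z : Fin d ⊕ Register → ℝ) : Register → ℝ
  | .pos => z (.inr .pos)
  | .neg => z (.inr .neg)
  | .val => z (.inr .val) - 1 / 4 ^ (j + 1) * (2 * z (.inr .tent₁) - 4 * z (.inr .relu₁))
      + 1 / 4 ^ (j + 1) * (2 * z (.inr .tent₂) - 4 * z (.inr .relu₂))
  | .tent₁ => 2 * z (.inr .tent₁) - 4 * z (.inr .relu₁)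
  | .relu₁ => 2 * z (.inr .tent₁) - 4 * z (.inr .relu₁) - 1 / 2
  | .tent₂ => 2 * z (.inr .tent₂) - 4 * z (.inr .relu₂)
  | .relu₂ => 2 * z (.inr .tent₂) - 4 * z (.inr .relu₂) - 1 / 2
  | _ => 0

/-- The update that adds `c` times the current value to the sums and resets the current value. -/
def sumUpdate (c : ℝ) (z : Fin d ⊕ Register → ℝ) : Register → ℝ
  | .pos => z (.inr .pos) + c⁺ * z (.inr .val)
  | .neg => z (.inr .neg) + c⁻ * z (.inr .val)
  | .val => 1
  | _ => 0

lemma isLayer_hatUpdate (k s : ℕ) (i : Fin d) : IsLayer (keepLayer (hatUpdate k s i)) :=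
  isLayer_keepLayer fun r => by cases r <;> unfold hatUpdate <;> fun_prop

lemma isLayer_factorUpdate : IsLayer (keepLayer (factorUpdate (d := d))) :=
  isLayer_keepLayer fun r => by cases r <;> unfold factorUpdate <;> fun_prop

lemma isLayer_mulUpdate : IsLayer (keepLayer (mulUpdate (d := d))) :=
  isLayer_keepLayer fun r => by cases r <;> unfold mulUpdate <;> fun_prop

lemma isLayer_tentUpdate (j : ℕ) : IsLayer (keepLayer (tentUpdate (d := d) j)) :=
  isLayer_keepLayer fun r => by cases r <;> unfold tentUpdate <;> fun_prop

lemma isLayer_sumUpdate (c : ℝ) : IsLayer (keepLayer (sumUpdate (d := d) c)) :=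
  isLayer_keepLayer fun r => by cases r <;> unfold sumUpdate <;> fun_prop

lemma Stores.mulUpdate (hz : Stores x a b P z) (hP : P ∈ I) {y : ℝ} (hy : y ∈ I)
    (h_factor : z (.inr .factor) = y) (h_excess : z (.inr .excess) = max (P - y) 0) :
    Stores x a b (mulApprox 0 P y) (DeepReLU.keepLayer mulUpdate z) ∧
      StoresTents ((P + y) / 2) (|P - y| / 2) (DeepReLU.keepLayer mulUpdate z) := by
  have h_half : 1 / 2 * (P + y) = (P + y) / 2 := by ring
  have h_min : P - max (P - y) 0 = mulApprox 0 P y := by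
    rw [mulApprox, parabolaApprox_zero_left, parabolaApprox_zero_left, sub_zero, add_zero,
      min_comm, ← sub_sub_cancel P (min y P), ← max_sub_sub_left, sub_self]
  have h_abs : max (P - y) 0 - 1 / 2 * (P - y) = |P - y| / 2 := by
    rcases abs_cases (P - y) with h | h <;> rcases max_cases (P - y) 0 with h' | h' <;> linarith
  refine ⟨hz.keepLayer hz.pos hz.neg ?_ hz.pos_nonneg hz.neg_nonneg (mulApprox_mem 0 hP hy).1,
    ?_, ?_, ?_, ?_⟩ <;>
  simp only [DeepReLU.mulUpdate, DeepReLU.keepLayer, relu, Sum.elim_inr, hz.val, h_factor, h_excess,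
    h_half, h_min, h_abs]
  exacts [max_eq_left (half_add_mem hP hy).1, max_eq_left (half_abs_sub_mem hP hy).1]

lemma Stores.tentUpdate {M : ℕ} {y : ℝ} (hz : Stores x a b (mulApprox M P y) z)
    (hP : P ∈ I) (hy : y ∈ I)
    (ht : StoresTents (tent^[M] ((P + y) / 2)) (tent^[M] (|P - y| / 2)) z) :
    Stores x a b (mulApprox (M + 1) P y) (DeepReLU.keepLayer (tentUpdate M) z) ∧
      StoresTents (tent^[M + 1] ((P + y) / 2)) (tent^[M + 1] (|P - y| / 2))
        (DeepReLU.keepLayer (tentUpdate M) z) := by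
  have h_tent₁ : 2 * z (.inr .tent₁) - 4 * z (.inr .relu₁) = tent^[M + 1] ((P + y) / 2) := by
    rw [ht.tent₁, ht.relu₁, iterate_succ_apply', tent]
  have h_tent₂ : 2 * z (.inr .tent₂) - 4 * z (.inr .relu₂) = tent^[M + 1] (|P - y| / 2) := by
    rw [ht.tent₂, ht.relu₂, iterate_succ_apply', tent]
  refine ⟨hz.keepLayer hz.pos hz.neg ?_ hz.pos_nonneg hz.neg_nonneg (mulApprox_mem _ hP hy).1,
    ?_, ?_, ?_, ?_⟩ <;>
  simp only [DeepReLU.tentUpdate, DeepReLU.keepLayer, relu, Sum.elim_inr, hz.val, h_tent₁, h_tent₂]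
  · rw [mulApprox_succ]; ring
  · exact max_eq_left (mapsTo_tent.iterate _ (half_add_mem hP hy)).1
  · exact max_eq_left (mapsTo_tent.iterate _ (half_abs_sub_mem hP hy)).1

lemma exists_layers_tent (d M : ℕ) :
    ∃ F : (Fin d ⊕ Register → ℝ) → Fin d ⊕ Register → ℝ, IsLayers M F ∧
      ∀ ⦃x a b P y z⦄, P ∈ I → y ∈ I → Stores x a b (mulApprox 0 P y) z →
        StoresTents ((P + y) / 2) (|P - y| / 2) z →
        Stores x a b (mulApprox M P y) (F z) ∧
          StoresTents (tent^[M] ((P + y) / 2)) (tent^[M] (|P - y| / 2)) (F z) := by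
  induction M with
  | zero => exact ⟨id, .zero, fun x a b P y z _ _ hz ht => ⟨hz, ht⟩⟩
  | succ M ih =>
    obtain ⟨F, hF, h⟩ := ih
    refine ⟨keepLayer (tentUpdate M) ∘ F, hF.succ (isLayer_tentUpdate M),
      fun x a b P y z hP hy hz ht => ?_⟩
    obtain ⟨hz', ht'⟩ := h hP hy hz ht
    exact hz'.tentUpdate hP hy ht'

lemma exists_layers_factor (M k s : ℕ) (i : Fin d) :
    ∃ F : (Fin d ⊕ Register → ℝ) → Fin d ⊕ Register → ℝ, IsLayers (M + 3) F ∧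
      ∀ ⦃x a b P z⦄, P ∈ I → Stores x a b P z →
        Stores x a b (mulApprox M P (hat k s (x i))) (F z) := by
  obtain ⟨F, hF, h⟩ := exists_layers_tent d M
  refine ⟨F ∘ keepLayer mulUpdate ∘ keepLayer factorUpdate ∘ keepLayer (hatUpdate k s i), ?_,
    fun x a b P z hP hz => ?_⟩
  · rw [add_comm]
    exact hF.comp (((isLayer_hatUpdate k s i).isLayers.succ isLayer_factorUpdate).succ
      isLayer_mulUpdate)
  · have hy := hat_mem k s (x i)
    have hz₁ : Stores x a b P (keepLayer (hatUpdate k s i) z) :=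
      hz.keepLayer hz.pos hz.neg hz.val hz.pos_nonneg hz.neg_nonneg hz.val_nonneg
    have hz₂ : Stores x a b P (keepLayer factorUpdate (keepLayer (hatUpdate k s i) z)) :=
      hz₁.keepLayer hz₁.pos hz₁.neg hz₁.val hz.pos_nonneg hz.neg_nonneg hz.val_nonneg
    obtain ⟨hz₃, ht⟩ := hz₂.mulUpdate hP hy
      (by simp only [keepLayer, relu, Sum.elim_inr, factorUpdate, hatUpdate, hz.input,
            ← hat_eq_relu, max_eq_left hy.1])
      (by simp only [keepLayer, relu, Sum.elim_inr, factorUpdate, hatUpdate, hz.input, hz.val,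
            ← hat_eq_relu, max_eq_left hP.1])
    exact (h hP hy hz₃ ht).1

lemma exists_layers_prod (M : ℕ) {n : ℕ} (k s : Fin n → ℕ) (e : Fin n → Fin d) :
    ∃ F : (Fin d ⊕ Register → ℝ) → Fin d ⊕ Register → ℝ, IsLayers (n * (M + 3)) F ∧
      ∀ ⦃x a b z⦄, Stores x a b 1 z →
        Stores x a b (prodApprox M fun j => hat (k j) (s j) (x (e j))) (F z) := by
  induction n with
  | zero => exact ⟨id, by simpa only [zero_mul] using IsLayers.zero, fun x a b z hz => hz⟩
  | succ n ih =>
    obtain ⟨F, hF, h⟩ := ih (Fin.init k) (Fin.init s) (Fin.init e)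
    obtain ⟨G, hG, h'⟩ :=
      exists_layers_factor M (k (Fin.last n)) (s (Fin.last n)) (e (Fin.last n))
    refine ⟨G ∘ F, by rw [add_mul, one_mul]; exact hG.comp hF, fun x a b z hz => ?_⟩
    exact h' (prodApprox_mem M fun j => hat_mem _ _ _) (h hz)

lemma exists_layers_term (M : ℕ) (k s : Fin d → ℕ) (c : ℝ) :
    ∃ F : (Fin d ⊕ Register → ℝ) → Fin d ⊕ Register → ℝ, IsLayers (d * (M + 3) + 1) F ∧
      ∀ ⦃x a b z⦄, Stores x a b 1 z →
        Stores x (a + c⁺ * prodApprox M fun j => hat (k j) (s j) (x j))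
          (b + c⁻ * prodApprox M fun j => hat (k j) (s j) (x j)) 1 (F z) := by
  obtain ⟨F, hF, h⟩ := exists_layers_prod M k s id
  refine ⟨keepLayer (sumUpdate c) ∘ F, hF.succ (isLayer_sumUpdate c), fun x a b z hz => ?_⟩
  have hz' := h hz
  have h_val := hz'.val_nonneg
  exact hz'.keepLayer (by simp only [sumUpdate, hz'.pos, hz'.val, id])
    (by simp only [sumUpdate, hz'.neg, hz'.val, id]) rfl
    (add_nonneg hz.pos_nonneg (mul_nonneg (posPart_nonneg c) h_val))
    (add_nonneg hz.neg_nonneg (mul_nonneg (negPart_nonneg c) h_val)) zero_le_one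

lemma exists_layers_sum {τ : Type*} (M : ℕ) (k s : τ → Fin d → ℕ) (c : τ → ℝ) (l : List τ) :
    ∃ F : (Fin d ⊕ Register → ℝ) → Fin d ⊕ Register → ℝ,
      IsLayers (l.length * (d * (M + 3) + 1)) F ∧
      ∀ ⦃x a b z⦄, Stores x a b 1 z → ∃ a' b', Stores x a' b' 1 (F z) ∧ a' - b' = a - b +
        (l.map fun t => c t * prodApprox M fun j => hat (k t j) (s t j) (x j)).sum := by
  induction l with
  | nil =>
    exact ⟨id, by simpa only [List.length_nil, zero_mul] using IsLayers.zero,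
      fun x a b z hz => ⟨a, b, hz, by simp⟩⟩
  | cons t l ih =>
    obtain ⟨G, hG, h'⟩ := ih
    obtain ⟨F, hF, h⟩ := exists_layers_term M (k t) (s t) (c t)
    refine ⟨G ∘ F, ?_, fun x a b z hz => ?_⟩
    · rw [List.length_cons, add_mul, one_mul, add_comm]
      exact hG.comp hF
    · obtain ⟨a', b', hz', hab⟩ := h' (h hz)
      refine ⟨a', b', hz', ?_⟩
      rw [hab, List.map_cons, List.sum_cons]
      nth_rw 3 [← posPart_sub_negPart (c t)]
      ring

/-- The layer that stores the input and the value one. -/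
def inputLayer (x : Fin d → ℝ) : Fin d ⊕ Register → ℝ :=
  relu (Sum.elim x (Pi.single .val 1))

lemma isLayer_inputLayer : IsLayer (inputLayer (d := d)) := by
  refine ⟨fun x => Sum.elim x (Pi.single .val 1), isAffine_pi ?_, fun x => rfl⟩
  rintro (i | r)
  exacts [isAffine_apply _, isAffine_const _]

lemma stores_inputLayer (hx : 0 ≤ x) : Stores x 0 0 1 (inputLayer x) where
  nonneg _ := le_max_right _ _
  input i := max_eq_left (hx i)
  pos := by simp [inputLayer, relu]
  neg := by simp [inputLayer, relu]
  val := by simp [inputLayer, relu]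

lemma exists_net_sum {τ : Type*} (M : ℕ) (k s : τ → Fin d → ℕ) (c : τ → ℝ) (T : Finset τ) :
    ∃ Φ : Net (constShape d (d + 12) (T.card * (d * (M + 3) + 1)) (Nat.le_add_left 1 (d + 11))),
      ∀ x, 0 ≤ x →
        Φ.output x = ∑ t ∈ T, c t * prodApprox M fun j => hat (k t j) (s t j) (x j) := by
  obtain ⟨F, hF, h⟩ := exists_layers_sum M k s c T.toList
  rw [Finset.length_toList] at hF
  obtain ⟨Φ, hΦ⟩ := hF.exists_net (Nat.le_add_left 1 (d + 11)) (card_registers d)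
    isLayer_inputLayer ((isAffine_apply (.inr .pos)).sub (isAffine_apply (.inr .neg)))
  refine ⟨Φ, fun x hx => ?_⟩
  obtain ⟨a, b, hz, hab⟩ := h (stores_inputLayer hx)
  rw [hΦ, hz.pos, hz.neg, hab, Finset.sum_map_toList, sub_self, zero_add]

end Program

/-! ### Hat functions of one level -/

lemma mem_Ioo_of_hat_ne_zero {k s : ℕ} {t : ℝ} (h : hat k s t ≠ 0) :
    2 ^ k * t ∈ Set.Ioo (s : ℝ) (s + 1) := by
  have h_abs : |2 ^ (k + 1) * t - 2 * s - 1| < 1 :=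
    sub_pos.1 <| not_le.1 fun h' => h (max_eq_right h')
  rw [abs_lt, pow_succ] at h_abs
  constructor <;> linarith

lemma hat_eq_zero_of_ne_floor {k s : ℕ} {t : ℝ} (h : s ≠ ⌊2 ^ k * t⌋₊) : hat k s t = 0 := by
  by_contra h'
  obtain ⟨h_lower, h_upper⟩ := mem_Ioo_of_hat_ne_zero h'
  exact h ((Nat.floor_eq_iff (s.cast_nonneg.trans h_lower.le)).2 ⟨h_lower.le, h_upper⟩).symm

lemma hat_eq_zero {k s : ℕ} {t : ℝ} (hs : s < 2 ^ k) (ht : t ∉ Set.Ioo 0 1) : hat k s t = 0 := by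
  by_contra h
  obtain ⟨h_lower, h_upper⟩ := mem_Ioo_of_hat_ne_zero h
  have hs' : (s : ℝ) + 1 ≤ 2 ^ k := mod_cast hs
  have hk : (0 : ℝ) < 2 ^ k := by positivity
  exact ht ⟨pos_of_mul_pos_right (s.cast_nonneg.trans_lt h_lower) hk.le,
    (mul_lt_iff_lt_one_right hk).1 (h_upper.trans_le hs')⟩

lemma sum_hat_mem (k : ℕ) (t : ℝ) : ∑ s ∈ Finset.range (2 ^ k), hat k s t ∈ I := by
  refine ⟨Finset.sum_nonneg fun s _ => (hat_mem k s t).1, ?_⟩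
  by_cases h : ⌊2 ^ k * t⌋₊ ∈ Finset.range (2 ^ k)
  · rw [Finset.sum_eq_single_of_mem _ h fun s _ hs => hat_eq_zero_of_ne_floor hs]
    exact (hat_mem _ _ _).2
  · rw [Finset.sum_eq_zero fun s hs => hat_eq_zero_of_ne_floor fun e => h (e ▸ hs)]
    exact zero_le_one

/-- The argument of the absolute value is the rescaled projection of `t` to the support of the hat
function; these projections telescope over the supports of one level. -/
lemma hat_eq_one_sub_abs (k s : ℕ) (t : ℝ) :
    hat k s t = 1 - |2 ^ (k + 1) * (min t ((s + 1 : ℕ) / 2 ^ k) - min t (s / 2 ^ k)) - 1| := by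
  have h_min (m : ℕ) : 2 ^ (k + 1) * min t (m / 2 ^ k) = min (2 ^ (k + 1) * t) (2 * m) := by
    rw [mul_min_of_nonneg _ _ (by positivity), pow_succ]
    field_simp
  rw [mul_sub, h_min, h_min, hat]
  generalize (2 : ℝ) ^ (k + 1) * t = v
  push_cast
  rcases min_cases v (2 * s) with h | h
  · rw [min_eq_left (by linarith), h.1, abs_of_nonpos (by linarith), max_eq_right (by linarith)]
    norm_num
  · rcases min_cases v (2 * (s + 1)) with h' | h'
    · rw [h.1, h'.1, max_eq_left (sub_nonneg.2 (abs_le.2 ⟨by linarith, by linarith⟩))]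
    · rw [h.1, h'.1, abs_of_pos (by linarith), max_eq_right (by linarith)]
      ring_nf
      norm_num

lemma monotone_min_sub_min {c₀ c₁ : ℝ} (hc : c₀ ≤ c₁) :
    Monotone fun t => min t c₁ - min t c₀ := by
  intro a b hab
  simp only
  rcases min_cases a c₀ with h₁ | h₁ <;> rcases min_cases b c₀ with h₂ | h₂ <;>
  rcases min_cases a c₁ with h₃ | h₃ <;> rcases min_cases b c₁ with h₄ | h₄ <;> linarith

lemma sum_abs_hat_sub_le (k : ℕ) (a b : ℝ) :
    ∑ s ∈ Finset.range (2 ^ k), |hat k s a - hat k s b| ≤ 2 ^ (k + 1) * |a - b| := by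
  wlog hab : a ≤ b generalizing a b
  · simp only [abs_sub_comm (hat k _ a), abs_sub_comm a b]
    exact this b a (le_of_not_ge hab)
  have h_term (s : ℕ) : |hat k s a - hat k s b| ≤ 2 ^ (k + 1) *
      ((min b ((s + 1 : ℕ) / 2 ^ k) - min b (s / 2 ^ k))
        - (min a ((s + 1 : ℕ) / 2 ^ k) - min a (s / 2 ^ k))) := by
    have h_mono := monotone_min_sub_min (c₀ := s / 2 ^ k) (c₁ := (s + 1 : ℕ) / 2 ^ k)
      (by gcongr; exact s.le_succ) hab
    rw [hat_eq_one_sub_abs, hat_eq_one_sub_abs, sub_sub_sub_cancel_left]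
    refine (abs_abs_sub_abs_le_abs_sub _ _).trans_eq ?_
    rw [sub_sub_sub_cancel_right, ← mul_sub]
    exact abs_of_nonneg (mul_nonneg (by positivity) (sub_nonneg.2 h_mono))
  refine (Finset.sum_le_sum fun s _ => h_term s).trans ?_
  rw [← Finset.mul_sum, Finset.sum_sub_distrib,
    Finset.sum_range_sub (fun s : ℕ => min b (s / 2 ^ k : ℝ)),
    Finset.sum_range_sub (fun s : ℕ => min a (s / 2 ^ k : ℝ)), abs_sub_comm,
    abs_of_nonneg (sub_nonneg.2 hab)]
  refine mul_le_mul_of_nonneg_left ?_ (by positivity)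
  have h_lower : min a (((0 : ℕ) : ℝ) / 2 ^ k) ≤ min b (((0 : ℕ) : ℝ) / 2 ^ k) :=
    min_le_min_right _ hab
  rcases min_cases b (((2 ^ k : ℕ) : ℝ) / 2 ^ k) with h | h <;>
  rcases min_cases a (((2 ^ k : ℕ) : ℝ) / 2 ^ k) with h' | h' <;> linarith

/-! ### Tensor products of combinations of point evaluations -/

/-- Formal linear combinations of point evaluations on the real line. -/
abbrev PointFunctional : Type := Π₀ _ : ℝ, ℝ

/-- The evaluation at the point `t`. -/
def evalAt (t : ℝ) : PointFunctional := DFinsupp.single t 1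

/-- The second difference `g ↦ g (t + 2 h) - 2 g (t + h) + g t`. -/
def diffAt (h t : ℝ) : PointFunctional := evalAt (t + 2 * h) - (2 : ℝ) • evalAt (t + h) + evalAt t

variable {d : ℕ}

/-- The value at `f` of the tensor product of combinations of point evaluations. -/
def tensorEval (f : (Fin d → ℝ) → ℝ) : MultilinearMap ℝ (fun _ : Fin d => PointFunctional) ℝ :=
  MultilinearMap.fromDFinsuppEquiv (fun _ : Fin d => ℝ) ℝ
    fun y => f y • MultilinearMap.mkPiAlgebra ℝ (Fin d) ℝ

lemma tensorEval_evalAt (f : (Fin d → ℝ) → ℝ) (y : Fin d → ℝ) :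
    tensorEval f (fun i => evalAt (y i)) = f y := by
  simp only [tensorEval, evalAt]
  rw [MultilinearMap.fromDFinsuppEquiv_single]
  simp

lemma tensorEval_eq_zero {f : (Fin d → ℝ) → ℝ} {a : Fin d → PointFunctional} (i : Fin d) {S : Set ℝ}
    (hf : ∀ y, y i ∈ S → f y = 0) (ha : ∀ t ∉ S, a i t = 0) : tensorEval f a = 0 := by
  classical
  rw [tensorEval, MultilinearMap.fromDFinsuppEquiv_apply]
  refine Finset.sum_eq_zero fun y _ => ?_
  by_cases hy : y i ∈ S
  · simp [hf y hy]
  · have h_prod : ∏ j, a j (y j) = 0 :=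
      Finset.prod_eq_zero (f := fun j => a j (y j)) (Finset.mem_univ i) (ha _ hy)
    simp [h_prod]

lemma tensorEval_update_diffAt (f : (Fin d → ℝ) → ℝ) (a : Fin d → PointFunctional) (i : Fin d)
    (h t : ℝ) :
    tensorEval f (update a i (diffAt h t)) = tensorEval f (update a i (evalAt (t + 2 * h)))
      - 2 * tensorEval f (update a i (evalAt (t + h)))
      + tensorEval f (update a i (evalAt t)) := by
  rw [diffAt, MultilinearMap.map_update_add, MultilinearMap.map_update_sub,
    MultilinearMap.map_update_smul, smul_eq_mul]

lemma mixedDiff_empty (h : Fin d → ℝ) (f : (Fin d → ℝ) → ℝ) : mixedDiff ∅ h f = f := by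
  have h_one : mixedDiff ∅ h = 1 := Finset.noncommProd_empty _ _
  rw [h_one, Module.End.one_apply]

lemma mixedDiff_insert {u : Finset (Fin d)} {i : Fin d} (hi : i ∉ u) (h : Fin d → ℝ)
    (f : (Fin d → ℝ) → ℝ) :
    mixedDiff (insert i u) h f = secondDiff i (h i) (mixedDiff u h f) := by
  have h_mul : mixedDiff (insert i u) h = secondDiff i (h i) * mixedDiff u h :=
    Finset.noncommProd_insert_of_notMem _ _ _ _ hi
  rw [h_mul, Module.End.mul_apply]

lemma mixedDiff_eq_tensorEval (u : Finset (Fin d)) (h : Fin d → ℝ) (f : (Fin d → ℝ) → ℝ)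
    (x : Fin d → ℝ) :
    mixedDiff u h f x
      = tensorEval f (u.piecewise (fun i => diffAt (h i) (x i)) fun i => evalAt (x i)) := by
  induction u using Finset.induction_on generalizing x with
  | empty => rw [mixedDiff_empty, Finset.piecewise_empty, tensorEval_evalAt]
  | insert i u hi ih =>
    have h_shift (t : ℝ) : mixedDiff u h f (x + Pi.single i t) = tensorEval f
        (update (u.piecewise (fun i => diffAt (h i) (x i)) fun i => evalAt (x i)) i
          (evalAt (x i + t))) := by
      rw [ih]
      congr 1
      funext j
      obtain rfl | hj := eq_or_ne j i
      · simp [hi]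
      · simp [Finset.piecewise, hj]
    have h_self := h_shift 0
    rw [Pi.single_zero, add_zero, add_zero] at h_self
    rw [mixedDiff_insert hi, Finset.piecewise_insert, tensorEval_update_diffAt, ← h_shift,
      ← h_shift, ← h_self]
    rfl

/-! ### The Faber series -/

/-- The value at `t` of the piecewise linear interpolation with nodes in `2⁻ᵏ ℕ`. -/
def interpAt (k : ℕ) (t : ℝ) : PointFunctional :=
  (1 - (2 ^ k * t - ⌊2 ^ k * t⌋₊)) • evalAt (⌊2 ^ k * t⌋₊ / 2 ^ k)
    + (2 ^ k * t - ⌊2 ^ k * t⌋₊) • evalAt ((⌊2 ^ k * t⌋₊ + 1) / 2 ^ k)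

/-- The value at `t` of the difference of the interpolations of the levels `k + 1` and `k`. -/
def levelAt (k : ℕ) (t : ℝ) : PointFunctional :=
  ∑ s ∈ Finset.range (2 ^ k), (-(1 / 2) * hat k s t) • diffAt (1 / 2 ^ (k + 1)) (s / 2 ^ k)

lemma levelAt_eq (k : ℕ) {t : ℝ} (ht : t ∈ Set.Ico 0 1) :
    levelAt k t = (-(1 / 2) * hat k ⌊2 ^ k * t⌋₊ t) •
      diffAt (1 / 2 ^ (k + 1)) (⌊2 ^ k * t⌋₊ / 2 ^ k) := by
  refine Finset.sum_eq_single_of_mem _ ?_ fun s _ hs => ?_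
  · rw [Finset.mem_range, Nat.floor_lt (mul_nonneg (by positivity) ht.1), Nat.cast_pow,
      Nat.cast_two]
    exact mul_lt_of_lt_one_right (by positivity) ht.2
  · rw [hat_eq_zero_of_ne_floor hs, mul_zero]
    exact zero_smul ℝ (diffAt (1 / 2 ^ (k + 1)) (s / 2 ^ k))

lemma interpAt_succ (k : ℕ) {t : ℝ} (ht : t ∈ Set.Ico 0 1) :
    interpAt (k + 1) t = interpAt k t + levelAt k t := by
  have h_nonneg : 0 ≤ 2 ^ k * t := mul_nonneg (by positivity) ht.1
  have h_lower := Nat.floor_le h_nonneg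
  have h_upper := Nat.lt_floor_add_one (2 ^ k * t)
  rw [levelAt_eq k ht, diffAt, interpAt, interpAt]
  set m := ⌊2 ^ k * t⌋₊
  have h_right : (m : ℝ) / 2 ^ k + 2 * (1 / 2 ^ (k + 1)) = (m + 1) / 2 ^ k := by
    rw [pow_succ]; field_simp
  have h_mid : (m : ℝ) / 2 ^ k + 1 / 2 ^ (k + 1) = (2 * m + 1) / 2 ^ (k + 1) := by
    rw [pow_succ]; field_simp
  obtain ⟨θ, hθ⟩ : ∃ θ, 2 ^ k * t = m + θ := ⟨_, (add_sub_cancel _ _).symm⟩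
  have h_double : (2 : ℝ) ^ (k + 1) * t = 2 * m + 2 * θ := by rw [pow_succ]; linarith
  rw [h_right, h_mid, hθ, h_double]
  by_cases h_half : θ < 1 / 2
  · have h_floor : ⌊(2 * m + 2 * θ : ℝ)⌋₊ = 2 * m := by
      rw [Nat.floor_eq_iff (by linarith)]
      push_cast
      constructor <;> linarith
    have h_hat : hat k m t = 2 * θ := by
      rw [hat, h_double, abs_of_nonpos (by linarith), max_eq_left (by linarith)]; ring
    have h_left : (2 * m : ℝ) / 2 ^ (k + 1) = m / 2 ^ k := by rw [pow_succ]; field_simp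
    rw [h_floor, h_hat]
    push_cast
    rw [h_left]
    module
  · have h_floor : ⌊(2 * m + 2 * θ : ℝ)⌋₊ = 2 * m + 1 := by
      rw [Nat.floor_eq_iff (by linarith)]
      push_cast
      constructor <;> linarith
    have h_hat : hat k m t = 2 - 2 * θ := by
      rw [hat, h_double, abs_of_nonneg (by linarith), max_eq_left (by linarith)]; ring
    have h_right' : (2 * m + 1 + 1 : ℝ) / 2 ^ (k + 1) = (m + 1) / 2 ^ k := by
      rw [pow_succ]; field_simp; ring
    rw [h_floor, h_hat]
    push_cast
    rw [h_right']
    module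

lemma interpAt_eq_sum (n : ℕ) {t : ℝ} (ht : t ∈ Set.Ico 0 1) :
    interpAt n t = ∑ k ∈ Finset.range n, levelAt k t + interpAt 0 t := by
  induction n with
  | zero => simp
  | succ n ih => rw [interpAt_succ n ht, ih, Finset.sum_range_succ]; abel

lemma interpAt_zero_apply {t u : ℝ} (ht : t < 1) (hu : u ∉ ({0, 1} : Set ℝ)) :
    interpAt 0 t u = 0 := by
  simp only [Set.mem_insert_iff, Set.mem_singleton_iff, not_or] at hu
  simp [interpAt, Nat.floor_eq_zero.2 ht, evalAt, DFinsupp.single_apply, Ne.symm hu.1,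
    Ne.symm hu.2]

/-- The coefficients of the Faber series. -/
def coef (f : (Fin d → ℝ) → ℝ) (k s : Fin d → ℕ) : ℝ :=
  (-(1 / 2)) ^ d * mixedDiff Finset.univ (fun j => 1 / 2 ^ (k j + 1)) f fun j => s j / 2 ^ k j

/-- The positions of the hat functions of level `k` in the unit cube. -/
def positions (k : Fin d → ℕ) : Finset (Fin d → ℕ) :=
  Fintype.piFinset fun j => Finset.range (2 ^ k j)

/-- The term of level `k` of the Faber series. -/
def level (f : (Fin d → ℝ) → ℝ) (k : Fin d → ℕ) (x : Fin d → ℝ) : ℝ :=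
  ∑ s ∈ positions k, coef f k s * ∏ j, hat (k j) (s j) (x j)

lemma tensorEval_levelAt (f : (Fin d → ℝ) → ℝ) (k : Fin d → ℕ) (x : Fin d → ℝ) :
    tensorEval f (fun i => levelAt (k i) (x i)) = level f k x := by
  simp only [levelAt]
  rw [MultilinearMap.map_sum_finset]
  refine Finset.sum_congr rfl fun s _ => ?_
  rw [MultilinearMap.map_smul_univ, coef, mixedDiff_eq_tensorEval, Finset.piecewise_univ,
    Finset.prod_mul_distrib, Finset.prod_const, Finset.card_univ, Fintype.card_fin, smul_eq_mul,
    mul_right_comm]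

lemma tensorEval_interpAt_eq_sum {f : (Fin d → ℝ) → ℝ}
    (hf : ∀ y i, y i = 0 ∨ y i = 1 → f y = 0) (n : ℕ) {x : Fin d → ℝ}
    (hx : ∀ i, x i ∈ Set.Ico 0 1) :
    tensorEval f (fun i => interpAt n (x i))
      = ∑ k ∈ Fintype.piFinset fun _ : Fin d => Finset.range n, level f k x := by
  have h_split : (fun i => interpAt n (x i)) = (fun i => ∑ k ∈ Finset.range n, levelAt k (x i))
      + fun i => interpAt 0 (x i) := funext fun i => interpAt_eq_sum n (hx i)
  rw [h_split, MultilinearMap.map_add_univ,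
    Finset.sum_eq_single_of_mem Finset.univ (Finset.mem_univ _), Finset.piecewise_univ,
    MultilinearMap.map_sum_finset]
  · exact Finset.sum_congr rfl fun k _ => tensorEval_levelAt f k x
  · intro S _ hS
    obtain ⟨i, hi⟩ : ∃ i, i ∉ S := by
      contrapose! hS
      exact Finset.eq_univ_of_forall hS
    refine tensorEval_eq_zero i (S := {0, 1}) (fun y hy => hf y i hy) fun t ht => ?_
    rw [Finset.piecewise_eq_of_notMem _ _ _ hi]
    exact interpAt_zero_apply (hx i).2 ht

lemma tensorEval_interpAt (f : (Fin d → ℝ) → ℝ) (n : ℕ) (x : Fin d → ℝ) :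
    tensorEval f (fun i => interpAt n (x i)) = ∑ S : Finset (Fin d),
      (∏ i, S.piecewise (fun i => 1 - (2 ^ n * x i - ⌊2 ^ n * x i⌋₊))
        (fun i => 2 ^ n * x i - ⌊2 ^ n * x i⌋₊) i)
      * f (S.piecewise (fun i => ⌊2 ^ n * x i⌋₊ / 2 ^ n)
          fun i => (⌊2 ^ n * x i⌋₊ + 1) / 2 ^ n) := by
  refine (MultilinearMap.map_add_univ (tensorEval f) _ _).trans <|
    Finset.sum_congr rfl fun S _ => ?_
  rw [← tensorEval_evalAt f, ← smul_eq_mul, ← MultilinearMap.map_smul_univ]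
  congr 1
  funext i
  by_cases hi : i ∈ S <;> simp [hi]

lemma abs_sum_mul_sub_le {ι : Type*} [Fintype ι] {w : ι → ℝ} (hw : ∀ i, w i ∈ I)
    (h_sum : ∑ i, w i = 1) (g : ι → ℝ) (c : ℝ) : |∑ i, w i * g i - c| ≤ ∑ i, |g i - c| := by
  have h_eq : ∑ i, w i * g i - c = ∑ i, w i * (g i - c) := by
    simp only [mul_sub, Finset.sum_sub_distrib, ← Finset.sum_mul, h_sum, one_mul]
  rw [h_eq]
  refine (Finset.abs_sum_le_sum_abs _ _).trans (Finset.sum_le_sum fun i _ => ?_)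
  rw [abs_mul, abs_of_nonneg (hw i).1]
  exact mul_le_of_le_one_left (abs_nonneg _) (hw i).2

lemma sum_prod_piecewise_one_sub (θ : Fin d → ℝ) :
    ∑ S : Finset (Fin d), ∏ i, S.piecewise (fun i => 1 - θ i) θ i = 1 := by
  have h := (MultilinearMap.mkPiAlgebra ℝ (Fin d) ℝ).map_add_univ (fun i => 1 - θ i) θ
  simp only [MultilinearMap.mkPiAlgebra_apply, Pi.add_apply, sub_add_cancel] at h
  rw [← h, Finset.prod_const_one]

lemma prod_piecewise_one_sub_mem {θ : Fin d → ℝ} (hθ : ∀ i, θ i ∈ I) (S : Finset (Fin d)) :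
    ∏ i, S.piecewise (fun i => 1 - θ i) θ i ∈ I := by
  refine unitInterval.prod_mem fun i _ => ?_
  by_cases hi : i ∈ S
  · rw [Finset.piecewise_eq_of_mem _ _ _ hi]
    exact Set.Icc.mem_iff_one_sub_mem.1 (hθ i)
  · rw [Finset.piecewise_eq_of_notMem _ _ _ hi]
    exact hθ i

lemma tendsto_floor_two_pow_mul_div {t : ℝ} (ht : 0 ≤ t) :
    Filter.Tendsto (fun n : ℕ => (⌊2 ^ n * t⌋₊ : ℝ) / 2 ^ n) Filter.atTop (nhds t) := by
  simp only [mul_comm _ t]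
  exact (tendsto_nat_floor_mul_div_atTop ht).comp (tendsto_pow_atTop_atTop_of_one_lt one_lt_two)

lemma tendsto_piecewise_node {x : Fin d → ℝ} (hx : 0 ≤ x) (S : Finset (Fin d)) :
    Filter.Tendsto (fun n : ℕ => S.piecewise (fun i => (⌊2 ^ n * x i⌋₊ : ℝ) / 2 ^ n)
      fun i => (⌊2 ^ n * x i⌋₊ + 1) / 2 ^ n) Filter.atTop (nhds x) := by
  refine tendsto_pi_nhds.2 fun i => ?_
  have h_left := tendsto_floor_two_pow_mul_div (hx i)
  by_cases hi : i ∈ S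
  · simpa only [Finset.piecewise_eq_of_mem _ _ _ hi] using h_left
  · have h_mesh : Filter.Tendsto (fun n : ℕ => (1 : ℝ) / 2 ^ n) Filter.atTop (nhds 0) := by
      simp only [← one_div_pow]
      exact tendsto_pow_atTop_nhds_zero_of_lt_one (by norm_num) (by norm_num)
    simpa only [Finset.piecewise_eq_of_notMem _ _ _ hi, add_div, add_zero] using h_left.add h_mesh

lemma tendsto_tensorEval_interpAt {f : (Fin d → ℝ) → ℝ} (hf : Continuous f) {x : Fin d → ℝ}
    (hx : 0 ≤ x) :
    Filter.Tendsto (fun n => tensorEval f fun i => interpAt n (x i)) Filter.atTop (nhds (f x)) := by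
  have h_frac (n : ℕ) (i : Fin d) : 2 ^ n * x i - ⌊2 ^ n * x i⌋₊ ∈ I :=
    ⟨sub_nonneg.2 (Nat.floor_le (mul_nonneg (by positivity) (hx i))),
      sub_le_iff_le_add'.2 (Nat.lt_floor_add_one _).le⟩
  have h_error (n : ℕ) : |(tensorEval f fun i => interpAt n (x i)) - f x|
      ≤ ∑ S : Finset (Fin d), |f (S.piecewise (fun i => ⌊2 ^ n * x i⌋₊ / 2 ^ n)
          fun i => (⌊2 ^ n * x i⌋₊ + 1) / 2 ^ n) - f x| := by
    rw [tensorEval_interpAt]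
    exact abs_sum_mul_sub_le (prod_piecewise_one_sub_mem (h_frac n))
      (sum_prod_piecewise_one_sub _) _ _
  refine tendsto_sub_nhds_zero_iff.1 (squeeze_zero_norm h_error ?_)
  rw [← Fintype.sum_eq_zero (fun _ : Finset (Fin d) => (0 : ℝ)) fun _ => rfl]
  refine tendsto_finsetSum _ fun S _ => ?_
  have h_node := (((hf.tendsto x).comp (tendsto_piecewise_node hx S)).sub_const (f x)).abs
  rwa [sub_self, abs_zero] at h_node

lemma prod_hat_eq_zero {k s : Fin d → ℕ} (hs : s ∈ positions k) {x : Fin d → ℝ} {i : Fin d}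
    (hi : x i ∉ Set.Ioo 0 1) : ∏ j, hat (k j) (s j) (x j) = 0 :=
  Finset.prod_eq_zero (Finset.mem_univ i)
    (hat_eq_zero (Finset.mem_range.1 (Fintype.mem_piFinset.1 hs i)) hi)

lemma tendsto_piFinset_range (κ : Type*) [Fintype κ] [DecidableEq κ] :
    Filter.Tendsto (fun n : ℕ => Fintype.piFinset fun _ : κ => Finset.range n)
      Filter.atTop Filter.atTop :=
  Filter.tendsto_atTop_finset_of_monotone
    (fun _ _ h => Fintype.piFinset_subset _ _ fun _ => Finset.range_mono h) fun k =>
    ⟨∑ j, k j + 1, Fintype.mem_piFinset.2 fun j => Finset.mem_range.2 <| Nat.lt_succ_of_le <|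
      Finset.single_le_sum (fun _ _ => Nat.zero_le _) (Finset.mem_univ j)⟩

lemma hasSum_level {f : (Fin d → ℝ) → ℝ} (hf : Continuous f)
    (hf₀ : ∀ y i, y i ∉ Set.Ioo 0 1 → f y = 0) {x : Fin d → ℝ}
    (hs : Summable fun k => level f k x) : HasSum (fun k => level f k x) (f x) := by
  by_cases hx : ∀ i, x i ∈ Set.Ioo 0 1
  · convert hs.hasSum
    refine tendsto_nhds_unique (tendsto_tensorEval_interpAt hf fun i => (hx i).1.le) ?_
    refine (hs.hasSum.comp (tendsto_piFinset_range (Fin d))).congr fun n => ?_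
    refine (tensorEval_interpAt_eq_sum (fun y i hi => hf₀ y i ?_) n fun i =>
      Set.Ioo_subset_Ico_self (hx i)).symm
    rcases hi with hi | hi <;> simp [hi]
  · push Not at hx
    obtain ⟨i, hi⟩ := hx
    have h_level (k : Fin d → ℕ) : level f k x = 0 :=
      Finset.sum_eq_zero fun s hs => by rw [prod_hat_eq_zero hs hi, mul_zero]
    simp only [h_level, hf₀ x i hi, hasSum_zero]

/-! ### Sums over sparse grids -/

lemma tsum_prod_le {κ : Type*} [Fintype κ] (g : ℕ → ℝ≥0∞) :
    ∑' k : κ → ℕ, ∏ j, g (k j) ≤ (∑' n, g n) ^ Fintype.card κ := by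
  classical
  refine le_of_tendsto' (ENNReal.summable.hasSum.comp (tendsto_piFinset_range κ)) fun n => ?_
  rw [Function.comp_apply, ← Finset.prod_univ_sum (fun _ : κ => Finset.range n) fun _ m => g m,
    Finset.prod_const]
  exact pow_le_pow_left' (ENNReal.sum_le_tsum _) _

lemma tsum_apply_sum_ne_le (i : Fin d) (φ : ℕ → ℕ → ℝ≥0∞) {C ρ : ℝ} (hρ₀ : 0 ≤ ρ) (hρ₁ : ρ < 1)
    (h : ∀ n, ∑' a, φ a n ≤ ENNReal.ofReal (C * ρ ^ n)) :
    ∑' k : Fin d → ℕ, φ (k i) (∑ j : {j // j ≠ i}, k j)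
      ≤ ENNReal.ofReal (C * ((1 - ρ)⁻¹) ^ (d - 1)) := by
  have h_split : ∑' k : Fin d → ℕ, φ (k i) (∑ j : {j // j ≠ i}, k j)
      = ∑' p : ℕ × ({j // j ≠ i} → ℕ), φ p.1 (∑ j, p.2 j) :=
    (Equiv.funSplitAt i ℕ).tsum_eq fun p : ℕ × ({j // j ≠ i} → ℕ) => φ p.1 (∑ j, p.2 j)
  have h_geom : ∑' n, ENNReal.ofReal ρ ^ n = ENNReal.ofReal (1 - ρ)⁻¹ := by
    rw [ENNReal.tsum_geometric, ENNReal.ofReal_inv_of_pos (sub_pos.2 hρ₁),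
      ENNReal.ofReal_sub _ hρ₀, ENNReal.ofReal_one]
  have h_card : Fintype.card {j // j ≠ i} = d - 1 := by
    rw [Fintype.card_subtype_compl, Fintype.card_fin, Fintype.card_subtype_eq]
  calc ∑' k : Fin d → ℕ, φ (k i) (∑ j : {j // j ≠ i}, k j)
      = ∑' k : {j // j ≠ i} → ℕ, ∑' a, φ a (∑ j, k j) := by
        rw [h_split, ENNReal.tsum_prod (f := fun a (k : {j // j ≠ i} → ℕ) => φ a (∑ j, k j)),
          ENNReal.tsum_comm]
    _ ≤ ∑' k : {j // j ≠ i} → ℕ, ENNReal.ofReal C * ∏ j, ENNReal.ofReal ρ ^ k j := by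
        refine ENNReal.tsum_le_tsum fun k => (h _).trans_eq ?_
        rw [ENNReal.ofReal_mul' (pow_nonneg hρ₀ _), ENNReal.ofReal_pow hρ₀,
          Finset.prod_pow_eq_pow_sum]
    _ ≤ ENNReal.ofReal C * ENNReal.ofReal (1 - ρ)⁻¹ ^ (d - 1) := by
        rw [ENNReal.tsum_mul_left, ← h_geom, ← h_card]
        gcongr
        exact tsum_prod_le fun n => ENNReal.ofReal ρ ^ n
    _ = ENNReal.ofReal (C * ((1 - ρ)⁻¹) ^ (d - 1)) := by
        have h_nonneg : 0 ≤ (1 - ρ)⁻¹ := inv_nonneg.2 (sub_nonneg.2 hρ₁.le)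
        rw [ENNReal.ofReal_mul' (pow_nonneg h_nonneg _), ENNReal.ofReal_pow h_nonneg]

/-- The factor `2 ^ (kᵢ - α |k|)` in the bound for the `i`-th derivative of level `k`. -/
def weight (α : ℝ) (i : Fin d) (k : Fin d → ℕ) : ℝ := (2 : ℝ) ^ ((k i : ℝ) - α * ∑ j, (k j : ℝ))

lemma weight_nonneg (α : ℝ) (i : Fin d) (k : Fin d → ℕ) : 0 ≤ weight α i k := by
  unfold weight; positivity

lemma sum_eq_add_sum_ne (i : Fin d) (k : Fin d → ℕ) :
    ∑ j, (k j : ℝ) = k i + (∑ j : {j // j ≠ i}, k j : ℕ) := by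
  rw [Fintype.sum_eq_add_sum_subtype_ne _ i, Nat.cast_sum]

lemma weight_eq (α : ℝ) (i : Fin d) (k : Fin d → ℕ) :
    weight α i k = ((2 : ℝ) ^ (1 - α)) ^ k i * ((2 : ℝ) ^ (-α)) ^ (∑ j : {j // j ≠ i}, k j) := by
  rw [weight, sum_eq_add_sum_ne i, ← Real.rpow_mul_natCast zero_le_two,
    ← Real.rpow_mul_natCast zero_le_two, ← Real.rpow_add two_pos]
  congr 1
  ring

lemma two_rpow_lt_one {t : ℝ} (ht : t < 0) : (2 : ℝ) ^ t < 1 :=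
  Real.rpow_lt_one_of_one_lt_of_neg one_lt_two ht

lemma tsum_ofReal_pow_mul {r c : ℝ} (hr₀ : 0 ≤ r) (hr₁ : r < 1) (hc : 0 ≤ c) :
    ∑' n, ENNReal.ofReal (r ^ n * c) = ENNReal.ofReal ((1 - r)⁻¹ * c) := by
  rw [← ENNReal.ofReal_tsum_of_nonneg (fun n => by positivity)
    ((summable_geometric_of_lt_one hr₀ hr₁).mul_right c), tsum_mul_right,
    tsum_geometric_of_lt_one hr₀ hr₁]

lemma tsum_ofReal_weight_le {α : ℝ} (hα : 1 < α) (i : Fin d) :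
    ∑' k : Fin d → ℕ, ENNReal.ofReal (weight α i k)
      ≤ ENNReal.ofReal ((1 - (2 : ℝ) ^ (1 - α))⁻¹ * ((1 - (2 : ℝ) ^ (-α))⁻¹) ^ (d - 1)) := by
  simp only [weight_eq]
  exact tsum_apply_sum_ne_le i
    (fun a n => ENNReal.ofReal (((2 : ℝ) ^ (1 - α)) ^ a * ((2 : ℝ) ^ (-α)) ^ n))
    (by positivity) (two_rpow_lt_one (by linarith)) fun n =>
      (tsum_ofReal_pow_mul (by positivity) (two_rpow_lt_one (by linarith)) (by positivity)).le

lemma summable_weight {α : ℝ} (hα : 1 < α) (i : Fin d) :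
    Summable fun k : Fin d → ℕ => weight α i k := by
  have h := ENNReal.summable_toReal
    ((tsum_ofReal_weight_le hα i).trans_lt ENNReal.ofReal_lt_top).ne
  simpa only [ENNReal.toReal_ofReal (weight_nonneg α i _)] using h

lemma tsum_weight_le {α : ℝ} (hα : 1 < α) (i : Fin d) :
    ∑' k : Fin d → ℕ, weight α i k
      ≤ (1 - (2 : ℝ) ^ (1 - α))⁻¹ * ((1 - (2 : ℝ) ^ (-α))⁻¹) ^ (d - 1) := by
  have h₁ : 0 < 1 - (2 : ℝ) ^ (1 - α) := sub_pos.2 (two_rpow_lt_one (by linarith))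
  have h₂ : 0 < 1 - (2 : ℝ) ^ (-α) := sub_pos.2 (two_rpow_lt_one (by linarith))
  have h := tsum_ofReal_weight_le hα i
  rwa [← ENNReal.ofReal_tsum_of_nonneg (weight_nonneg α i) (summable_weight hα i),
    ENNReal.ofReal_le_ofReal_iff (by positivity)] at h

/-- The levels of the energy-based sparse grid with parameter `β` and resolution `m`. -/
def sparse (d : ℕ) (β m : ℝ) : Set (Fin d → ℕ) :=
  {k | ∃ i, β * ∑ j, (k j : ℝ) - k i ≤ (β - 1) * m}

lemma finite_sparse (d : ℕ) {β : ℝ} (hβ : 1 < β) (m : ℝ) : (sparse d β m).Finite := by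
  refine (Fintype.piFinset fun _ : Fin d => Finset.range (⌊m⌋₊ + 1)).finite_toSet.subset ?_
  rintro k ⟨i, hi⟩
  refine Finset.mem_coe.2 <| Fintype.mem_piFinset.2 fun j => Finset.mem_range.2 <|
    Nat.lt_succ_of_le <| Nat.le_floor <| le_of_mul_le_mul_left ?_ (sub_pos.2 hβ)
  have h_le (j : Fin d) : (k j : ℝ) ≤ ∑ j, (k j : ℝ) :=
    Finset.single_le_sum (f := fun j => (k j : ℝ)) (fun _ _ => Nat.cast_nonneg _)
      (Finset.mem_univ j)
  calc (β - 1) * k j ≤ (β - 1) * ∑ j, (k j : ℝ) :=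
        mul_le_mul_of_nonneg_left (h_le j) (sub_nonneg.2 hβ.le)
    _ ≤ β * ∑ j, (k j : ℝ) - k i := by linarith [h_le i]
    _ ≤ (β - 1) * m := hi

lemma mem_sparse_iff {β m : ℝ} (hβ : 1 < β) {k : Fin d → ℕ} : k ∈ sparse d β m ↔
    ∃ i, (k i : ℝ) ≤ m - β / (β - 1) * (∑ j : {j // j ≠ i}, k j : ℕ) := by
  refine exists_congr fun i => ?_
  rw [sum_eq_add_sum_ne i]
  generalize ((∑ j : {j // j ≠ i}, k j : ℕ) : ℝ) = n
  have h_pos : 0 < β - 1 := sub_pos.2 hβ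
  have h_eq : m - β / (β - 1) * n = ((β - 1) * m - β * n) / (β - 1) := by field_simp
  rw [h_eq, le_div_iff₀ h_pos]
  constructor <;> intro h <;> linarith

lemma tsum_ite_lt_pow_le {r τ : ℝ} (hr₀ : 0 < r) (hr₁ : r < 1) :
    ∑' a : ℕ, (if τ < a then ENNReal.ofReal (r ^ a) else 0)
      ≤ ENNReal.ofReal (r ^ τ * (1 - r)⁻¹) := by
  have h_head : ∑ a ∈ Finset.range ⌈τ⌉₊, (if τ < a then ENNReal.ofReal (r ^ a) else 0) = 0 :=
    Finset.sum_eq_zero fun a ha => if_neg (Nat.lt_ceil.1 (Finset.mem_range.1 ha)).le.not_gt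
  rw [← Summable.sum_add_tsum_nat_add' (k := ⌈τ⌉₊) ENNReal.summable, h_head, zero_add]
  calc ∑' a : ℕ, (if τ < (a + ⌈τ⌉₊ : ℕ) then ENNReal.ofReal (r ^ (a + ⌈τ⌉₊)) else 0)
      ≤ ∑' a : ℕ, ENNReal.ofReal (r ^ a * r ^ ⌈τ⌉₊) := by
        refine ENNReal.tsum_le_tsum fun a => ?_
        split_ifs
        · rw [pow_add]
        · exact zero_le
    _ = ENNReal.ofReal ((1 - r)⁻¹ * r ^ (⌈τ⌉₊ : ℝ)) := by
        rw [tsum_ofReal_pow_mul hr₀.le hr₁ (by positivity), Real.rpow_natCast]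
    _ ≤ ENNReal.ofReal (r ^ τ * (1 - r)⁻¹) := by
        rw [mul_comm]
        refine ENNReal.ofReal_le_ofReal (mul_le_mul_of_nonneg_right ?_
          (inv_nonneg.2 (sub_nonneg.2 hr₁.le)))
        exact Real.rpow_le_rpow_of_exponent_ge hr₀ hr₁.le (Nat.le_ceil τ)

lemma tsum_ite_le_two_pow_le (τ : ℝ) :
    ∑' a : ℕ, (if (a : ℝ) ≤ τ then (2 : ℝ≥0∞) ^ a else 0) ≤ ENNReal.ofReal (2 * 2 ^ τ) := by
  obtain hτ | hτ := lt_or_ge τ 0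
  · rw [ENNReal.tsum_eq_zero.2 fun a => if_neg (hτ.trans_le a.cast_nonneg).not_ge]
    exact zero_le
  rw [tsum_eq_sum (s := Finset.range (⌊τ⌋₊ + 1)) fun a ha => if_neg fun h =>
    ha (Finset.mem_range.2 (Nat.lt_succ_of_le (Nat.le_floor h)))]
  calc ∑ a ∈ Finset.range (⌊τ⌋₊ + 1), (if (a : ℝ) ≤ τ then (2 : ℝ≥0∞) ^ a else 0)
      ≤ ((∑ a ∈ Finset.range (⌊τ⌋₊ + 1), 2 ^ a : ℕ) : ℝ≥0∞) := by
        push_cast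
        exact Finset.sum_le_sum fun a _ => by split_ifs <;> simp
    _ ≤ ((2 ^ (⌊τ⌋₊ + 1) : ℕ) : ℝ≥0∞) := by
        rw [Nat.geomSum_eq le_rfl, Nat.div_one]
        gcongr
        exact Nat.sub_le _ _
    _ ≤ ENNReal.ofReal (2 * 2 ^ τ) := by
        rw [← ENNReal.ofReal_natCast, Nat.cast_pow, Nat.cast_two, pow_succ', ← Real.rpow_natCast]
        gcongr
        · exact one_le_two
        · exact Nat.floor_le hτ

open Classical in
lemma tsum_weight_compl_sparse_le {α β : ℝ} (hα : 1 < α) (hβ : α < β) (m : ℝ) (i : Fin d) :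
    ∑' k : Fin d → ℕ, (if k ∈ sparse d β m then 0 else ENNReal.ofReal (weight α i k))
      ≤ ENNReal.ofReal ((2 : ℝ) ^ ((1 - α) * m) * (1 - (2 : ℝ) ^ (1 - α))⁻¹
        * ((gap α β)⁻¹) ^ (d - 1)) := by
  have hβ₁ : 0 < β - 1 := sub_pos.2 (hα.trans hβ)
  have h_ratio : (2 : ℝ) ^ (-((β - α) / (β - 1))) < 1 :=
    two_rpow_lt_one (neg_neg_of_pos (div_pos (sub_pos.2 hβ) hβ₁))
  set r := (2 : ℝ) ^ (1 - α) with hr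
  have h_fiber (n : ℕ) : ∑' a : ℕ, (if m - β / (β - 1) * n < a then ENNReal.ofReal (r ^ a) else 0)
        * ENNReal.ofReal (((2 : ℝ) ^ (-α)) ^ n)
      ≤ ENNReal.ofReal (2 ^ ((1 - α) * m) * (1 - r)⁻¹ * (2 ^ (-((β - α) / (β - 1)))) ^ n) := by
    have h_rpow : r ^ (m - β / (β - 1) * n) * ((2 : ℝ) ^ (-α)) ^ n
        = 2 ^ ((1 - α) * m) * (2 ^ (-((β - α) / (β - 1)))) ^ n := by
      rw [hr, ← Real.rpow_mul zero_le_two, ← Real.rpow_mul_natCast zero_le_two,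
        ← Real.rpow_mul_natCast zero_le_two, ← Real.rpow_add two_pos, ← Real.rpow_add two_pos]
      congr 1
      field_simp
      ring
    rw [ENNReal.tsum_mul_right, mul_right_comm, ← h_rpow, mul_right_comm,
      ENNReal.ofReal_mul' (by positivity)]
    gcongr
    exact tsum_ite_lt_pow_le (by positivity) (two_rpow_lt_one (by linarith))
  refine (ENNReal.tsum_le_tsum fun k => ?_).trans
    (tsum_apply_sum_ne_le i (fun a n => (if m - β / (β - 1) * n < a then ENNReal.ofReal (r ^ a)
      else 0) * ENNReal.ofReal (((2 : ℝ) ^ (-α)) ^ n)) (by positivity) h_ratio h_fiber)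
  by_cases hk : k ∈ sparse d β m
  · rw [if_pos hk]
    exact zero_le
  · have h_lt : m - β / (β - 1) * (∑ j : {j // j ≠ i}, k j : ℕ) < k i :=
      not_le.1 fun h => hk ((mem_sparse_iff (hα.trans hβ)).2 ⟨i, h⟩)
    rw [if_neg hk, if_pos h_lt, weight_eq, ENNReal.ofReal_mul (by positivity)]

lemma card_positions (k : Fin d → ℕ) (i : Fin d) :
    (positions k).card = 2 ^ k i * 2 ^ ∑ j : {j // j ≠ i}, k j := by
  simp only [positions, Fintype.card_piFinset, Finset.card_range]
  rw [Finset.prod_pow_eq_pow_sum, Fintype.sum_eq_add_sum_subtype_ne _ i, pow_add]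

lemma tsum_two_pow_le {β : ℝ} (hβ : 1 < β) (m : ℝ) (i : Fin d) :
    ∑' k : Fin d → ℕ, (if (k i : ℝ) ≤ m - β / (β - 1) * (∑ j : {j // j ≠ i}, k j : ℕ)
        then (2 : ℝ≥0∞) ^ k i else 0) * 2 ^ ∑ j : {j // j ≠ i}, k j
      ≤ ENNReal.ofReal (2 * 2 ^ m * ((1 - (2 : ℝ) ^ (-(1 / (β - 1))))⁻¹) ^ (d - 1)) := by
  have hβ₁ : 0 < β - 1 := sub_pos.2 hβ
  refine tsum_apply_sum_ne_le i (fun a n => (if (a : ℝ) ≤ m - β / (β - 1) * n then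
    (2 : ℝ≥0∞) ^ a else 0) * 2 ^ n) (by positivity)
    (two_rpow_lt_one (neg_neg_of_pos (one_div_pos.2 hβ₁))) fun n => ?_
  have h_rpow : (2 : ℝ) ^ (m - β / (β - 1) * n) * 2 ^ n
      = 2 ^ m * (2 ^ (-(1 / (β - 1)))) ^ n := by
    rw [← Real.rpow_mul_natCast zero_le_two, ← Real.rpow_natCast 2 n, ← Real.rpow_add two_pos,
      ← Real.rpow_add two_pos]
    congr 1
    field_simp
    ring
  have h_two : (2 : ℝ≥0∞) ^ n = ENNReal.ofReal (2 ^ n) := by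
    rw [ENNReal.ofReal_pow zero_le_two, ENNReal.ofReal_ofNat]
  rw [ENNReal.tsum_mul_right, mul_assoc 2, ← h_rpow, ← mul_assoc,
    ENNReal.ofReal_mul (by positivity), h_two]
  gcongr
  exact tsum_ite_le_two_pow_le _

lemma sum_card_positions_le {β : ℝ} (hβ : 1 < β) (m : ℝ) :
    ((∑ k ∈ (finite_sparse d hβ m).toFinset, (positions k).card : ℕ) : ℝ)
      ≤ 2 * d * 2 ^ m * ((1 - (2 : ℝ) ^ (-(1 / (β - 1))))⁻¹) ^ (d - 1) := by
  set C := 2 * 2 ^ m * ((1 - (2 : ℝ) ^ (-(1 / (β - 1))))⁻¹) ^ (d - 1)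
  have h_pos : 0 < 1 - (2 : ℝ) ^ (-(1 / (β - 1))) :=
    sub_pos.2 (two_rpow_lt_one (neg_neg_of_pos (one_div_pos.2 (sub_pos.2 hβ))))
  have h_card : ((∑ k ∈ (finite_sparse d hβ m).toFinset, (positions k).card : ℕ) : ℝ≥0∞)
      ≤ ∑ _i : Fin d, ENNReal.ofReal C := by
    refine le_trans ?_ (Finset.sum_le_sum fun i _ => tsum_two_pow_le hβ m i)
    rw [← Summable.tsum_finsetSum fun _ _ => ENNReal.summable, Nat.cast_sum]
    refine (Finset.sum_le_sum fun k hk => ?_).trans (ENNReal.sum_le_tsum _)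
    obtain ⟨i, hi⟩ := (mem_sparse_iff hβ).1 ((finite_sparse d hβ m).mem_toFinset.1 hk)
    refine le_trans ?_ (Finset.single_le_sum (fun _ _ => zero_le) (Finset.mem_univ i))
    rw [if_pos hi, card_positions k i]
    push_cast
    exact le_rfl
  rw [Finset.sum_const, Finset.card_univ, Fintype.card_fin, nsmul_eq_mul, ← ENNReal.ofReal_natCast,
    ← ENNReal.ofReal_natCast, ← ENNReal.ofReal_mul (by positivity),
    ENNReal.ofReal_le_ofReal_iff (by positivity)] at h_card
  exact h_card.trans_eq (by ring)

/-! ### Norms of sums of hat functions -/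

/-- The sum of the hat functions of level `k`. -/
def sawtooth (k : ℕ) (t : ℝ) : ℝ := ∑ s ∈ Finset.range (2 ^ k), hat k s t

lemma continuous_hat (k s : ℕ) : Continuous (hat k s) := by
  unfold hat
  fun_prop

lemma sawtooth_mem (k : ℕ) (t : ℝ) : sawtooth k t ∈ I := sum_hat_mem k t

lemma continuous_sawtooth (k : ℕ) : Continuous (sawtooth k) :=
  continuous_finsetSum _ fun s _ => continuous_hat k s

lemma integral_max_one_sub_abs_rpow {p : ℝ} (hp : 0 < p) :
    ∫ v : ℝ, (max (1 - |v|) 0) ^ p = 2 * (p + 1)⁻¹ := by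
  have h_outside : ∀ v ∈ Set.Ioi (0 : ℝ) \ Set.Ioc 0 1, (max (1 - v) 0) ^ p = 0 := by
    rintro v ⟨h_pos, h_notMem⟩
    have h_gt : 1 < v := not_le.1 fun h => h_notMem ⟨h_pos, h⟩
    rw [max_eq_right (by linarith), Real.zero_rpow hp.ne']
  have h_inside : ∀ v ∈ Set.Ioc (0 : ℝ) 1, (max (1 - v) 0) ^ p = (1 - v) ^ p := fun v hv => by
    rw [max_eq_left (sub_nonneg.2 hv.2)]
  rw [integral_comp_abs (f := fun v => (max (1 - v) 0) ^ p),
    setIntegral_eq_of_subset_of_forall_sdiff_eq_zero measurableSet_Ioi Set.Ioc_subset_Ioi_self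
      h_outside, setIntegral_congr_fun measurableSet_Ioc h_inside,
    ← intervalIntegral.integral_of_le zero_le_one,
    intervalIntegral.integral_comp_sub_left (fun v => v ^ p) 1, integral_rpow (.inl (by linarith))]
  simp [Real.zero_rpow (by linarith : p + 1 ≠ 0)]

lemma integral_hat_rpow (k s : ℕ) {p : ℝ} (hp : 0 < p) :
    ∫ t, hat k s t ^ p = (1 / 2) ^ k * (p + 1)⁻¹ := by
  have h_hat (t : ℝ) : hat k s t ^ p =
      (fun v : ℝ => max (1 - |v - (2 * s + 1)|) 0 ^ p) (2 ^ (k + 1) * t) := by rw [hat, sub_sub]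
  rw [integral_congr_ae (.of_forall h_hat), Measure.integral_comp_mul_left
      (fun v : ℝ => max (1 - |v - (2 * s + 1)|) 0 ^ p),
    integral_sub_right_eq_self (fun v : ℝ => max (1 - |v|) 0 ^ p), integral_max_one_sub_abs_rpow hp,
    smul_eq_mul, abs_of_pos (by positivity), pow_succ, one_div_pow]
  field_simp

lemma integrable_hat_rpow (k s : ℕ) {p : ℝ} (hp : 0 < p) : Integrable fun t => hat k s t ^ p := by
  refine ((continuous_hat k s).rpow_const fun _ => .inr hp.le).integrable_of_hasCompactSupport <|
    .intro (isCompact_Icc (a := (s : ℝ) / 2 ^ k) (b := (s + 1) / 2 ^ k)) fun t ht => ?_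
  have h_hat : hat k s t = 0 := by
    by_contra h
    obtain ⟨h_lower, h_upper⟩ := mem_Ioo_of_hat_ne_zero h
    exact ht ⟨(div_le_iff₀' (by positivity)).2 h_lower.le,
      (le_div_iff₀' (by positivity)).2 h_upper.le⟩
  rw [h_hat, Real.zero_rpow hp.ne']

lemma sawtooth_rpow (k : ℕ) (t : ℝ) {p : ℝ} (hp : 0 < p) :
    sawtooth k t ^ p = ∑ s ∈ Finset.range (2 ^ k), hat k s t ^ p := by
  have h_zero {s : ℕ} (hs : s ≠ ⌊2 ^ k * t⌋₊) : hat k s t ^ p = 0 := by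
    rw [hat_eq_zero_of_ne_floor hs, Real.zero_rpow hp.ne']
  unfold sawtooth
  by_cases h : ⌊2 ^ k * t⌋₊ ∈ Finset.range (2 ^ k)
  · rw [Finset.sum_eq_single_of_mem _ h fun s _ hs => hat_eq_zero_of_ne_floor hs,
      Finset.sum_eq_single_of_mem _ h fun s _ hs => h_zero hs]
  · have h_ne {s : ℕ} (hs : s ∈ Finset.range (2 ^ k)) : s ≠ ⌊2 ^ k * t⌋₊ := fun e => h (e ▸ hs)
    rw [Finset.sum_eq_zero fun _ hs => hat_eq_zero_of_ne_floor (h_ne hs), Real.zero_rpow hp.ne',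
      Finset.sum_eq_zero fun _ hs => h_zero (h_ne hs)]

lemma setIntegral_sawtooth_rpow_le (k : ℕ) {p : ℝ} (hp : 0 < p) :
    ∫ t in I, sawtooth k t ^ p ≤ (p + 1)⁻¹ := by
  simp only [sawtooth_rpow k _ hp]
  rw [integral_finsetSum _ fun s _ => (integrable_hat_rpow k s hp).integrableOn]
  calc ∑ s ∈ Finset.range (2 ^ k), ∫ t in I, hat k s t ^ p
      ≤ ∑ _s ∈ Finset.range (2 ^ k), (1 / 2 : ℝ) ^ k * (p + 1)⁻¹ := by
        refine Finset.sum_le_sum fun s _ => ?_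
        rw [← integral_hat_rpow k s hp]
        exact setIntegral_le_integral (integrable_hat_rpow k s hp)
          (.of_forall fun t => Real.rpow_nonneg (hat_mem k s t).1 p)
    _ = (p + 1)⁻¹ := by
        rw [Finset.sum_const, Finset.card_range, nsmul_eq_mul, ← mul_assoc, Nat.cast_pow,
          Nat.cast_two, ← mul_pow, mul_one_div_cancel two_ne_zero, one_pow, one_mul]

lemma volume_restrict_cube (d : ℕ) : (volume : Measure (Fin d → ℝ)).restrict (cube d)
    = Measure.pi fun _ => (volume : Measure ℝ).restrict I := by
  rw [cube, ← Set.pi_univ_Icc, volume_pi, Measure.restrict_pi_pi]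
  rfl

instance : IsProbabilityMeasure ((volume : Measure (Fin d → ℝ)).restrict (cube d)) := by
  rw [volume_restrict_cube]
  have : IsProbabilityMeasure ((volume : Measure ℝ).restrict I) := ⟨by simp⟩
  infer_instance

lemma prod_sawtooth_mem (k : Fin d → ℕ) (S : Finset (Fin d)) (x : Fin d → ℝ) :
    ∏ j ∈ S, sawtooth (k j) (x j) ∈ I :=
  unitInterval.prod_mem fun j _ => sawtooth_mem (k j) (x j)

lemma continuous_prod_sawtooth (k : Fin d → ℕ) (S : Finset (Fin d)) :
    Continuous fun x : Fin d → ℝ => ∏ j ∈ S, sawtooth (k j) (x j) :=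
  continuous_finsetProd _ fun j _ => (continuous_sawtooth (k j)).comp (continuous_apply j)

lemma integral_prod_sawtooth_rpow_le (k : Fin d → ℕ) (S : Finset (Fin d)) {p : ℝ} (hp : 0 < p) :
    ∫ x in cube d, (∏ j ∈ S, sawtooth (k j) (x j)) ^ p ≤ ((p + 1)⁻¹) ^ S.card := by
  have h_prod (x : Fin d → ℝ) : (∏ j ∈ S, sawtooth (k j) (x j)) ^ p
      = ∏ j, if j ∈ S then sawtooth (k j) (x j) ^ p else 1 := by
    rw [← Real.finsetProd_rpow _ _ fun j _ => (sawtooth_mem _ _).1, Finset.prod_ite_mem,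
      Finset.univ_inter]
  simp only [h_prod]
  rw [volume_restrict_cube, integral_fintype_prod_eq_prod
    (fun j t => if j ∈ S then sawtooth (k j) t ^ p else 1)]
  have h_ite (j : Fin d) : (∫ t in I, if j ∈ S then sawtooth (k j) t ^ p else 1)
      = if j ∈ S then ∫ t in I, sawtooth (k j) t ^ p else 1 := by
    split_ifs <;> simp
  simp only [h_ite]
  rw [Finset.prod_ite_mem, Finset.univ_inter]
  refine (Finset.prod_le_prod (fun j _ => ?_) fun j _ =>
    setIntegral_sawtooth_rpow_le (k j) hp).trans_eq (Finset.prod_const _)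
  exact integral_nonneg fun t => Real.rpow_nonneg (sawtooth_mem _ t).1 p

lemma eLpNorm_prod_sawtooth_le {p : ℝ≥0∞} (hp : 1 ≤ p) (k : Fin d → ℕ) (S : Finset (Fin d)) :
    eLpNorm (fun x : Fin d → ℝ => ∏ j ∈ S, sawtooth (k j) (x j)) p (volume.restrict (cube d))
      ≤ ENNReal.ofReal (((pPow p 1)⁻¹) ^ S.card) := by
  have h_norm (x : Fin d → ℝ) : ‖∏ j ∈ S, sawtooth (k j) (x j)‖ = ∏ j ∈ S, sawtooth (k j) (x j) :=
    Real.norm_of_nonneg (prod_sawtooth_mem k S x).1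
  have h_bound (x : Fin d → ℝ) : ‖∏ j ∈ S, sawtooth (k j) (x j)‖ ≤ 1 :=
    (h_norm x).trans_le (prod_sawtooth_mem k S x).2
  obtain rfl | h_top := eq_or_ne p ⊤
  · refine (eLpNorm_le_of_ae_bound (.of_forall h_bound)).trans_eq ?_
    simp [pPow]
  have hp₀ : p ≠ 0 := (zero_lt_one.trans_le hp).ne'
  have hp_pos : 0 < p.toReal := ENNReal.toReal_pos hp₀ h_top
  have h_mem : MemLp (fun x : Fin d → ℝ => ∏ j ∈ S, sawtooth (k j) (x j)) p
      (volume.restrict (cube d)) :=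
    .of_bound (continuous_prod_sawtooth k S).aestronglyMeasurable 1 (.of_forall h_bound)
  rw [h_mem.eLpNorm_eq_integral_rpow_norm hp₀ h_top]
  simp only [h_norm]
  refine ENNReal.ofReal_le_ofReal ((Real.rpow_le_rpow
    (integral_nonneg fun x => Real.rpow_nonneg (prod_sawtooth_mem k S x).1 _)
    (integral_prod_sawtooth_rpow_le k S hp_pos) (by positivity)).trans_eq ?_)
  rw [pPow, if_neg h_top, one_div, ← Real.rpow_natCast, ← Real.rpow_natCast,
    ← Real.rpow_mul (by positivity), ← Real.inv_rpow (by positivity),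
    ← Real.rpow_mul (by positivity), mul_comm]

lemma eLpNorm_tsum_le {Ω ι : Type*} [MeasurableSpace Ω] [Countable ι] {μ : Measure Ω} {p : ℝ≥0∞}
    (hp : 1 ≤ p) {g : ι → Ω → ℝ} (hg : ∀ k, AEStronglyMeasurable (g k) μ)
    (hs : ∀ x, Summable fun k => g k x) :
    eLpNorm (fun x => ∑' k, g k x) p μ ≤ ∑' k, eLpNorm (g k) p μ := by
  refine Lp.eLpNorm_le_of_ae_tendsto (u := Filter.atTop) (f := fun S : Finset ι => ∑ k ∈ S, g k)
    (.of_forall fun S => (eLpNorm_sum_le (fun k _ => hg k) hp).trans (ENNReal.sum_le_tsum S))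
    (fun S => Finset.aestronglyMeasurable_sum S fun k _ => hg k) (.of_forall fun x => ?_)
  simp only [Finset.sum_apply]
  exact (hs x).hasSum

/-! ### Lipschitz functions in the Sobolev space -/

lemma measurableSet_cube (d : ℕ) : MeasurableSet (cube d) := measurableSet_Icc

lemma lipschitzWith_of_update {F : (Fin d → ℝ) → ℝ} {C : NNReal}
    (hF : ∀ x i t, |F (update x i t) - F x| ≤ C * |t - x i|) : LipschitzWith (d * C) F := by
  refine .of_dist_le_mul fun y x => ?_
  have h_piecewise (S : Finset (Fin d)) :
      |F (S.piecewise y x) - F x| ≤ S.card * (C * dist y x) := by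
    induction S using Finset.induction_on with
    | empty => simp
    | insert i S hi ih =>
      have h_step : |F (update (S.piecewise y x) i (y i)) - F (S.piecewise y x)|
          ≤ C * dist y x := by
        refine (hF _ i (y i)).trans ?_
        rw [Finset.piecewise_eq_of_notMem _ _ _ hi, ← Real.dist_eq]
        gcongr
        exact dist_le_pi_dist y x i
      rw [Finset.piecewise_insert, Finset.card_insert_of_notMem hi, Nat.cast_succ]
      linarith [abs_sub_le (F (update (S.piecewise y x) i (y i))) (F (S.piecewise y x)) (F x)]
  simpa [Real.dist_eq, mul_assoc] using h_piecewise Finset.univ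

lemma add_smul_single_eq_update (x : Fin d → ℝ) (i : Fin d) (t : ℝ) :
    x + t • Pi.single i (1 : ℝ) = update x i (x i + t) := by
  ext j
  obtain rfl | hj := eq_or_ne j i
  · simp
  · simp [hj]

lemma abs_lineDeriv_single_le {F : (Fin d → ℝ) → ℝ} {x : Fin d → ℝ} {i : Fin d} {c : ℝ}
    (hc : 0 ≤ c) (hF : ∀ t, |F (update x i t) - F x| ≤ c * |t - x i|) :
    |lineDeriv ℝ F x (Pi.single i 1)| ≤ c := by
  refine norm_deriv_le_of_lip' (f := fun t : ℝ => F (x + t • Pi.single i (1 : ℝ))) hc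
    (.of_forall fun t => ?_)
  simp only [add_smul_single_eq_update, add_zero, update_eq_self, sub_zero]
  simpa using hF (x i + t)

lemma lineDeriv_eq_zero_of_notMem_cube {F : (Fin d → ℝ) → ℝ} (hF : ∀ x ∉ cube d, F x = 0)
    {x : Fin d → ℝ} (hx : x ∉ cube d) (v : Fin d → ℝ) : lineDeriv ℝ F x v = 0 := by
  have h_eq : F =ᶠ[nhds x] fun _ => 0 := by
    filter_upwards [isClosed_Icc.isOpen_compl.mem_nhds hx] with y hy using hF y hy
  rw [h_eq.lineDeriv_eq]
  simp [lineDeriv]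

lemma hasZeroTrace_lineDeriv {F u : (Fin d → ℝ) → ℝ} {C : NNReal} (hF : LipschitzWith C F)
    (hF₀ : ∀ x ∉ cube d, F x = 0) (hu : ∀ x ∈ cube d, u x = F x) :
    HasZeroTrace u fun i x => lineDeriv ℝ F x (Pi.single i 1) := by
  intro i φ hφ hφc
  obtain ⟨D, hD⟩ := hφ.lipschitzWith_of_hasCompactSupport hφc (by simp)
  have h_u : ∫ x in cube d, u x * fderiv ℝ φ x (Pi.single i 1)
      = ∫ x, F x * fderiv ℝ φ x (Pi.single i 1) := by
    rw [← setIntegral_eq_integral_of_forall_compl_eq_zero (s := cube d)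
      (f := fun x => F x * fderiv ℝ φ x (Pi.single i 1)) fun x hx => by rw [hF₀ x hx, zero_mul]]
    exact setIntegral_congr_fun (measurableSet_cube d) fun x hx => by simp only [hu x hx]
  have h_deriv : ∫ x in cube d, lineDeriv ℝ F x (Pi.single i 1) * φ x
      = ∫ x, lineDeriv ℝ F x (Pi.single i 1) * φ x :=
    setIntegral_eq_integral_of_forall_compl_eq_zero fun x hx => by
      rw [lineDeriv_eq_zero_of_notMem_cube hF₀ hx, zero_mul]
  have h_neg (x : Fin d → ℝ) : lineDeriv ℝ φ x (-Pi.single i (1 : ℝ)) * F x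
      = -(F x * fderiv ℝ φ x (Pi.single i 1)) := by
    rw [(hφ.differentiable (by simp)).differentiableAt.lineDeriv_eq_fderiv, map_neg, neg_mul,
      mul_comm]
  rw [h_u, h_deriv, hF.integral_lineDeriv_mul_eq hD hφc, integral_congr_ae (.of_forall h_neg),
    integral_neg, add_neg_cancel]

lemma isW10Gradient_lineDeriv {p : ℝ≥0∞} {F u : (Fin d → ℝ) → ℝ} {C : NNReal}
    (hF : LipschitzWith C F) (hF₀ : ∀ x ∉ cube d, F x = 0) (hu : ∀ x ∈ cube d, u x = F x) :
    IsW10Gradient p u fun i x => lineDeriv ℝ F x (Pi.single i 1) where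
  memLp := by
    obtain ⟨K, hK⟩ := (isCompact_Icc (a := (0 : Fin d → ℝ)) (b := 1)).exists_bound_of_continuousOn
      hF.continuous.continuousOn
    rw [memLp_congr_ae (ae_restrict_of_forall_mem (measurableSet_cube d) hu)]
    exact .of_bound hF.continuous.aestronglyMeasurable K
      (ae_restrict_of_forall_mem (measurableSet_cube d) hK)
  memLp_grad i := .of_bound (aestronglyMeasurable_lineDeriv hF.continuous _)
    (C * ‖(Pi.single i 1 : Fin d → ℝ)‖)
    (.of_forall fun _ => norm_lineDeriv_le_of_lipschitz ℝ hF)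
  weak i φ hφ hφc _ := eq_neg_of_add_eq_zero_left (hasZeroTrace_lineDeriv hF hF₀ hu i φ hφ hφc)
  trace := hasZeroTrace_lineDeriv hF hF₀ hu

lemma gradNorm_le {p : ℝ≥0∞} (hp : 1 ≤ p) {g : Fin d → (Fin d → ℝ) → ℝ} {E : ℝ≥0∞}
    (hg : ∀ i, eLpNorm (g i) p (volume.restrict (cube d)) ≤ E) : gradNorm p g ≤ d * E := by
  rw [gradNorm]
  split_ifs with h_top
  · refine iSup_le fun i => ?_
    have hd : (1 : ℝ≥0∞) ≤ d := mod_cast i.pos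
    rw [← eLpNormEssSup, ← eLpNorm_exponent_top, ← h_top]
    exact (hg i).trans (le_mul_of_one_le_left' hd)
  · have hp₀ : p ≠ 0 := (zero_lt_one.trans_le hp).ne'
    have hp_pos : 0 < p.toReal := ENNReal.toReal_pos hp₀ h_top
    have hp_one : 1 ≤ p.toReal := by
      rw [← ENNReal.toReal_one]
      exact ENNReal.toReal_mono h_top hp
    have h_int (i : Fin d) : ∫⁻ x in cube d, ‖g i x‖ₑ ^ p.toReal ≤ E ^ p.toReal := by
      rw [← ENNReal.rpow_inv_le_iff hp_pos, ← one_div,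
        ← eLpNorm_eq_lintegral_rpow_enorm_toReal hp₀ h_top]
      exact hg i
    calc (∑ i, ∫⁻ x in cube d, ‖g i x‖ₑ ^ p.toReal) ^ (1 / p.toReal)
        ≤ (∑ _i : Fin d, E ^ p.toReal) ^ (1 / p.toReal) := by
          gcongr with i
          exact h_int i
      _ = (d : ℝ≥0∞) ^ (1 / p.toReal) * E := by
          rw [Finset.sum_const, Finset.card_univ, Fintype.card_fin, nsmul_eq_mul,
            ENNReal.mul_rpow_of_nonneg _ _ (by positivity), ← ENNReal.rpow_mul,
            mul_one_div_cancel hp_pos.ne', ENNReal.rpow_one]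
      _ ≤ d * E := by
          gcongr
          obtain rfl | hd := d.eq_zero_or_pos
          · simp [hp_pos]
          · exact (ENNReal.rpow_le_rpow_of_exponent_le (mod_cast hd)
              ((div_le_one hp_pos).2 hp_one)).trans_eq (ENNReal.rpow_one _)

/-! ### Estimates for a single level -/

lemma sum_positions_mul (k : Fin d → ℕ) (i : Fin d) (w : ℕ → ℝ) (v : Fin d → ℕ → ℝ) :
    ∑ s ∈ positions k, w (s i) * ∏ j ∈ Finset.univ.erase i, v j (s j)
      = (∑ a ∈ Finset.range (2 ^ k i), w a)
        * ∏ j ∈ Finset.univ.erase i, ∑ a ∈ Finset.range (2 ^ k j), v j a := by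
  have h_split (z : Fin d → ℝ) : ∏ j, z j = z i * ∏ j ∈ Finset.univ.erase i, z j :=
    (Finset.mul_prod_erase _ _ (Finset.mem_univ i)).symm
  have h_erase (s : Fin d → ℕ) : ∏ j ∈ Finset.univ.erase i, v j (s j)
      = ∏ j ∈ Finset.univ.erase i, update v i w j (s j) :=
    Finset.prod_congr rfl fun j hj => by rw [update_of_ne (Finset.ne_of_mem_erase hj)]
  have h_erase_sum : ∏ j ∈ Finset.univ.erase i, ∑ a ∈ Finset.range (2 ^ k j), v j a
      = ∏ j ∈ Finset.univ.erase i, ∑ a ∈ Finset.range (2 ^ k j), update v i w j a :=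
    Finset.prod_congr rfl fun j hj => by rw [update_of_ne (Finset.ne_of_mem_erase hj)]
  have h := Finset.prod_univ_sum (fun j => Finset.range (2 ^ k j)) (update v i w)
  simp only [h_split, update_self] at h
  simp only [h_erase, h_erase_sum]
  exact h.symm

lemma hat_update (k s : Fin d → ℕ) (x : Fin d → ℝ) (i : Fin d) (t : ℝ) :
    (fun j => hat (k j) (s j) (update x i t j))
      = update (fun j => hat (k j) (s j) (x j)) i (hat (k i) (s i) t) :=
  funext fun j => apply_update (fun j => hat (k j) (s j)) x i t j

lemma abs_level_le {f : (Fin d → ℝ) → ℝ} {k : Fin d → ℕ} {c : ℝ} (hc₀ : 0 ≤ c)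
    (hc : ∀ s ∈ positions k, |coef f k s| ≤ c) (x : Fin d → ℝ) : |level f k x| ≤ c := by
  have h_nonneg (s : Fin d → ℕ) : 0 ≤ ∏ j, hat (k j) (s j) (x j) :=
    Finset.prod_nonneg fun j _ => (hat_mem _ _ _).1
  calc |level f k x| ≤ ∑ s ∈ positions k, c * ∏ j, hat (k j) (s j) (x j) := by
        refine (Finset.abs_sum_le_sum_abs _ _).trans (Finset.sum_le_sum fun s hs => ?_)
        rw [abs_mul, abs_of_nonneg (h_nonneg s)]
        exact mul_le_mul_of_nonneg_right (hc s hs) (h_nonneg s)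
    _ = c * ∏ j, sawtooth (k j) (x j) := by
        rw [← Finset.mul_sum, positions, ← Finset.prod_univ_sum (fun j => Finset.range (2 ^ k j))
          fun j a => hat (k j) a (x j)]
        rfl
    _ ≤ c := mul_le_of_le_one_right hc₀ (prod_sawtooth_mem k _ x).2

lemma abs_level_update_sub_le {f : (Fin d → ℝ) → ℝ} {k : Fin d → ℕ} {c : ℝ} (hc₀ : 0 ≤ c)
    (hc : ∀ s ∈ positions k, |coef f k s| ≤ c) (x : Fin d → ℝ) (i : Fin d) (t : ℝ) :
    |level f k (update x i t) - level f k x|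
      ≤ c * 2 ^ (k i + 1) * (∏ j ∈ Finset.univ.erase i, sawtooth (k j) (x j)) * |t - x i| := by
  have h_nonneg (s : Fin d → ℕ) : 0 ≤ ∏ j ∈ Finset.univ.erase i, hat (k j) (s j) (x j) :=
    Finset.prod_nonneg fun j _ => (hat_mem _ _ _).1
  have h_diff (s : Fin d → ℕ) : |∏ j, hat (k j) (s j) (update x i t j)
      - ∏ j, hat (k j) (s j) (x j)| = |hat (k i) (s i) t - hat (k i) (s i) (x i)|
        * ∏ j ∈ Finset.univ.erase i, hat (k j) (s j) (x j) := by
    rw [hat_update, Finset.prod_update_of_mem (Finset.mem_univ i), Finset.sdiff_singleton_eq_erase,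
      ← Finset.mul_prod_erase _ (fun j => hat (k j) (s j) (x j)) (Finset.mem_univ i), ← sub_mul,
      abs_mul, abs_of_nonneg (h_nonneg s)]
  calc |level f k (update x i t) - level f k x|
      ≤ ∑ s ∈ positions k, c * (|hat (k i) (s i) t - hat (k i) (s i) (x i)|
        * ∏ j ∈ Finset.univ.erase i, hat (k j) (s j) (x j)) := by
        rw [level, level, ← Finset.sum_sub_distrib]
        refine (Finset.abs_sum_le_sum_abs _ _).trans (Finset.sum_le_sum fun s hs => ?_)
        rw [← mul_sub, abs_mul, h_diff]
        exact mul_le_mul_of_nonneg_right (hc s hs) (mul_nonneg (abs_nonneg _) (h_nonneg s))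
    _ = c * ((∑ a ∈ Finset.range (2 ^ k i), |hat (k i) a t - hat (k i) a (x i)|)
        * ∏ j ∈ Finset.univ.erase i, sawtooth (k j) (x j)) := by
        rw [← Finset.mul_sum, sum_positions_mul k i (fun a => |hat (k i) a t - hat (k i) a (x i)|)
          fun j a => hat (k j) a (x j)]
        rfl
    _ ≤ c * (2 ^ (k i + 1) * |t - x i| * ∏ j ∈ Finset.univ.erase i, sawtooth (k j) (x j)) :=
        mul_le_mul_of_nonneg_left (mul_le_mul_of_nonneg_right (sum_abs_hat_sub_le _ _ _)
          (prod_sawtooth_mem k _ x).1) hc₀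
    _ = c * 2 ^ (k i + 1) * (∏ j ∈ Finset.univ.erase i, sawtooth (k j) (x j)) * |t - x i| := by ring

/-- The term of level `k` of the Faber series of `f`, with the products of hat functions replaced
by their approximations of accuracy `M`. -/
def levelApprox (M : ℕ) (f : (Fin d → ℝ) → ℝ) (k : Fin d → ℕ) (x : Fin d → ℝ) : ℝ :=
  ∑ s ∈ positions k, coef f k s * prodApprox M fun j => hat (k j) (s j) (x j)

lemma sum_indicator_hat_le (k : ℕ) (t : ℝ) :
    ∑ s ∈ Finset.range (2 ^ k), (if hat k s t = 0 then 0 else 1 : ℝ) ≤ 1 := by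
  by_cases h : ⌊2 ^ k * t⌋₊ ∈ Finset.range (2 ^ k)
  · rw [Finset.sum_eq_single_of_mem _ h fun s _ hs => if_pos (hat_eq_zero_of_ne_floor hs)]
    split_ifs <;> norm_num
  · rw [Finset.sum_eq_zero fun s hs => if_pos (hat_eq_zero_of_ne_floor fun e => h (e ▸ hs))]
    exact zero_le_one

lemma abs_prodApprox_hat_error_update_sub_le {M : ℕ} (hM : 2 * d * (1 / 2 : ℝ) ^ M ≤ 1)
    (k s : Fin d → ℕ) (x : Fin d → ℝ) (i : Fin d) (t : ℝ) :
    |(prodApprox M (fun j => hat (k j) (s j) (update x i t j))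
        - ∏ j, hat (k j) (s j) (update x i t j))
      - (prodApprox M (fun j => hat (k j) (s j) (x j)) - ∏ j, hat (k j) (s j) (x j))|
      ≤ 2 * d * (1 / 2) ^ M * (|hat (k i) (s i) t - hat (k i) (s i) (x i)|
        * ∏ j ∈ Finset.univ.erase i, (if hat (k j) (s j) (x j) = 0 then 0 else 1 : ℝ)) := by
  have h_mem (z : Fin d → ℝ) (j : Fin d) : hat (k j) (s j) (z j) ∈ I := hat_mem _ _ _
  by_cases h : ∃ j ∈ Finset.univ.erase i, hat (k j) (s j) (x j) = 0
  · obtain ⟨j, hj, h_zero⟩ := h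
    have h_zero' : hat (k j) (s j) (update x i t j) = 0 := by
      rwa [update_of_ne (Finset.ne_of_mem_erase hj)]
    have h_indicator : ∏ j ∈ Finset.univ.erase i, (if hat (k j) (s j) (x j) = 0 then 0 else 1 : ℝ)
        = 0 := Finset.prod_eq_zero hj (if_pos h_zero)
    rw [prodApprox_eq_zero M (h_mem x) h_zero, prodApprox_eq_zero M (h_mem _) h_zero',
      Finset.prod_eq_zero (Finset.mem_univ j) h_zero',
      Finset.prod_eq_zero (Finset.mem_univ j) h_zero, h_indicator]
    simp
  · push Not at h
    rw [Finset.prod_congr rfl fun j hj => if_neg (h j hj), Finset.prod_const_one, mul_one,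
      hat_update]
    exact abs_prodApprox_error_update_sub_le M hM (h_mem x) i (hat_mem _ _ _)

lemma abs_levelApprox_error_update_sub_le {f : (Fin d → ℝ) → ℝ} {k : Fin d → ℕ} {c : ℝ}
    (hc₀ : 0 ≤ c) (hc : ∀ s ∈ positions k, |coef f k s| ≤ c) {M : ℕ}
    (hM : 2 * d * (1 / 2 : ℝ) ^ M ≤ 1) (x : Fin d → ℝ) (i : Fin d) (t : ℝ) :
    |(levelApprox M f k (update x i t) - level f k (update x i t))
      - (levelApprox M f k x - level f k x)|
      ≤ c * 2 ^ (k i + 1) * (2 * d * (1 / 2) ^ M) * |t - x i| := by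
  set δ : ℝ := 2 * d * (1 / 2) ^ M
  calc |(levelApprox M f k (update x i t) - level f k (update x i t))
        - (levelApprox M f k x - level f k x)|
      ≤ ∑ s ∈ positions k, c * (δ * (|hat (k i) (s i) t - hat (k i) (s i) (x i)|
        * ∏ j ∈ Finset.univ.erase i, (if hat (k j) (s j) (x j) = 0 then 0 else 1 : ℝ))) := by
        rw [level, level, levelApprox, levelApprox, ← Finset.sum_sub_distrib,
          ← Finset.sum_sub_distrib, ← Finset.sum_sub_distrib]
        refine (Finset.abs_sum_le_sum_abs _ _).trans (Finset.sum_le_sum fun s hs => ?_)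
        rw [← mul_sub, ← mul_sub, ← mul_sub, abs_mul]
        exact mul_le_mul (hc s hs) (abs_prodApprox_hat_error_update_sub_le hM k s x i t)
          (abs_nonneg _) hc₀
    _ = c * (δ * ((∑ a ∈ Finset.range (2 ^ k i), |hat (k i) a t - hat (k i) a (x i)|)
        * ∏ j ∈ Finset.univ.erase i, ∑ a ∈ Finset.range (2 ^ k j),
          (if hat (k j) a (x j) = 0 then 0 else 1 : ℝ))) := by
        rw [← Finset.mul_sum, ← Finset.mul_sum,
          sum_positions_mul k i (fun a => |hat (k i) a t - hat (k i) a (x i)|)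
          fun j a => if hat (k j) a (x j) = 0 then 0 else 1]
    _ ≤ c * (δ * (2 ^ (k i + 1) * |t - x i| * 1)) := by
        gcongr
        · exact sum_abs_hat_sub_le _ _ _
        · exact Finset.prod_le_one
            (fun j _ => Finset.sum_nonneg fun a _ => by split_ifs <;> norm_num)
            fun j _ => sum_indicator_hat_le _ _
    _ = c * 2 ^ (k i + 1) * δ * |t - x i| := by ring

/-! ### The Faber coefficients of functions in the unit ball -/

/-- The projection onto the cube; composition with it extends a function in the unit ball by zero
to a continuous function on the whole space. -/
def clamp (x : Fin d → ℝ) : Fin d → ℝ := 0 ⊔ (1 ⊓ x)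

lemma clamp_mem (x : Fin d → ℝ) : clamp x ∈ cube d :=
  ⟨le_sup_left, sup_le zero_le_one inf_le_left⟩

lemma clamp_eq_self {x : Fin d → ℝ} (hx : x ∈ cube d) : clamp x = x := by
  rw [clamp, inf_eq_right.2 hx.2, sup_eq_right.2 hx.1]

lemma continuous_clamp : Continuous (clamp (d := d)) :=
  continuous_pi fun i => continuous_const.max (continuous_const.min (continuous_apply i))

lemma InUnitBall.continuous_comp_clamp {α : ℝ} {f : (Fin d → ℝ) → ℝ} (hf : InUnitBall α f) :
    Continuous (f ∘ clamp) :=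
  hf.continuousOn.comp_continuous continuous_clamp clamp_mem

lemma InUnitBall.comp_clamp_eq_zero {α : ℝ} {f : (Fin d → ℝ) → ℝ} (hf : InUnitBall α f)
    (x : Fin d → ℝ) (i : Fin d) (hi : x i ∉ Set.Ioo 0 1) : (f ∘ clamp) x = 0 := by
  refine hf.boundary _ (clamp_mem x) ⟨i, ?_⟩
  change max 0 (min 1 (x i)) = 0 ∨ max 0 (min 1 (x i)) = 1
  obtain h | h := le_or_gt (x i) 0
  · exact .inl (max_eq_left ((min_le_right _ _).trans h))
  · rw [min_eq_left (not_lt.1 fun h' => hi ⟨h, h'⟩), max_eq_right zero_le_one]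
    exact .inr rfl

lemma add_single_mem_diffDomain {u : Finset (Fin d)} {h x : Fin d → ℝ} {i : Fin d} (hi : i ∉ u)
    (hx : x ∈ diffDomain (insert i u) h) {t : ℝ} (ht : t ∈ Set.Icc 0 (2 * h i)) :
    x + Pi.single i t ∈ diffDomain u h := by
  have h_lower : 0 ≤ x i := hx.1.1 i
  have h_upper := (hx.2 i (Finset.mem_insert_self i u)).2
  refine ⟨⟨fun j => ?_, fun j => ?_⟩, fun j hj => ?_⟩
  · obtain rfl | hj := eq_or_ne j i
    · simpa using add_nonneg h_lower ht.1
    · simpa [hj] using hx.1.1 j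
  · obtain rfl | hj := eq_or_ne j i
    · simpa using (add_le_add_right ht.2 _).trans h_upper
    · simpa [hj] using hx.1.2 j
  · simpa [ne_of_mem_of_not_mem hj hi] using hx.2 j (Finset.mem_insert_of_mem hj)

lemma mixedDiff_congr {u : Finset (Fin d)} {h : Fin d → ℝ} {f g : (Fin d → ℝ) → ℝ}
    (hfg : ∀ x ∈ cube d, f x = g x) (hh : ∀ i ∈ u, 0 ≤ h i) {x : Fin d → ℝ}
    (hx : x ∈ diffDomain u h) : mixedDiff u h f x = mixedDiff u h g x := by
  induction u using Finset.induction_on generalizing x with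
  | empty => rw [mixedDiff_empty, mixedDiff_empty, hfg x hx.1]
  | insert i u hi ih =>
    have hhi := hh i (Finset.mem_insert_self i u)
    have h_congr {t : ℝ} (ht : t ∈ Set.Icc 0 (2 * h i)) :
        mixedDiff u h f (x + Pi.single i t) = mixedDiff u h g (x + Pi.single i t) :=
      ih (fun j hj => hh j (Finset.mem_insert_of_mem hj)) (add_single_mem_diffDomain hi hx ht)
    have h_zero := h_congr ⟨le_rfl, by linarith⟩
    rw [Pi.single_zero, add_zero] at h_zero
    simp only [mixedDiff_insert hi, secondDiff, LinearMap.coe_mk, AddHom.coe_mk]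
    rw [h_congr ⟨by linarith, le_rfl⟩, h_congr ⟨hhi, by linarith⟩, h_zero]

lemma InUnitBall.abs_mixedDiff_le {α : ℝ} {f : (Fin d → ℝ) → ℝ} (hf : InUnitBall α f)
    {u : Finset (Fin d)} {h : Fin d → ℝ} (hh : ∀ i ∈ u, 0 < h i) {x : Fin d → ℝ}
    (hx : x ∈ diffDomain u h) : |mixedDiff u h f x| ≤ ∏ i ∈ u, h i ^ α := by
  have h_le : ENNReal.ofReal ((∏ i ∈ u, h i ^ (-α)) * |mixedDiff u h f x|) ≤ 1 := by
    refine le_trans ?_ hf.norm_le_one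
    exact le_iSup_of_le u (le_iSup_of_le h (le_iSup_of_le hh
      (le_iSup_of_le x (le_iSup_of_le hx le_rfl))))
  have h_inv : ∏ i ∈ u, h i ^ (-α) = (∏ i ∈ u, h i ^ α)⁻¹ := by
    rw [← Finset.prod_inv_distrib]
    exact Finset.prod_congr rfl fun i hi => Real.rpow_neg (hh i hi).le α
  have h_pos : 0 < ∏ i ∈ u, h i ^ α := Finset.prod_pos fun i hi => Real.rpow_pos_of_pos (hh i hi) α
  rwa [ENNReal.ofReal_le_one, h_inv, inv_mul_le_iff₀ h_pos, mul_one] at h_le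

/-- The bound for the Faber coefficients of level `k` of a function in the unit ball of
smoothness `α`. -/
def coefBound (α : ℝ) (k : Fin d → ℕ) : ℝ :=
  (2 : ℝ) ^ (-((α + 1) * d)) * (2 : ℝ) ^ (-(α * ∑ j, (k j : ℝ)))

lemma coefBound_nonneg (α : ℝ) (k : Fin d → ℕ) : 0 ≤ coefBound α k := by
  unfold coefBound; positivity

lemma half_pow_mul_prod_step_rpow (α : ℝ) (k : Fin d → ℕ) :
    (1 / 2) ^ d * ∏ j, ((1 : ℝ) / 2 ^ (k j + 1)) ^ α = coefBound α k := by
  have h_step (j : Fin d) : ((1 : ℝ) / 2 ^ (k j + 1)) ^ α = 2 ^ (-(α * k j) - α) := by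
    rw [one_div, ← Real.rpow_natCast, ← Real.rpow_neg zero_le_two, ← Real.rpow_mul zero_le_two]
    congr 1
    push_cast
    ring
  have h_half : ((1 : ℝ) / 2) ^ d = 2 ^ (-(d : ℝ)) := by
    rw [one_div, inv_pow, Real.rpow_neg zero_le_two, Real.rpow_natCast]
  simp only [h_step]
  rw [← Real.rpow_sum_of_pos two_pos, h_half, coefBound, ← Real.rpow_add two_pos,
    ← Real.rpow_add two_pos, Finset.sum_sub_distrib, Finset.sum_neg_distrib, ← Finset.mul_sum,
    Finset.sum_const, Finset.card_univ, Fintype.card_fin, nsmul_eq_mul]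
  congr 1
  ring

lemma gridPoint_mem_diffDomain {k s : Fin d → ℕ} (hs : s ∈ positions k) :
    (fun j => (s j : ℝ) / 2 ^ k j) ∈ diffDomain Finset.univ fun j => (1 : ℝ) / 2 ^ (k j + 1) := by
  have h_succ (j : Fin d) : (s j : ℝ) + 1 ≤ 2 ^ k j :=
    mod_cast Finset.mem_range.1 (Fintype.mem_piFinset.1 hs j)
  have h_pow (j : Fin d) : (0 : ℝ) < 2 ^ k j := by positivity
  have h_end (j : Fin d) : (s j : ℝ) / 2 ^ k j + 2 * (1 / 2 ^ (k j + 1)) = (s j + 1) / 2 ^ k j := by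
    rw [pow_succ]
    field_simp
  refine ⟨⟨fun j => ?_, fun j => ?_⟩, fun j _ => ⟨by positivity, ?_⟩⟩
  · exact div_nonneg (s j).cast_nonneg (h_pow j).le
  · exact (div_le_one (h_pow j)).2 ((le_add_of_nonneg_right zero_le_one).trans (h_succ j))
  · rw [h_end]
    exact (div_le_one (h_pow j)).2 (h_succ j)

lemma InUnitBall.abs_coef_le {α : ℝ} {f : (Fin d → ℝ) → ℝ} (hf : InUnitBall α f)
    {k s : Fin d → ℕ} (hs : s ∈ positions k) : |coef (f ∘ clamp) k s| ≤ coefBound α k := by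
  have h_mem := gridPoint_mem_diffDomain hs
  have h_congr := mixedDiff_congr (f := f ∘ clamp) (g := f)
    (fun x hx => congrArg f (clamp_eq_self hx)) (fun j _ => by positivity) h_mem
  rw [coef, h_congr, abs_mul, abs_pow, abs_neg, abs_of_pos one_half_pos,
    ← half_pow_mul_prod_step_rpow]
  exact mul_le_mul_of_nonneg_left (hf.abs_mixedDiff_le (fun j _ => by positivity) h_mem)
    (by positivity)

lemma coefBound_mul_two_pow (α : ℝ) (k : Fin d → ℕ) (i : Fin d) :
    coefBound α k * 2 ^ (k i + 1) = 2 * (2 : ℝ) ^ (-((α + 1) * d)) * weight α i k := by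
  rw [coefBound, weight, sub_eq_add_neg, Real.rpow_add two_pos, Real.rpow_natCast, pow_succ]
  ring

lemma coefBound_le_weight (α : ℝ) (k : Fin d → ℕ) (i : Fin d) :
    coefBound α k ≤ 2 * (2 : ℝ) ^ (-((α + 1) * d)) * weight α i k := by
  rw [← coefBound_mul_two_pow]
  exact le_mul_of_one_le_right (coefBound_nonneg α k) (one_le_pow₀ one_le_two)

/-! ### The error of the sparse grid network -/

/-- The function computed by the network: the approximate Faber series of `f` over the finite set
`L` of levels, where `M` is the accuracy of the multiplications. -/
def gridApprox (M : ℕ) (L : Finset (Fin d → ℕ)) (f : (Fin d → ℝ) → ℝ) (x : Fin d → ℝ) : ℝ :=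
  ∑ k ∈ L, levelApprox M f k x

/-- The bound for the `i`-th derivative of the error at level `k`, up to the factor in
`coefBound_mul_two_pow`: the multiplications have error `δ` at the levels in `L`, and the other
levels are missing. -/
def errorBound (α δ : ℝ) (L : Finset (Fin d → ℕ)) (i : Fin d) (k : Fin d → ℕ) (x : Fin d → ℝ) : ℝ :=
  weight α i k * if k ∈ L then δ else ∏ j ∈ Finset.univ.erase i, sawtooth (k j) (x j)

lemma errorBound_nonneg {δ : ℝ} (hδ : 0 ≤ δ) (α : ℝ) (L : Finset (Fin d → ℕ)) (i : Fin d)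
    (k : Fin d → ℕ) (x : Fin d → ℝ) : 0 ≤ errorBound α δ L i k x := by
  refine mul_nonneg (weight_nonneg α i k) ?_
  split_ifs
  exacts [hδ, (prod_sawtooth_mem k _ x).1]

lemma errorBound_le_weight {δ : ℝ} (hδ : δ ≤ 1) (α : ℝ) (L : Finset (Fin d → ℕ)) (i : Fin d)
    (k : Fin d → ℕ) (x : Fin d → ℝ) : errorBound α δ L i k x ≤ weight α i k := by
  refine mul_le_of_le_one_right (weight_nonneg α i k) ?_
  split_ifs
  exacts [hδ, (prod_sawtooth_mem k _ x).2]

lemma summable_errorBound {α δ : ℝ} (hα : 1 < α) (hδ : δ ∈ I) (L : Finset (Fin d → ℕ)) (i : Fin d)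
    (x : Fin d → ℝ) : Summable fun k => errorBound α δ L i k x :=
  .of_nonneg_of_le (fun k => errorBound_nonneg hδ.1 α L i k x)
    (fun k => errorBound_le_weight hδ.2 α L i k x) (summable_weight hα i)

lemma tsum_errorBound_le {α δ : ℝ} (hα : 1 < α) (hδ : δ ∈ I) (L : Finset (Fin d → ℕ)) (i : Fin d)
    (x : Fin d → ℝ) : ∑' k, errorBound α δ L i k x
      ≤ (1 - (2 : ℝ) ^ (1 - α))⁻¹ * ((1 - (2 : ℝ) ^ (-α))⁻¹) ^ (d - 1) :=
  ((summable_errorBound hα hδ L i x).tsum_le_tsum (fun k => errorBound_le_weight hδ.2 α L i k x)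
    (summable_weight hα i)).trans (tsum_weight_le hα i)

lemma continuous_errorBound (α δ : ℝ) (L : Finset (Fin d → ℕ)) (i : Fin d) (k : Fin d → ℕ) :
    Continuous (errorBound α δ L i k) := by
  unfold errorBound
  split_ifs
  · exact continuous_const
  · exact continuous_const.mul (continuous_prod_sawtooth k _)

lemma eLpNorm_errorBound_le {δ : ℝ} (hδ : 0 ≤ δ) {p : ℝ≥0∞} (hp : 1 ≤ p) (α : ℝ)
    (L : Finset (Fin d → ℕ)) (i : Fin d) (k : Fin d → ℕ) :
    eLpNorm (errorBound α δ L i k) p (volume.restrict (cube d))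
      ≤ ENNReal.ofReal (weight α i k) * ENNReal.ofReal δ
        + (if k ∈ L then 0 else ENNReal.ofReal (weight α i k))
          * ENNReal.ofReal (((pPow p 1)⁻¹) ^ (d - 1)) := by
  have hw := weight_nonneg α i k
  by_cases hk : k ∈ L
  · have h_eq : errorBound α δ L i k = fun _ => weight α i k * δ :=
      funext fun x => by rw [errorBound, if_pos hk]
    rw [h_eq, if_pos hk, zero_mul, add_zero, ← ENNReal.ofReal_mul hw]
    refine (eLpNorm_le_of_ae_bound
      (.of_forall fun _ => (Real.norm_of_nonneg (mul_nonneg hw hδ)).le)).trans_eq ?_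
    rw [measure_univ, ENNReal.one_rpow, one_mul]
  · have h_eq : errorBound α δ L i k
        = weight α i k • fun x => ∏ j ∈ Finset.univ.erase i, sawtooth (k j) (x j) :=
      funext fun x => by rw [errorBound, if_neg hk]; rfl
    have h_card : (Finset.univ.erase i).card = d - 1 := by
      rw [Finset.card_erase_of_mem (Finset.mem_univ i), Finset.card_univ, Fintype.card_fin]
    rw [h_eq, if_neg hk, eLpNorm_const_smul, Real.enorm_of_nonneg hw, ← h_card]
    refine le_add_left ?_
    gcongr
    exact eLpNorm_prod_sawtooth_le hp k _

lemma hasSum_error {α : ℝ} (hα : 1 < α) {f : (Fin d → ℝ) → ℝ} (hf : Continuous f)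
    (hf₀ : ∀ x i, x i ∉ Set.Ioo 0 1 → f x = 0)
    (hc : ∀ k, ∀ s ∈ positions k, |coef f k s| ≤ coefBound α k) (i : Fin d) (M : ℕ)
    (L : Finset (Fin d → ℕ)) (x : Fin d → ℝ) :
    HasSum (fun k => level f k x - if k ∈ L then levelApprox M f k x else 0)
      (f x - gridApprox M L f x) := by
  refine HasSum.sub (hasSum_level hf hf₀ ?_) ?_
  · refine ((summable_weight hα i).mul_left (2 * (2 : ℝ) ^ (-((α + 1) * d)))).of_norm_bounded
      fun k => ?_
    exact (abs_level_le (coefBound_nonneg α k) (hc k) x).trans (coefBound_le_weight α k i)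
  · rw [gridApprox, ← Finset.sum_congr rfl fun k hk => if_pos hk]
    exact hasSum_sum_of_ne_finset_zero fun k hk => if_neg hk

lemma abs_error_update_sub_le {α : ℝ} (hα : 1 < α) {f : (Fin d → ℝ) → ℝ} (hf : Continuous f)
    (hf₀ : ∀ x i, x i ∉ Set.Ioo 0 1 → f x = 0)
    (hc : ∀ k, ∀ s ∈ positions k, |coef f k s| ≤ coefBound α k) {M : ℕ}
    (hM : 2 * d * (1 / 2 : ℝ) ^ M ≤ 1) (L : Finset (Fin d → ℕ)) (x : Fin d → ℝ) (i : Fin d)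
    (t : ℝ) :
    |(f (update x i t) - gridApprox M L f (update x i t)) - (f x - gridApprox M L f x)|
      ≤ 2 * (2 : ℝ) ^ (-((α + 1) * d))
        * (∑' k, errorBound α (2 * d * (1 / 2) ^ M) L i k x) * |t - x i| := by
  have h_error := (hasSum_error hα hf hf₀ hc i M L (update x i t)).sub
    (hasSum_error hα hf hf₀ hc i M L x)
  have h_bound := ((summable_errorBound hα ⟨by positivity, hM⟩ L i x).hasSum.mul_left
    (2 * (2 : ℝ) ^ (-((α + 1) * d)))).mul_right |t - x i|
  refine h_error.norm_le_of_bounded h_bound fun k => ?_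
  rw [Real.norm_eq_abs, errorBound, ← mul_assoc, ← coefBound_mul_two_pow]
  by_cases hk : k ∈ L
  · simp only [if_pos hk]
    exact (abs_eq_abs.2 (.inr (by ring))).trans_le
      (abs_levelApprox_error_update_sub_le (coefBound_nonneg α k) (hc k) hM x i t)
  · simp only [if_neg hk, sub_zero]
    exact abs_level_update_sub_le (coefBound_nonneg α k) (hc k) x i t

lemma gridApprox_eq_zero (M : ℕ) (L : Finset (Fin d → ℕ)) (f : (Fin d → ℝ) → ℝ) {x : Fin d → ℝ}
    {i : Fin d} (hi : x i ∉ Set.Ioo 0 1) : gridApprox M L f x = 0 := by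
  refine Finset.sum_eq_zero fun k _ => Finset.sum_eq_zero fun s hs => ?_
  have h_zero : hat (k i) (s i) (x i) = 0 :=
    hat_eq_zero (Finset.mem_range.1 (Fintype.mem_piFinset.1 hs i)) hi
  rw [prodApprox_eq_zero M (fun _ => hat_mem _ _ _) h_zero, mul_zero]

lemma exists_notMem_Ioo_of_notMem_cube {x : Fin d → ℝ} (hx : x ∉ cube d) :
    ∃ i, x i ∉ Set.Ioo 0 1 := by
  by_contra! h
  exact hx ⟨fun i => (h i).1.le, fun i => (h i).2.le⟩

/-- The bound for the Sobolev norm of the error of the network for the sparse grid of size `m` with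
multiplications of accuracy `M`; the first summand comes from the multiplications, the second one
from the truncation of the Faber series. -/
def totalError (d : ℕ) (α β : ℝ) (p : ℝ≥0∞) (m : ℝ) (M : ℕ) : ℝ :=
  d * (2 * (2 : ℝ) ^ (-((α + 1) * d))
    * ((1 - (2 : ℝ) ^ (1 - α))⁻¹ * ((1 - (2 : ℝ) ^ (-α))⁻¹) ^ (d - 1) * (2 * d * (1 / 2) ^ M)
      + (2 : ℝ) ^ ((1 - α) * m) * (1 - (2 : ℝ) ^ (1 - α))⁻¹ * ((gap α β)⁻¹) ^ (d - 1)
        * ((pPow p 1)⁻¹) ^ (d - 1)))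

lemma gap_mem_Ioo {α β : ℝ} (hα : 1 < α) (hβ : α < β) : gap α β ∈ Set.Ioo 0 1 :=
  ⟨sub_pos.2 (two_rpow_lt_one (neg_neg_of_pos (div_pos (sub_pos.2 hβ) (sub_pos.2 (hα.trans hβ))))),
    sub_lt_self _ (Real.rpow_pos_of_pos two_pos _)⟩

lemma pPow_pos (p : ℝ≥0∞) (t : ℝ) : 0 < pPow p t := by
  rw [pPow]
  split_ifs <;> positivity

lemma eLpNorm_tsum_errorBound_le {α β : ℝ} (hα : 1 < α) (hβ : α < β) {p : ℝ≥0∞} (hp : 1 ≤ p)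
    {δ : ℝ} (hδ : δ ∈ I) (m : ℝ) (i : Fin d) :
    eLpNorm (fun x => ∑' k, errorBound α δ (finite_sparse d (hα.trans hβ) m).toFinset i k x) p
        (volume.restrict (cube d))
      ≤ ENNReal.ofReal ((1 - (2 : ℝ) ^ (1 - α))⁻¹ * ((1 - (2 : ℝ) ^ (-α))⁻¹) ^ (d - 1) * δ
        + (2 : ℝ) ^ ((1 - α) * m) * (1 - (2 : ℝ) ^ (1 - α))⁻¹ * ((gap α β)⁻¹) ^ (d - 1)
          * ((pPow p 1)⁻¹) ^ (d - 1)) := by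
  have h₁ : 0 < 1 - (2 : ℝ) ^ (1 - α) := sub_pos.2 (two_rpow_lt_one (by linarith))
  have h₂ : 0 < 1 - (2 : ℝ) ^ (-α) := sub_pos.2 (two_rpow_lt_one (by linarith))
  have h_gap := (gap_mem_Ioo hα hβ).1
  have h_pPow := pPow_pos p 1
  have hδ₀ : 0 ≤ δ := hδ.1
  set L := (finite_sparse d (hα.trans hβ) m).toFinset
  have h_tail : ∑' k, (if k ∈ L then 0 else ENNReal.ofReal (weight α i k))
      ≤ ENNReal.ofReal ((2 : ℝ) ^ ((1 - α) * m) * (1 - (2 : ℝ) ^ (1 - α))⁻¹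
        * ((gap α β)⁻¹) ^ (d - 1)) := by
    convert tsum_weight_compl_sparse_le hα hβ m i
    exact Set.Finite.mem_toFinset _
  calc eLpNorm (fun x => ∑' k, errorBound α δ L i k x) p (volume.restrict (cube d))
      ≤ ∑' k, eLpNorm (errorBound α δ L i k) p (volume.restrict (cube d)) :=
        eLpNorm_tsum_le hp (fun k => (continuous_errorBound α δ L i k).aestronglyMeasurable)
          (summable_errorBound hα hδ L i)
    _ ≤ ∑' k, (ENNReal.ofReal (weight α i k) * ENNReal.ofReal δ
        + (if k ∈ L then 0 else ENNReal.ofReal (weight α i k))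
          * ENNReal.ofReal (((pPow p 1)⁻¹) ^ (d - 1))) :=
        ENNReal.tsum_le_tsum fun k => eLpNorm_errorBound_le hδ₀ hp α L i k
    _ ≤ ENNReal.ofReal ((1 - (2 : ℝ) ^ (1 - α))⁻¹ * ((1 - (2 : ℝ) ^ (-α))⁻¹) ^ (d - 1))
          * ENNReal.ofReal δ
        + ENNReal.ofReal ((2 : ℝ) ^ ((1 - α) * m) * (1 - (2 : ℝ) ^ (1 - α))⁻¹
          * ((gap α β)⁻¹) ^ (d - 1)) * ENNReal.ofReal (((pPow p 1)⁻¹) ^ (d - 1)) := by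
        rw [ENNReal.tsum_add, ENNReal.tsum_mul_right, ENNReal.tsum_mul_right]
        gcongr
        exact tsum_ofReal_weight_le hα i
    _ = ENNReal.ofReal ((1 - (2 : ℝ) ^ (1 - α))⁻¹ * ((1 - (2 : ℝ) ^ (-α))⁻¹) ^ (d - 1) * δ
        + (2 : ℝ) ^ ((1 - α) * m) * (1 - (2 : ℝ) ^ (1 - α))⁻¹ * ((gap α β)⁻¹) ^ (d - 1)
          * ((pPow p 1)⁻¹) ^ (d - 1)) := by
        rw [← ENNReal.ofReal_mul (by positivity), ← ENNReal.ofReal_mul (by positivity),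
          ← ENNReal.ofReal_add (by positivity) (by positivity)]

lemma lipschitzWith_error {α : ℝ} (hα : 1 < α) {f : (Fin d → ℝ) → ℝ} (hf : Continuous f)
    (hf₀ : ∀ x i, x i ∉ Set.Ioo 0 1 → f x = 0)
    (hc : ∀ k, ∀ s ∈ positions k, |coef f k s| ≤ coefBound α k) {M : ℕ}
    (hM : 2 * d * (1 / 2 : ℝ) ^ M ≤ 1) (L : Finset (Fin d → ℕ)) :
    ∃ C, LipschitzWith C fun x => f x - gridApprox M L f x := by
  refine ⟨_, lipschitzWith_of_update (C := Real.toNNReal (2 * (2 : ℝ) ^ (-((α + 1) * d))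
    * ((1 - (2 : ℝ) ^ (1 - α))⁻¹ * ((1 - (2 : ℝ) ^ (-α))⁻¹) ^ (d - 1)))) fun x i t => ?_⟩
  refine (abs_error_update_sub_le hα hf hf₀ hc hM L x i t).trans ?_
  gcongr
  refine le_trans ?_ (Real.le_coe_toNNReal _)
  gcongr
  exact tsum_errorBound_le hα ⟨by positivity, hM⟩ L i x

lemma isW10Gradient_and_gradNorm_le {α β : ℝ} (hα : 1 < α) (hβ : α < β) {p : ℝ≥0∞} (hp : 1 ≤ p)
    (m : ℝ) {M : ℕ} (hM : 2 * d * (1 / 2 : ℝ) ^ M ≤ 1) {f u : (Fin d → ℝ) → ℝ} (hf : Continuous f)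
    (hf₀ : ∀ x i, x i ∉ Set.Ioo 0 1 → f x = 0)
    (hc : ∀ k, ∀ s ∈ positions k, |coef f k s| ≤ coefBound α k)
    (hu : ∀ x ∈ cube d, u x = f x - gridApprox M (finite_sparse d (hα.trans hβ) m).toFinset f x) :
    ∃ g, IsW10Gradient p u g ∧ gradNorm p g ≤ ENNReal.ofReal (totalError d α β p m M) := by
  set L := (finite_sparse d (hα.trans hβ) m).toFinset
  have hδ : 2 * d * (1 / 2 : ℝ) ^ M ∈ I := ⟨by positivity, hM⟩
  obtain ⟨C, hC⟩ := lipschitzWith_error hα hf hf₀ hc hM L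
  have h_outside (x : Fin d → ℝ) (hx : x ∉ cube d) : f x - gridApprox M L f x = 0 := by
    obtain ⟨i, hi⟩ := exists_notMem_Ioo_of_notMem_cube hx
    rw [hf₀ x i hi, gridApprox_eq_zero M L f hi, sub_zero]
  refine ⟨_, isW10Gradient_lineDeriv hC h_outside hu, ?_⟩
  rw [totalError, ENNReal.ofReal_mul d.cast_nonneg, ENNReal.ofReal_natCast]
  refine gradNorm_le hp fun i => ?_
  set c : ℝ := 2 * (2 : ℝ) ^ (-((α + 1) * d))
  have hc₀ : 0 ≤ c := by positivity
  have h_deriv (x : Fin d → ℝ) :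
      |lineDeriv ℝ (fun x => f x - gridApprox M L f x) x (Pi.single i 1)|
        ≤ c * ∑' k, errorBound α (2 * d * (1 / 2) ^ M) L i k x :=
    abs_lineDeriv_single_le
      (mul_nonneg hc₀ (tsum_nonneg fun k => errorBound_nonneg hδ.1 α L i k x))
      (abs_error_update_sub_le hα hf hf₀ hc hM L x i)
  refine (eLpNorm_mono_real
    (g := c • fun x => ∑' k, errorBound α (2 * d * (1 / 2) ^ M) L i k x) h_deriv).trans ?_
  rw [eLpNorm_const_smul, Real.enorm_of_nonneg hc₀, ENNReal.ofReal_mul hc₀]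
  gcongr
  exact eLpNorm_tsum_errorBound_le hα hβ hp hδ m i

lemma InUnitBall.memW10_and_w10Norm_le {α β : ℝ} (hα : 1 < α) (hβ : α < β) {p : ℝ≥0∞} (hp : 1 ≤ p)
    (m : ℝ) {M : ℕ} (hM : 2 * d * (1 / 2 : ℝ) ^ M ≤ 1) {f u : (Fin d → ℝ) → ℝ}
    (hf : InUnitBall α f) (hu : ∀ x ∈ cube d, u x = f x - gridApprox M
      (finite_sparse d (hα.trans hβ) m).toFinset (f ∘ clamp) x) :
    MemW10 p u ∧ w10Norm p u ≤ ENNReal.ofReal (totalError d α β p m M) := by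
  obtain ⟨g, hg, hg_norm⟩ := isW10Gradient_and_gradNorm_le (u := u) hα hβ hp m hM
    hf.continuous_comp_clamp
    hf.comp_clamp_eq_zero (fun _ _ hs => hf.abs_coef_le hs)
    fun x hx => by rw [comp_apply, clamp_eq_self hx, hu x hx]
  exact ⟨⟨g, hg⟩, (iInf₂_le g hg).trans hg_norm⟩

lemma pPow_natCast (p : ℝ≥0∞) (d : ℕ) : pPow p d = pPow p 1 ^ d := by
  rw [pPow, pPow]
  split_ifs
  · rw [one_pow]
  · rw [← Real.rpow_mul_natCast (by positivity), div_mul_eq_mul_div, one_mul]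

/-- The base of the exponential decay in `d` of the truncation error, in the normalization that
occurs in `B`. -/
def base (α β : ℝ) (p : ℝ≥0∞) : ℝ := pPow p 1 * (2 : ℝ) ^ (α + 1) * gap α β

lemma base_pos {α β : ℝ} (hα : 1 < α) (hβ : α < β) (p : ℝ≥0∞) : 0 < base α β p :=
  mul_pos (mul_pos (pPow_pos p 1) (Real.rpow_pos_of_pos two_pos _)) (gap_mem_Ioo hα hβ).1

lemma base_pow (α β : ℝ) (p : ℝ≥0∞) (d : ℕ) :
    base α β p ^ d = pPow p d * (2 : ℝ) ^ ((α + 1) * d) * gap α β ^ d := by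
  rw [base, mul_pow, mul_pow, pPow_natCast, Real.rpow_mul_natCast zero_le_two]

lemma truncation_factor_le {α β : ℝ} (hα : 1 < α) (hβ : α < β) (p : ℝ≥0∞) (hd : 1 ≤ d) :
    (2 : ℝ) ^ (-((α + 1) * d)) * ((gap α β)⁻¹) ^ (d - 1) * ((pPow p 1)⁻¹) ^ (d - 1)
      ≤ pPow p 1 / base α β p ^ d := by
  obtain ⟨h_gap, h_gap_lt⟩ := gap_mem_Ioo hα hβ
  have h_pPow := pPow_pos p 1
  obtain ⟨n, rfl⟩ := Nat.exists_eq_add_of_le' hd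
  calc (2 : ℝ) ^ (-((α + 1) * (n + 1 : ℕ))) * ((gap α β)⁻¹) ^ n * ((pPow p 1)⁻¹) ^ n
      = gap α β * (pPow p 1 / base α β p ^ (n + 1)) := by
        rw [base_pow, pPow_natCast, Real.rpow_neg zero_le_two, pow_succ, pow_succ, inv_pow, inv_pow]
        field_simp
    _ ≤ pPow p 1 / base α β p ^ (n + 1) :=
        mul_le_of_le_one_left (div_pos h_pPow (pow_pos (base_pos hα hβ p) _)).le h_gap_lt.le

lemma multiplication_factor_le {α : ℝ} (hα : 1 ≤ α) (d : ℕ) :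
    (2 : ℝ) ^ (-((α + 1) * d)) * ((1 - (2 : ℝ) ^ (-α))⁻¹) ^ (d - 1) ≤ 1 := by
  have h_half : (2 : ℝ) ^ (-α) ≤ 1 / 2 :=
    calc (2 : ℝ) ^ (-α) ≤ (2 : ℝ) ^ (-1 : ℝ) :=
          Real.rpow_le_rpow_of_exponent_le one_le_two (neg_le_neg hα)
      _ = 1 / 2 := by rw [Real.rpow_neg_one, one_div]
  have h_inv : (1 - (2 : ℝ) ^ (-α))⁻¹ ≤ 2 := by
    rw [inv_le_comm₀ (by linarith) two_pos]
    linarith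
  have h_nonneg : 0 ≤ (1 - (2 : ℝ) ^ (-α))⁻¹ := inv_nonneg.2 (by linarith)
  calc (2 : ℝ) ^ (-((α + 1) * d)) * ((1 - (2 : ℝ) ^ (-α))⁻¹) ^ (d - 1)
      ≤ (2 : ℝ) ^ (-(d : ℝ)) * 2 ^ d := by
        gcongr ?_ * ?_
        · refine Real.rpow_le_rpow_of_exponent_le one_le_two (neg_le_neg ?_)
          exact le_mul_of_one_le_left d.cast_nonneg (by linarith)
        · exact (pow_le_pow_left₀ h_nonneg h_inv _).trans
            (pow_le_pow_right₀ one_le_two (Nat.sub_le d 1))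
    _ = 1 := by
        rw [Real.rpow_neg zero_le_two, Real.rpow_natCast, inv_mul_cancel₀ (by positivity)]

lemma multiplication_error_le {α ε : ℝ} (hα : 1 < α) (hε : 0 < ε) {M : ℕ}
    (hM : 8 * d ^ 2 / ((1 - (2 : ℝ) ^ (1 - α)) * ε) ≤ 2 ^ M) :
    d * (2 * (2 : ℝ) ^ (-((α + 1) * d)) * ((1 - (2 : ℝ) ^ (1 - α))⁻¹
      * ((1 - (2 : ℝ) ^ (-α))⁻¹) ^ (d - 1) * (2 * d * (1 / 2) ^ M))) ≤ ε / 2 := by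
  have hr : 0 < 1 - (2 : ℝ) ^ (1 - α) := sub_pos.2 (two_rpow_lt_one (by linarith))
  calc d * (2 * (2 : ℝ) ^ (-((α + 1) * d)) * ((1 - (2 : ℝ) ^ (1 - α))⁻¹
        * ((1 - (2 : ℝ) ^ (-α))⁻¹) ^ (d - 1) * (2 * d * (1 / 2) ^ M)))
      = ((2 : ℝ) ^ (-((α + 1) * d)) * ((1 - (2 : ℝ) ^ (-α))⁻¹) ^ (d - 1))
        * (4 * d ^ 2 * (1 - (2 : ℝ) ^ (1 - α))⁻¹ * (1 / 2) ^ M) := by ring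
    _ ≤ 4 * d ^ 2 * (1 - (2 : ℝ) ^ (1 - α))⁻¹ * (1 / 2) ^ M :=
        mul_le_of_le_one_left (by positivity) (multiplication_factor_le hα.le d)
    _ ≤ ε / 2 := by
        rw [div_le_iff₀ (by positivity)] at hM
        rw [one_div, inv_pow, ← div_eq_mul_inv, ← div_eq_mul_inv, div_div,
          div_le_iff₀ (by positivity)]
        linarith

/-- The constant `K` in the choice of the size `m` of the sparse grid by
`2 ^ ((α - 1) * m) = K * d ^ 2 / (base ^ d * ε)`: the truncation error is at most `ε / 2`, and
`0 ≤ m` for `ε < ε₀`. -/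
def sizeConst (α β : ℝ) (p : ℝ≥0∞) : ℝ :=
  max (K₁ α β p) (4 * (1 - (2 : ℝ) ^ (1 - α))⁻¹ * pPow p 1)

lemma sizeConst_pos {α : ℝ} (hα : 1 < α) (β : ℝ) (p : ℝ≥0∞) : 0 < sizeConst α β p := by
  have hr : 0 < 1 - (2 : ℝ) ^ (1 - α) := sub_pos.2 (two_rpow_lt_one (by linarith))
  have h_pPow := pPow_pos p 1
  exact lt_max_of_lt_right (by positivity)

/-- The value of `2 ^ ((α - 1) * m)` for the size `m` of the sparse grid used for accuracy `ε`. -/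
def sizeParam (d : ℕ) (α β : ℝ) (p : ℝ≥0∞) (ε : ℝ) : ℝ :=
  sizeConst α β p * d ^ 2 / base α β p ^ d / ε

lemma truncation_error_le {α β : ℝ} (hα : 1 < α) (hβ : α < β) {p : ℝ≥0∞} (hd : 1 ≤ d) {ε m : ℝ}
    (hε : 0 < ε) (hm : (2 : ℝ) ^ ((α - 1) * m) = sizeParam d α β p ε) :
    d * (2 * (2 : ℝ) ^ (-((α + 1) * d)) * ((2 : ℝ) ^ ((1 - α) * m) * (1 - (2 : ℝ) ^ (1 - α))⁻¹
      * ((gap α β)⁻¹) ^ (d - 1) * ((pPow p 1)⁻¹) ^ (d - 1))) ≤ ε / 2 := by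
  have hr : 0 < 1 - (2 : ℝ) ^ (1 - α) := sub_pos.2 (two_rpow_lt_one (by linarith))
  have h_one_le : (1 : ℝ) ≤ d := by exact_mod_cast hd
  have h_base := base_pos hα hβ p
  have h_const := sizeConst_pos hα β p
  have hm' : (2 : ℝ) ^ ((1 - α) * m) = ε * base α β p ^ d / (sizeConst α β p * d ^ 2) := by
    rw [← neg_sub α 1, neg_mul, Real.rpow_neg zero_le_two, hm, sizeParam]
    field_simp
  calc d * (2 * (2 : ℝ) ^ (-((α + 1) * d)) * ((2 : ℝ) ^ ((1 - α) * m) * (1 - (2 : ℝ) ^ (1 - α))⁻¹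
        * ((gap α β)⁻¹) ^ (d - 1) * ((pPow p 1)⁻¹) ^ (d - 1)))
      = 2 * d * ((2 : ℝ) ^ ((1 - α) * m) * (1 - (2 : ℝ) ^ (1 - α))⁻¹
        * ((2 : ℝ) ^ (-((α + 1) * d)) * ((gap α β)⁻¹) ^ (d - 1) * ((pPow p 1)⁻¹) ^ (d - 1))) := by
        ring
    _ ≤ 2 * d * ((2 : ℝ) ^ ((1 - α) * m) * (1 - (2 : ℝ) ^ (1 - α))⁻¹
        * (pPow p 1 / base α β p ^ d)) := by
        gcongr
        exact truncation_factor_le hα hβ p hd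
    _ = (4 * (1 - (2 : ℝ) ^ (1 - α))⁻¹ * pPow p 1) * (ε / 2) / (sizeConst α β p * d) := by
        rw [hm']
        field_simp
        ring
    _ ≤ sizeConst α β p * (ε / 2) / (sizeConst α β p * d) := by
        gcongr
        exact le_max_right _ _
    _ = ε / 2 / d := mul_div_mul_left _ _ h_const.ne'
    _ ≤ ε / 2 := div_le_self (by positivity) h_one_le

lemma totalError_le {α β : ℝ} (hα : 1 < α) (hβ : α < β) {p : ℝ≥0∞} (hd : 1 ≤ d) {ε m : ℝ}
    (hε : 0 < ε) (hm : (2 : ℝ) ^ ((α - 1) * m) = sizeParam d α β p ε) {M : ℕ}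
    (hM : 8 * d ^ 2 / ((1 - (2 : ℝ) ^ (1 - α)) * ε) ≤ 2 ^ M) : totalError d α β p m M ≤ ε := by
  rw [totalError, mul_add, mul_add]
  linarith [multiplication_error_le hα hε hM, truncation_error_le hα hβ hd hε hm]

lemma B_rpow_neg {α β : ℝ} (hα : 1 < α) (hβ : α < β) (p : ℝ≥0∞) (hd : d ≠ 0) :
    B d α β p ^ (-(d : ℝ)) = ((1 - (2 : ℝ) ^ (-(1 / (β - 1))))⁻¹) ^ d
      * (d ^ 2 * (d ^ 2 / base α β p ^ d) ^ (1 / (α - 1))) := by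
  have h_sub : 0 < 1 - (2 : ℝ) ^ (-(1 / (β - 1))) :=
    sub_pos.2 (two_rpow_lt_one (neg_neg_of_pos (one_div_pos.2 (by linarith))))
  have hd₀ : (0 : ℝ) < d := by exact_mod_cast hd.bot_lt
  have h_base := base_pos hα hβ p
  have hα' : α - 1 ≠ 0 := by linarith
  set q := 1 / (α - 1) with hq
  have h_pow : ((d : ℝ) ^ (2 * α / d)) ^ d = (d : ℝ) ^ (2 * α) := by
    rw [← Real.rpow_mul_natCast hd₀.le, div_mul_cancel₀ _ hd₀.ne']
  have h_exp : (d : ℝ) ^ (2 * α * q) = d ^ 2 * ((d : ℝ) ^ 2) ^ q := by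
    rw [← Real.rpow_natCast, ← Real.rpow_mul hd₀.le, ← Real.rpow_add hd₀]
    congr 1
    rw [hq]
    push_cast
    field_simp
    ring
  have h_B : B d α β p ^ d
      = (1 - (2 : ℝ) ^ (-(1 / (β - 1)))) ^ d * (base α β p ^ d / d ^ (2 * α)) ^ q := by
    rw [B, ← base, mul_pow, ← Real.rpow_mul_natCast (by positivity), mul_comm q,
      Real.rpow_natCast_mul (by positivity), div_pow, h_pow]
  calc B d α β p ^ (-(d : ℝ)) = (B d α β p ^ d)⁻¹ := by
        rw [Real.rpow_neg, Real.rpow_natCast]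
        rw [B, ← base]
        positivity
    _ = ((1 - (2 : ℝ) ^ (-(1 / (β - 1))))⁻¹) ^ d * (d ^ (2 * α) / base α β p ^ d) ^ q := by
        rw [h_B, mul_inv, inv_pow, ← Real.inv_rpow (by positivity), inv_div]
    _ = ((1 - (2 : ℝ) ^ (-(1 / (β - 1))))⁻¹) ^ d * (d ^ 2 * (d ^ 2 / base α β p ^ d) ^ q) := by
        rw [Real.div_rpow (by positivity) (by positivity), ← Real.rpow_mul hd₀.le, h_exp,
          Real.div_rpow (by positivity) (by positivity), mul_div_assoc]

lemma sq_mul_sizeParam_rpow {α β : ℝ} (hα : 1 < α) (hβ : α < β) (p : ℝ≥0∞) (hd : d ≠ 0) {ε : ℝ}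
    (hε : 0 < ε) :
    d ^ 2 * sizeParam d α β p ε ^ (1 / (α - 1)) * ((1 - (2 : ℝ) ^ (-(1 / (β - 1))))⁻¹) ^ d
      = sizeConst α β p ^ (1 / (α - 1))
        * (B d α β p ^ (-(d : ℝ)) * ε⁻¹ ^ (1 / (α - 1))) := by
  have h_base := base_pos hα hβ p
  rw [B_rpow_neg hα hβ p hd, sizeParam, div_eq_mul_inv _ ε, mul_div_assoc,
    Real.mul_rpow (mul_nonneg (sizeConst_pos hα β p).le (by positivity)) (inv_nonneg.2 hε.le),
    Real.mul_rpow (sizeConst_pos hα β p).le (by positivity)]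
  ring

lemma one_le_sizeParam {α β : ℝ} (hα : 1 < α) (hβ : α < β) {p : ℝ≥0∞} {ε : ℝ} (hε : 0 < ε)
    (h : ε ≤ K₁ α β p * d ^ 2 / base α β p ^ d) : 1 ≤ sizeParam d α β p ε := by
  have h_base := base_pos hα hβ p
  rw [sizeParam, one_le_div hε]
  refine h.trans ?_
  gcongr
  exact le_max_left _ _

lemma natCast_le_two_rpow (n : ℕ) : (n : ℝ) ≤ (2 : ℝ) ^ (n : ℝ) := by
  rw [Real.rpow_natCast]
  exact_mod_cast Nat.lt_two_pow_self.le

lemma le_mul_max_logb {α ε : ℝ} (hα : 1 < α) (hε : 0 < ε)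
    (h : ε < d / ((2 : ℝ) ^ (α * d) * (1 - (2 : ℝ) ^ (1 - α)))) :
    (d : ℝ) ≤ (1 - Real.logb 2 (1 - (2 : ℝ) ^ (1 - α))) / (α - 1)
      * max 1 (Real.logb 2 ε⁻¹) := by
  have hr : 0 < 1 - (2 : ℝ) ^ (1 - α) := sub_pos.2 (two_rpow_lt_one (by linarith))
  have h_log : Real.logb 2 (1 - (2 : ℝ) ^ (1 - α)) ≤ 0 :=
    Real.logb_nonpos one_lt_two hr.le (sub_le_self _ (Real.rpow_pos_of_pos two_pos _).le)
  have h_lt : ε * ((2 : ℝ) ^ (α * d) * (1 - (2 : ℝ) ^ (1 - α))) < (2 : ℝ) ^ (d : ℝ) :=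
    ((lt_div_iff₀ (by positivity)).1 h).trans_le (natCast_le_two_rpow d)
  have h_logb_lt := Real.logb_lt_logb one_lt_two (by positivity) h_lt
  rw [Real.logb_rpow two_pos one_lt_two.ne', Real.logb_mul hε.ne' (by positivity),
    Real.logb_mul (by positivity) hr.ne', Real.logb_rpow two_pos one_lt_two.ne'] at h_logb_lt
  rw [div_mul_eq_mul_div, le_div_iff₀ (sub_pos.2 hα)]
  calc (d : ℝ) * (α - 1) ≤ Real.logb 2 ε⁻¹ - Real.logb 2 (1 - (2 : ℝ) ^ (1 - α)) := by
        rw [Real.logb_inv]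
        linarith
    _ ≤ max 1 (Real.logb 2 ε⁻¹)
        + -Real.logb 2 (1 - (2 : ℝ) ^ (1 - α)) * max 1 (Real.logb 2 ε⁻¹) := by
        rw [sub_eq_add_neg]
        gcongr
        · exact le_max_right _ _
        · exact le_mul_of_one_le_right (neg_nonneg.2 h_log) (le_max_left _ _)
    _ = (1 - Real.logb 2 (1 - (2 : ℝ) ^ (1 - α))) * max 1 (Real.logb 2 ε⁻¹) := by ring

lemma exists_two_pow_ge {r ε : ℝ} (hr₀ : 0 < r) (hr₁ : r ≤ 1) (hε₀ : 0 < ε) (hε₁ : ε ≤ 1)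
    (hd : 1 ≤ d) : ∃ M : ℕ, 8 * d ^ 2 / (r * ε) ≤ 2 ^ M ∧
      (M : ℝ) ≤ 4 + 2 * d - Real.logb 2 r + Real.logb 2 ε⁻¹ := by
  have h_one_le : (1 : ℝ) ≤ d := by exact_mod_cast hd
  have h_logb : Real.logb 2 (8 * d ^ 2 / (r * ε))
      = 3 + 2 * Real.logb 2 d - Real.logb 2 r + Real.logb 2 ε⁻¹ := by
    rw [Real.logb_div (by positivity) (by positivity),
      Real.logb_mul (by positivity) (by positivity), Real.logb_mul hr₀.ne' hε₀.ne', Real.logb_pow,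
      Real.logb_inv, show (8 : ℝ) = 2 ^ (3 : ℝ) by norm_num, Real.logb_rpow two_pos one_lt_two.ne']
    push_cast
    ring
  have h_one_le_arg : 1 ≤ 8 * d ^ 2 / (r * ε) := by
    rw [one_le_div (by positivity)]
    nlinarith [mul_le_one₀ hr₁ hε₀.le hε₁]
  have h_logb_le : Real.logb 2 d ≤ d :=
    (Real.logb_le_iff_le_rpow one_lt_two (by positivity)).2 (natCast_le_two_rpow d)
  refine ⟨⌈Real.logb 2 (8 * d ^ 2 / (r * ε))⌉₊, ?_, ?_⟩
  · rw [← Real.rpow_natCast 2, ← Real.logb_le_iff_le_rpow one_lt_two (by positivity)]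
    exact Nat.le_ceil _
  · linarith [Nat.ceil_lt_add_one (Real.logb_nonneg one_lt_two h_one_le_arg)]

lemma two_mul_half_pow_le_one {r ε : ℝ} (hr₀ : 0 < r) (hr₁ : r ≤ 1) (hε₀ : 0 < ε) (hε₁ : ε ≤ 1)
    {M : ℕ} (hM : 8 * d ^ 2 / (r * ε) ≤ (2 : ℝ) ^ M) : 2 * d * (1 / 2 : ℝ) ^ M ≤ 1 := by
  have h_sq : (d : ℝ) ≤ d ^ 2 := by exact_mod_cast Nat.le_self_pow two_ne_zero d
  rw [one_div, inv_pow, ← div_eq_mul_inv, div_le_one (by positivity)]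
  calc (2 * d : ℝ) ≤ 8 * d ^ 2 := by linarith [sq_nonneg (d : ℝ)]
    _ ≤ 8 * d ^ 2 / (r * ε) :=
        le_div_self (by positivity) (by positivity) (mul_le_one₀ hr₁ hε₀.le hε₁)
    _ ≤ 2 ^ M := hM

/-- The constant in the bound `M + 5 ≤ depthConst α * max 1 (logb 2 ε⁻¹)` for the number `M` of
iterations in an approximate multiplication. -/
def depthConst (α : ℝ) : ℝ :=
  10 + 2 * ((1 - Real.logb 2 (1 - (2 : ℝ) ^ (1 - α))) / (α - 1))
    - Real.logb 2 (1 - (2 : ℝ) ^ (1 - α))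

lemma depthConst_pos {α : ℝ} (hα : 1 < α) : 0 < depthConst α := by
  have hr : 0 < 1 - (2 : ℝ) ^ (1 - α) := sub_pos.2 (two_rpow_lt_one (by linarith))
  have h_log : Real.logb 2 (1 - (2 : ℝ) ^ (1 - α)) ≤ 0 :=
    Real.logb_nonpos one_lt_two hr.le (sub_le_self _ (Real.rpow_pos_of_pos two_pos _).le)
  have h_div : 0 ≤ (1 - Real.logb 2 (1 - (2 : ℝ) ^ (1 - α))) / (α - 1) :=
    div_nonneg (by linarith) (by linarith)
  unfold depthConst
  linarith

lemma exists_accuracy {α ε : ℝ} (hα : 1 < α) (hε₀ : 0 < ε) (hε₁ : ε ≤ 1) (hd : 1 ≤ d)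
    (h : ε < d / ((2 : ℝ) ^ (α * d) * (1 - (2 : ℝ) ^ (1 - α)))) :
    ∃ M : ℕ, 8 * d ^ 2 / ((1 - (2 : ℝ) ^ (1 - α)) * ε) ≤ 2 ^ M ∧
      2 * d * (1 / 2 : ℝ) ^ M ≤ 1 ∧ (M : ℝ) + 5 ≤ depthConst α * max 1 (Real.logb 2 ε⁻¹) := by
  have hr : 0 < 1 - (2 : ℝ) ^ (1 - α) := sub_pos.2 (two_rpow_lt_one (by linarith))
  have hr' : 1 - (2 : ℝ) ^ (1 - α) ≤ 1 := sub_le_self _ (Real.rpow_pos_of_pos two_pos _).le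
  have h_log := Real.logb_nonpos one_lt_two hr.le hr'
  have hd_le := le_mul_max_logb hα hε₀ h
  obtain ⟨M, hM, hM_le⟩ := exists_two_pow_ge hr hr' hε₀ hε₁ hd
  refine ⟨M, hM, two_mul_half_pow_le_one hr hr' hε₀ hε₁ hM, ?_⟩
  unfold depthConst
  nlinarith [le_max_left 1 (Real.logb 2 ε⁻¹), le_max_right 1 (Real.logb 2 ε⁻¹)]

lemma exists_two_rpow_mul_eq {a Y : ℝ} (ha : a ≠ 0) (hY : 0 < Y) :
    ∃ m : ℝ, (2 : ℝ) ^ (a * m) = Y ∧ (2 : ℝ) ^ m = Y ^ (1 / a) := by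
  have h_logb : (2 : ℝ) ^ Real.logb 2 Y = Y := Real.rpow_logb two_pos one_lt_two.ne' hY
  refine ⟨Real.logb 2 Y * (1 / a), ?_, ?_⟩
  · rw [mul_left_comm, mul_one_div_cancel ha, mul_one, h_logb]
  · rw [Real.rpow_mul zero_le_two, h_logb]

lemma natCast_depth_le {N M : ℕ} {Q R : ℝ} (hd : 1 ≤ d) (hQ : 1 ≤ Q) (hN : (N : ℝ) ≤ 2 * d * Q)
    (hM : (M : ℝ) + 5 ≤ R) : ((N * (d * (M + 3) + 1) + 2 : ℕ) : ℝ) ≤ 2 * R * (d ^ 2 * Q) := by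
  have h_one_le : (1 : ℝ) ≤ d := by exact_mod_cast hd
  have h_sq : (1 : ℝ) ≤ d ^ 2 * Q := one_le_mul_of_one_le_of_one_le (one_le_pow₀ h_one_le) hQ
  calc ((N * (d * (M + 3) + 1) + 2 : ℕ) : ℝ) = N * (d * (M + 3) + 1) + 2 := by push_cast; ring
    _ ≤ 2 * d * Q * (d * (M + 4)) + 2 * (d ^ 2 * Q) := by
        gcongr ?_ * ?_ + ?_ <;> linarith
    _ = 2 * (M + 5) * (d ^ 2 * Q) := by ring
    _ ≤ 2 * R * (d ^ 2 * Q) := by gcongr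

lemma one_le_inv_one_sub_two_rpow {t : ℝ} (ht : t < 0) : 1 ≤ (1 - (2 : ℝ) ^ t)⁻¹ :=
  (one_le_inv₀ (sub_pos.2 (two_rpow_lt_one ht))).2
    (sub_le_self _ (Real.rpow_pos_of_pos two_pos t).le)

lemma sum_card_positions_le_two_mul {β : ℝ} (hβ : 1 < β) (m : ℝ) :
    ((∑ k ∈ (finite_sparse d hβ m).toFinset, (positions k).card : ℕ) : ℝ)
      ≤ 2 * d * (2 ^ m * ((1 - (2 : ℝ) ^ (-(1 / (β - 1))))⁻¹) ^ d) := by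
  have h_inv := one_le_inv_one_sub_two_rpow (neg_neg_of_pos (one_div_pos.2 (sub_pos.2 hβ)))
  refine (sum_card_positions_le hβ m).trans ?_
  rw [← mul_assoc]
  gcongr
  exact Nat.sub_le d 1

lemma exists_parameters {α β : ℝ} (hα : 1 < α) (hβ : α < β) (p : ℝ≥0∞) :
    ∃ K₅ : ℝ, 0 < K₅ ∧ ∀ d : ℕ, 1 ≤ d → ∀ ε : ℝ, 0 < ε → ε < ε₀ d α β p → ∃ (m : ℝ) (M : ℕ),
      2 * d * (1 / 2 : ℝ) ^ M ≤ 1 ∧ totalError d α β p m M ≤ ε ∧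
      (((∑ k ∈ (finite_sparse d (hα.trans hβ) m).toFinset, (positions k).card)
          * (d * (M + 3) + 1) + 2 : ℕ) : ℝ)
        ≤ K₅ * B d α β p ^ (-(d : ℝ)) * ε⁻¹ ^ (1 / (α - 1)) * max 1 (Real.logb 2 ε⁻¹) := by
  have hα' : 0 < α - 1 := sub_pos.2 hα
  refine ⟨2 * depthConst α * sizeConst α β p ^ (1 / (α - 1)), ?_, fun d hd ε hε₀ hε => ?_⟩
  · have h_depth := depthConst_pos hα
    have h_size := sizeConst_pos hα β p
    positivity
  obtain ⟨hε_one, hε_dim, hε_size⟩ : ε < 1 ∧ _ ∧ _ := by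
    simpa only [ε₀, ← base_pow, lt_min_iff] using hε
  have h_size := one_le_sizeParam hα hβ hε₀ hε_size.le
  obtain ⟨m, hm, hm'⟩ := exists_two_rpow_mul_eq hα'.ne' (one_pos.trans_le h_size)
  obtain ⟨M, hM, hM_half, hM_le⟩ := exists_accuracy hα hε₀ hε_one.le hd hε_dim
  have h_inv := one_le_inv_one_sub_two_rpow
    (neg_neg_of_pos (one_div_pos.2 (sub_pos.2 (hα.trans hβ))))
  have h_factor : 1 ≤ (2 : ℝ) ^ m * ((1 - (2 : ℝ) ^ (-(1 / (β - 1))))⁻¹) ^ d := by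
    rw [hm']
    exact one_le_mul_of_one_le_of_one_le (Real.one_le_rpow h_size (by positivity))
      (one_le_pow₀ h_inv)
  refine ⟨m, M, hM_half, totalError_le hα hβ hd hε₀ hm hM, ?_⟩
  refine (natCast_depth_le hd h_factor (sum_card_positions_le_two_mul (hα.trans hβ) m)
    hM_le).trans_eq ?_
  rw [← mul_assoc (_ ^ 2), hm', sq_mul_sizeParam_rpow hα hβ p (by omega) hε₀]
  ring

lemma exists_net_gridApprox (M : ℕ) (L : Finset (Fin d → ℕ)) (f : (Fin d → ℝ) → ℝ) :
    ∃ Φ : Net (constShape d (d + 12) ((∑ k ∈ L, (positions k).card) * (d * (M + 3) + 1))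
      (Nat.le_add_left 1 (d + 11))), ∀ x, 0 ≤ x → Φ.output x = gridApprox M L f x := by
  obtain ⟨Φ, hΦ⟩ := exists_net_sum M (fun t => t.1) (fun t => t.2) (fun t => coef f t.1 t.2)
    (L.sigma positions)
  rw [← Finset.card_sigma]
  exact ⟨Φ, fun x hx => (hΦ x hx).trans (Finset.sum_sigma ..)⟩

end

end DeepReLU

/-- `K₄` is absolute, `K₅` depends on `α`, `β`, `p` only, and the architecture `A` (with
dimensions `D`) does not depend on `f`. -/
theorem corollary4p4 :
    ∃ K₄ : ℝ, 0 < K₄ ∧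
      ∀ (α β : ℝ) (p : ENNReal), 1 < α → α ≤ 2 → α < β → 1 ≤ p →
        ∃ K₅ : ℝ, 0 < K₅ ∧
          ∀ d : ℕ, 2 ≤ d → ∀ ε : ℝ, 0 < ε → ε < DeepReLU.ε₀ d α β p →
            ∃ (D : DeepReLU.NetShape d) (A : DeepReLU.Net D), A.IsArchitecture ∧
              (D.width : ℝ) ≤ K₄ * d ∧
              (D.depth : ℝ) ≤ K₅ * (DeepReLU.B d α β p) ^ (-(d : ℝ)) *
                (ε⁻¹) ^ (1 / (α - 1)) * max 1 (Real.logb 2 ε⁻¹) ∧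
              ∀ f : (Fin d → ℝ) → ℝ, DeepReLU.InUnitBall α f →
                ∃ Φ : DeepReLU.Net D, Φ.HasArchitecture A ∧
                  DeepReLU.MemW10 p (fun x => f x - Φ.output x) ∧
                  DeepReLU.w10Norm p (fun x => f x - Φ.output x) ≤ ENNReal.ofReal ε := by
  refine ⟨7, by norm_num, fun α β p hα _ hβ hp => ?_⟩
  obtain ⟨K₅, hK₅, h_parameters⟩ := DeepReLU.exists_parameters hα hβ p
  refine ⟨K₅, hK₅, fun d hd ε hε₀ hε => ?_⟩
  obtain ⟨m, M, hM, h_error, h_depth⟩ := h_parameters d (one_le_two.trans hd) ε hε₀ hε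
  refine ⟨DeepReLU.constShape d (d + 12) _ (Nat.le_add_left 1 (d + 11)),
    ⟨fun _ _ _ => 1, fun _ _ => 1⟩, fun _ _ => ⟨fun _ _ => .inr rfl, fun _ => .inr rfl⟩, ?_,
    h_depth, fun f hf => ?_⟩
  · exact_mod_cast (DeepReLU.width_constShape_le _ (Nat.le_add_left 1 (d + 11))
      (Nat.le_add_right d 12)).trans (show d + 12 ≤ 7 * d by omega)
  · obtain ⟨Φ, hΦ⟩ := DeepReLU.exists_net_gridApprox M
      (DeepReLU.finite_sparse d (hα.trans hβ) m).toFinset (f ∘ DeepReLU.clamp)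
    have h_norm := hf.memW10_and_w10Norm_le hα hβ hp m hM
      (u := fun x => f x - Φ.output x) fun x hx => congrArg (f x - ·) (hΦ x hx.1)
    exact ⟨Φ, fun _ _ => ⟨fun _ _ h => absurd h one_ne_zero, fun _ h => absurd h one_ne_zero⟩,
      h_norm.1, h_norm.2.trans (ENNReal.ofReal_le_ofReal h_error)⟩
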